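/- **Setting.** Let $R$ be a commutative ring. Let $u\mathcal C$ be a unitary, reduced, unital Hopf cooperad in differential graded $R$-modules: a symmetric cooperad (given by partial decomposition maps, with cooperadic counit) whose components $u\mathcal C(r)$ are unital associative dg algebras and whose structure maps are maps of dg algebras, with $u\mathcal C(0)=R$ and $u\mathcal C(1)=R$. Assume that every $u\mathcal C(r)$ is free as a graded $R[S_r]$-module, or that $\mathbb Q\subseteq R$. Let $V$ be a graded $R$-module with a complete Hausdorff descending filtration $V=F^1V\supseteq F^2V\supseteq\cdots$ by graded submodules. Let $\widehat{u\mathcal C(V)}$ be the cofree $u\mathcal C$-coalgebra $\bigoplus_{n\ge 0}(u\mathcal C(n)\otimes V^{\otimes n})_{S_n}$, completed with respect to the filtration induced by $V$, with structure maps $\delta_k$, $k\ge0$, landing in the completed tensor products $u\mathcal C(k)\,\widehat\otimes\,\widehat{u\mathcal C(V)}^{\widehat\otimes k}$. A *curved $\Omega\mathcal C$-algebra* structure on $V$ is an $R$-linear map $Q:\widehat{u\mathcal C(V)}\to\widehat{u\mathcal C(V)}$ of degree $-1$ which preserves the filtration, maps elements of bounded arity to elements of bounded arity, is a coderivation over the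 dg cooperad $u\mathcal C$, i.e. $$\delta_k Q=\Big(d\otimes 1+\sum_{j=1}^k 1\otimes(1\otimes\cdots\otimes \underset{j}{Q}\otimes\cdots\otimes 1)\Big)\delta_k\qquad(k\ge 0),$$ and satisfies $Q^2=0$. Let $\mathbb 1\in\widehat{u\mathcal C(V)}$ be the unit of $u\mathcal C(0)=R$, and let $\star$ be the generalized shuffle product on $\widehat{u\mathcal C(V)}$, $$(c\otimes x_1\cdots x_n)\star(c'\otimes y_1\cdots y_m)=\pm\,(c_1\cdot c'_1)\otimes x_1\cdots x_n\,y_1\cdots y_m ,$$ where $c_1,c_1'\in u\mathcal C(n+m)$ are obtained from $c$ and $c'$ by the maps $u\mathcal C(r)\to u\mathcal C(r+1)$ dual to plugging the arity-zero operation into the additional inputs, $\cdot$ is the Hopf product of $u\mathcal C(n+m)$, and the sign is the Koszul sign. Let $R[G]$ be the group algebra of the additive group of $R$, with basis $g_r$ ($r\in R$), $g_rg_s=g_{r+s}$, and with the $u\mathcal C$-coalgebra structure $\delta_k(g_r)=1_{u\mathcal C(k)}\otimes g_r^{\otimes k}$. For $v\in V_0$ let $\gamma_v:R[G]\to(\widehat{u\mathcal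 C(V)},\star,\mathbb 1)$ be the degree $0$ morphism of $u\mathcal C$-coalgebras and of unital algebras such that, for every $r\in R$, the arity $1$ component of $\gamma_v(g_r)$ is $rv\in V$. Set $\exp(v):=\gamma_v(g_1)$. **Theorem.** Let $Q$ be a curved $\Omega\mathcal C$-algebra structure on $V$ and let $v\in V_0$. Then $\gamma_v$ exists and is unique (for every $v\in V_0$, so in particular $\exp(v)$ and $\exp(-v)$ are well defined), and $$Q^v(x):=\exp(-v)\star Q\big(\exp(v)\star x\big)$$ is again a coderivation of degree $-1$ with $(Q^v)^2=0$, preserving the filtration and the elements of bounded arity. Hence the twist of a curved $\Omega\mathcal C$-algebra is again a curved $\Omega\mathcal C$-algebra. -/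

import Mathlib

open scoped TensorProduct DirectSum

universe u v w

noncomputable section

namespace CurvedTwist

/-! ### Graded modules and Koszul signs -/

section Graded

variable {R : Type u} [CommRing R] {M : Type v} [AddCommGroup M] [Module R M]
  (𝒜 : ℤ → Submodule R M) [DirectSum.Decomposition 𝒜]

/-- The endomorphism of a graded module multiplying the degree `i` part by `χ i`. -/
def scaleByDegree (χ : ℤ → R) : M →ₗ[R] M :=
  DirectSum.coeLinearMap 𝒜 ∘ₗ DirectSum.lmap (fun i => χ i • LinearMap.id) ∘ₗ
    (DirectSum.decomposeLinearEquiv 𝒜).toLinearMap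

open Classical in
/-- The projection to the part of even (`b = false`) or odd (`b = true`) degree. -/
def parityPart (b : Bool) : M →ₗ[R] M :=
  scaleByDegree 𝒜 (fun i => if (Odd i ↔ b = true) then 1 else 0)

/-- The involution `x ↦ (-1)^|x| x`. -/
def signInv : M →ₗ[R] M := parityPart 𝒜 false - parityPart 𝒜 true

/-- The switch `x ⊗ y ↦ (-1)^(|x||y|) y ⊗ x`. -/
def koszulSwap {N : Type w} [AddCommGroup N] [Module R N]
    (ℬ : ℤ → Submodule R N) [DirectSum.Decomposition ℬ] : M ⊗[R] N →ₗ[R] N ⊗[R] M :=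
  (TensorProduct.comm R M N).toLinearMap ∘ₗ
    (TensorProduct.map (parityPart 𝒜 false) LinearMap.id +
      TensorProduct.map (parityPart 𝒜 true) (signInv ℬ))

/-- The degree `i` part of a tensor product. -/
def tensorDeg {N : Type w} [AddCommGroup N] [Module R N] (ℬ : ℤ → Submodule R N) (i : ℤ) :
    Submodule R (M ⊗[R] N) :=
  ⨆ p : ℤ, Submodule.map₂ (TensorProduct.mk R M N) (𝒜 p) (ℬ (i - p))

/-- The Koszul sign of `e` acting on a tensor whose `i`-th factor is odd if and only if
`ε i = true`: each inverted pair of odd factors contributes `-1`. -/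
def koszulSign {m n : ℕ} (e : Fin m ≃ Fin n) (ε : Fin m → Bool) : ℤ :=
  ∏ i, ∏ j, if i < j ∧ e j < e i ∧ ε i = true ∧ ε j = true then -1 else 1

/-- The action of `e` on `M^{⊗m}` with Koszul signs: the factor in position `i` moves to position
`e i`. -/
def signedReindex {m n : ℕ} (e : Fin m ≃ Fin n) : ⨂[R]^m M →ₗ[R] ⨂[R]^n M :=
  ∑ ε : Fin m → Bool, (koszulSign e ε : R) •
    ((PiTensorProduct.reindex R (fun _ => M) e).toLinearMap ∘ₗ
      PiTensorProduct.map (fun i => parityPart 𝒜 (ε i)))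

end Graded

/-! ### Bijections of finite ordinals -/

/-- The block sum of two bijections. -/
def finSum {a a' b b' : ℕ} (σ : Fin a ≃ Fin a') (τ : Fin b ≃ Fin b') :
    Fin (a + b) ≃ Fin (a' + b') :=
  finSumFinEquiv.symm.trans ((Equiv.sumCongr σ τ).trans finSumFinEquiv)

/-- Exchange of the last two of three blocks. -/
def finSwap (a b c : ℕ) : Fin (a + b + c) ≃ Fin (a + c + b) :=
  (finCongr (Nat.add_assoc a b c)).trans
    ((finSum (Equiv.refl (Fin a)) finAddFlip).trans (finCongr (Nat.add_assoc a c b).symm))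

/-- A symmetric sequence of differential graded unital associative `R`-algebras, as a functor on
the groupoid of the sets `Fin n` and bijections. -/
structure DGAlgSeq (R : Type u) [CommRing R] where
  obj : ℕ → Type w
  [ring : ∀ n, Ring (obj n)]
  [algebra : ∀ n, Algebra R (obj n)]
  deg : ∀ n, ℤ → Submodule R (obj n)
  [graded : ∀ n, GradedAlgebra (deg n)]
  d : ∀ n, obj n →ₗ[R] obj n
  d_deg : ∀ n i, ∀ x ∈ deg n i, d n x ∈ deg n (i - 1)
  d_d : ∀ n x, d n (d n x) = 0
  d_mul : ∀ n x y, d n (x * y) = d n x * y + signInv (deg n) x * d n y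
  map : ∀ {m n : ℕ}, (Fin m ≃ Fin n) → (obj m →ₐ[R] obj n)
  map_refl : ∀ n x, map (Equiv.refl (Fin n)) x = x
  map_trans : ∀ {l m n : ℕ} (e : Fin l ≃ Fin m) (f : Fin m ≃ Fin n) x,
    map (e.trans f) x = map f (map e x)
  map_deg : ∀ {m n : ℕ} (e : Fin m ≃ Fin n) i, ∀ x ∈ deg m i, map e x ∈ deg n i
  map_d : ∀ {m n : ℕ} (e : Fin m ≃ Fin n) x, map e (d m x) = d n (map e x)

attribute [instance] DGAlgSeq.ring DGAlgSeq.algebra DGAlgSeq.graded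

/-- A reduced unitary unital Hopf cooperad `u𝒞` over `R`, that is, a cooperad in differential graded
unital associative algebras with `u𝒞(0) = R` and `u𝒞(1) = R`. The cooperad structure is given
by the partial decompositions `u𝒞(a + b) → u𝒞(a + 1) ⊗ u𝒞(b)` (dual to inserting an operation
with `b` inputs into the last input of an operation with `a + 1` inputs); all other partial
decompositions follow from these by the symmetric group actions. The target of `decomp` carries
the tensor product algebra structure with Koszul signs. -/
structure HopfCooperad (R : Type u) [CommRing R] extends DGAlgSeq.{u, w} R where
  decomp : ∀ a b, obj (a + b) →ₐ[R] (deg (a + 1) ᵍ⊗[R] deg b)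
  /-- The cooperadic counit, which is an isomorphism because `u𝒞` is reduced. -/
  counit : obj 1 ≃ₐ[R] R
  /-- The identification `u𝒞(0) = R`. -/
  unitary : obj 0 ≃ₐ[R] R
  decomp_deg : ∀ a b i, ∀ x ∈ deg (a + b) i,
    (GradedTensorProduct.of R (deg (a + 1)) (deg b)).symm (decomp a b x) ∈
      tensorDeg (deg (a + 1)) (deg b) i
  decomp_d : ∀ a b x,
    (GradedTensorProduct.of R (deg (a + 1)) (deg b)).symm (decomp a b (d (a + b) x)) =
      TensorProduct.map (d (a + 1)) LinearMap.id
          ((GradedTensorProduct.of R (deg (a + 1)) (deg b)).symm (decomp a b x)) +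
        TensorProduct.map (signInv (deg (a + 1))) (d b)
          ((GradedTensorProduct.of R (deg (a + 1)) (deg b)).symm (decomp a b x))
  /-- Equivariance. -/
  decomp_map : ∀ {a a' b b' : ℕ} (σ : Fin a ≃ Fin a') (τ : Fin b ≃ Fin b') x,
    (GradedTensorProduct.of R (deg (a' + 1)) (deg b')).symm
        (decomp a' b' (map (finSum σ τ) x)) =
      TensorProduct.map (map (finSum σ (Equiv.refl (Fin 1)))).toLinearMap (map τ).toLinearMap
        ((GradedTensorProduct.of R (deg (a + 1)) (deg b)).symm (decomp a b x))
  /-- The right counit axiom. -/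
  decomp_counit : ∀ a x,
    TensorProduct.rid R (obj (a + 1)) (TensorProduct.map LinearMap.id counit.toLinearMap
      ((GradedTensorProduct.of R (deg (a + 1)) (deg 1)).symm (decomp a 1 x))) = x
  /-- The left counit axiom. -/
  counit_decomp : ∀ b x,
    TensorProduct.lid R (obj b) (TensorProduct.map counit.toLinearMap LinearMap.id
      ((GradedTensorProduct.of R (deg (0 + 1)) (deg b)).symm (decomp 0 b x))) =
      map (finCongr (Nat.zero_add b)) x
  /-- Sequential coassociativity. -/
  coassoc_seq : ∀ a b c x,
    TensorProduct.map LinearMap.id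
        ((GradedTensorProduct.of R (deg (b + 1)) (deg c)).symm.toLinearMap ∘ₗ
          (decomp b c).toLinearMap)
        ((GradedTensorProduct.of R (deg (a + 1)) (deg (b + c))).symm (decomp a (b + c) x)) =
      TensorProduct.assoc R _ _ _
        (TensorProduct.map
          ((GradedTensorProduct.of R (deg (a + 1)) (deg (b + 1))).symm.toLinearMap ∘ₗ
            (decomp a (b + 1)).toLinearMap) LinearMap.id
          ((GradedTensorProduct.of R (deg (a + b + 1)) (deg c)).symm
            (decomp (a + b) c (map (finCongr (Nat.add_assoc a b c).symm) x))))
  /-- Parallel coassociativity. -/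
  coassoc_par : ∀ a b c x,
    TensorProduct.map LinearMap.id (koszulSwap (deg b) (deg c))
      (TensorProduct.assoc R _ _ _
        (TensorProduct.map
          ((TensorProduct.map (map (finSwap a 1 1)).toLinearMap LinearMap.id) ∘ₗ
            (GradedTensorProduct.of R (deg (a + 1 + 1)) (deg b)).symm.toLinearMap ∘ₗ
            (decomp (a + 1) b).toLinearMap ∘ₗ (map (finSwap a b 1)).toLinearMap) LinearMap.id
          ((GradedTensorProduct.of R (deg (a + b + 1)) (deg c)).symm (decomp (a + b) c x)))) =
      TensorProduct.assoc R _ _ _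
        (TensorProduct.map
          ((GradedTensorProduct.of R (deg (a + 1 + 1)) (deg c)).symm.toLinearMap ∘ₗ
            (decomp (a + 1) c).toLinearMap ∘ₗ (map (finSwap a c 1)).toLinearMap) LinearMap.id
          ((GradedTensorProduct.of R (deg (a + c + 1)) (deg b)).symm
            (decomp (a + c) b (map (finSwap a b c) x))))

/-- A graded `R`-module `V` with a complete descending filtration
`V = F¹V ⊇ F²V ⊇ ⋯` by graded submodules. -/
structure CompleteGradedModule (R : Type u) [CommRing R] where
  carrier : Type v
  [addCommGroup : AddCommGroup carrier]
  [module : Module R carrier]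
  deg : ℤ → Submodule R carrier
  [decomposition : DirectSum.Decomposition deg]
  F : ℕ → Submodule R carrier
  F_antitone : Antitone F
  F_one : F 1 = ⊤
  F_graded : ∀ N, ∀ x ∈ F N, ∀ i, (DirectSum.decompose deg x i : carrier) ∈ F N
  F_separated : ⨅ N, F N = ⊥
  F_complete : ∀ i (x : ℕ → carrier), (∀ N, x N ∈ deg i) → (∀ N, x (N + 1) - x N ∈ F N) →
    ∃ y ∈ deg i, ∀ N, y - x N ∈ F N

attribute [instance] CompleteGradedModule.addCommGroup CompleteGradedModule.module
  CompleteGradedModule.decomposition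

section Cofree

variable {R : Type u} [CommRing R] (C : HopfCooperad.{u, w} R)

namespace HopfCooperad

/-- The partial decomposition with values in the plain tensor product. -/
def partialDecomp (a b : ℕ) : C.obj (a + b) →ₗ[R] C.obj (a + 1) ⊗[R] C.obj b :=
  (GradedTensorProduct.of R (C.deg (a + 1)) (C.deg b)).symm.toLinearMap ∘ₗ
    (C.decomp a b).toLinearMap

/-- Every `u𝒞(r)` is free as a graded `R[S_r]`-module. -/
def IsSymmetricFree : Prop :=
  ∀ r, ∃ (ι : Type w) (b : ι → C.obj r), (∀ i, ∃ k, b i ∈ C.deg r k) ∧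
    LinearIndependent R (fun p : ι × Equiv.Perm (Fin r) => C.map p.2 (b p.1)) ∧
    Submodule.span R (Set.range fun p : ι × Equiv.Perm (Fin r) => C.map p.2 (b p.1)) = ⊤

/-- The map `u𝒞(n) → u𝒞(n + 1) ⊗ u𝒞(0) = u𝒞(n + 1)`, dual to inserting the unitary operation
into the last input. -/
def addInput (n : ℕ) : C.obj n →ₗ[R] C.obj (n + 1) :=
  (TensorProduct.rid R (C.obj (n + 1))).toLinearMap ∘ₗ
    TensorProduct.map LinearMap.id C.unitary.toLinearMap ∘ₗ C.partialDecomp n 0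

/-- The map `u𝒞(n) → u𝒞(n + m)`, dual to inserting unitary operations into the last `m` inputs. -/
def addInputs (n : ℕ) : ∀ m, C.obj n →ₗ[R] C.obj (n + m)
  | 0 => LinearMap.id
  | m + 1 => C.addInput (n + m) ∘ₗ addInputs n m

/-- The map `u𝒞(m) → u𝒞(n + m)`, dual to inserting unitary operations into the first `n` inputs. -/
def addInputsLeft (n m : ℕ) : C.obj m →ₗ[R] C.obj (n + m) :=
  (C.map finAddFlip).toLinearMap ∘ₗ C.addInputs m n

end HopfCooperad

variable (V : CompleteGradedModule.{u, v} R)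

/-- `u𝒞(n + p) ⊗ V^{⊗n}`. -/
abbrev Cell (p n : ℕ) : Type _ := C.obj (n + p) ⊗[R] (⨂[R]^n V.carrier)

/-- The direct sum of the `u𝒞(n + p) ⊗ V^{⊗n}`, without coinvariants and without completion:
operations with `p` marked inputs, all other inputs being decorated by elements of `V`. -/
abbrev Words (p : ℕ) : Type _ := ⨁ n, Cell C V p n

instance (p : ℕ) : AddCommGroup (Words C V p) :=
  { (inferInstance : AddCommMonoid (Words C V p)), (inferInstance : AddCommGroup (Words C V p)) with }

/-- The diagonal action of `e` with Koszul signs; the marked inputs are fixed. -/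
def act (p : ℕ) {m n : ℕ} (e : Fin m ≃ Fin n) : Cell C V p m →ₗ[R] Cell C V p n :=
  TensorProduct.map (C.map (finSum e (Equiv.refl (Fin p)))).toLinearMap (signedReindex V.deg e)

/-- The submodule spanned by the `σ z - z`: the quotient by it is
`⨁ n, (u𝒞(n) ⊗ V^{⊗n})_{S_n}`. -/
def coinvRel : Submodule R (Words C V 0) :=
  Submodule.span R {y | ∃ (n : ℕ) (σ : Equiv.Perm (Fin n)) (z : Cell C V 0 n),
    y = DirectSum.lof R ℕ (Cell C V 0) n (act C V 0 σ z) - DirectSum.lof R ℕ (Cell C V 0) n z}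

/-- The filtration of `⨁ n, u𝒞(n) ⊗ V^{⊗n}` induced by that of `V`. -/
def wordFil (N : ℕ) : Submodule R (Words C V 0) :=
  Submodule.span R {y | ∃ (n : ℕ) (c : C.obj n) (x : Fin n → V.carrier) (w : Fin n → ℕ),
    (∀ i, x i ∈ V.F (w i)) ∧ N ≤ ∑ i, w i ∧
    y = DirectSum.lof R ℕ (Cell C V 0) n (c ⊗ₜ PiTensorProduct.tprod R x)}

/-- The degree `k` part of `⨁ n, u𝒞(n) ⊗ V^{⊗n}`. -/
def wordDeg (k : ℤ) : Submodule R (Words C V 0) :=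
  Submodule.span R {y | ∃ (n : ℕ) (i : ℤ) (c : C.obj n) (x : Fin n → V.carrier) (f : Fin n → ℤ),
    c ∈ C.deg n i ∧ (∀ j, x j ∈ V.deg (f j)) ∧ i + ∑ j, f j = k ∧
    y = DirectSum.lof R ℕ (Cell C V 0) n (c ⊗ₜ PiTensorProduct.tprod R x)}

/-- The involution `(-1)^degree`. -/
def wordSign : Words C V 0 →ₗ[R] Words C V 0 :=
  DirectSum.lmap fun n => TensorProduct.map (signInv (C.deg n))
    (PiTensorProduct.map fun _ => signInv V.deg)

/-- `C₁ ⊗ C₂ ⊗ V^{⊗a} ⊗ V^{⊗b} → (C₁ ⊗ V^{⊗a}) ⊗ (C₂ ⊗ V^{⊗b})`, with the Koszul sign. -/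
def distribute (k l a b : ℕ) :
    (C.obj k ⊗[R] C.obj l) ⊗[R] ((⨂[R]^a V.carrier) ⊗[R] (⨂[R]^b V.carrier)) →ₗ[R]
      (C.obj k ⊗[R] (⨂[R]^a V.carrier)) ⊗[R] (C.obj l ⊗[R] (⨂[R]^b V.carrier)) :=
  (TensorProduct.tensorTensorTensorComm R _ _ _ _).toLinearMap ∘ₗ
    (TensorProduct.map (TensorProduct.map LinearMap.id (parityPart (C.deg l) false))
        LinearMap.id +
      TensorProduct.map (TensorProduct.map LinearMap.id (parityPart (C.deg l) true))
        (TensorProduct.map (PiTensorProduct.map fun _ => signInv V.deg) LinearMap.id))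

/-- The order preserving bijections of `s` and its complement with initial segments. -/
def splitEquiv {n : ℕ} (s : Finset (Fin n)) : Fin n ≃ Fin (s.card + sᶜ.card) :=
  (finSumEquivOfFinset (s := s) rfl rfl).symm.trans finSumFinEquiv

/-- The sum, over all subsets `s` of the decorated inputs, of the partial decomposition which
splits off an operation on the inputs outside `s`; the input of the remaining operation which
is created in this way becomes the last marked input. -/
def peel (p : ℕ) : Words C V p →ₗ[R] Words C V (p + 1) ⊗[R] Words C V 0 :=
  DirectSum.toModule R ℕ _ fun n => ∑ s : Finset (Fin n),
    TensorProduct.map (DirectSum.lof R ℕ (Cell C V (p + 1)) s.card)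
        (DirectSum.lof R ℕ (Cell C V 0) sᶜ.card) ∘ₗ
      distribute C V (s.card + (p + 1)) sᶜ.card s.card sᶜ.card ∘ₗ
      TensorProduct.map
        (C.partialDecomp (s.card + p) sᶜ.card ∘ₗ
          (C.map (finSwap s.card sᶜ.card p)).toLinearMap)
        (TensorPower.mulEquiv (n := s.card) (m := sᶜ.card)).symm.toLinearMap ∘ₗ
      act C V p (splitEquiv s)

/-- `x ⊗ (y₁ ⊗ ⋯ ⊗ y_k) ↦ x ⊗ y₁ ⊗ ⋯ ⊗ y_k`. -/
def consTensor (W : Type v) [AddCommGroup W] [Module R W] (k : ℕ) :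
    W ⊗[R] (⨂[R]^k W) →ₗ[R] ⨂[R]^(k + 1) W :=
  TensorProduct.lift (PiTensorProduct.lift.toLinearMap ∘ₗ
    (PiTensorProduct.tprod R (s := fun _ : Fin (k + 1) => W)).curryLeft)

/-- Splitting off `k` operations one after the other. The factor split off last comes first. -/
def iterPeel : ∀ k : ℕ, Words C V 0 →ₗ[R] Words C V k ⊗[R] (⨂[R]^k (Words C V 0))
  | 0 => (TensorProduct.mk R _ _).flip (PiTensorProduct.tprod R Fin.elim0)
  | k + 1 => TensorProduct.map LinearMap.id (consTensor (Words C V 0) k) ∘ₗ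
      (TensorProduct.assoc R _ _ _).toLinearMap ∘ₗ
      TensorProduct.map (peel C V k) LinearMap.id ∘ₗ iterPeel k

/-- The projection to the operations all of whose inputs are marked. The marked inputs are
renumbered in reverse order, so that the input marked last comes first. -/
def rootPart (k : ℕ) : Words C V k →ₗ[R] C.obj k :=
  (C.map ((finCongr (Nat.zero_add k)).trans Fin.revPerm)).toLinearMap ∘ₗ
    (TensorProduct.rid R (C.obj (0 + k))).toLinearMap ∘ₗ
    TensorProduct.map LinearMap.id (PiTensorProduct.isEmptyEquiv (Fin 0)).toLinearMap ∘ₗ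
    DirectSum.component R ℕ (Cell C V k) 0

/-- The arity `k` structure map `δ_k : D → u𝒞(k) ⊗ D^{⊗k}` of the cofree coalgebra
`D = ⨁ n, (u𝒞(n) ⊗ V^{⊗n})_{S_n}`, on representatives: the sum over all ways of distributing the
inputs over `k` blocks (possibly empty) of the decomposition of the operation into operations on
the blocks and one operation on top. Its values are invariant under `S_k`; if the norm map from
coinvariants to invariants is an isomorphism, then this is the same as a structure map with
values in `(u𝒞(k) ⊗ D^{⊗k})_{S_k}`. -/
def coproduct (k : ℕ) : Words C V 0 →ₗ[R] C.obj k ⊗[R] (⨂[R]^k (Words C V 0)) :=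
  TensorProduct.map (rootPart C V k) LinearMap.id ∘ₗ iterPeel C V k

/-- The projection to the cogenerators. -/
def tangent : Words C V 0 →ₗ[R] V.carrier :=
  (TensorProduct.lid R V.carrier).toLinearMap ∘ₗ
    TensorProduct.map C.counit.toLinearMap
      (PiTensorProduct.subsingletonEquiv (0 : Fin 1)).toLinearMap ∘ₗ
    DirectSum.component R ℕ (Cell C V 0) 1

end Cofree


/-! ### Auxiliary facts on signs -/

section GradedLemmas

variable {R : Type u} [CommRing R] {M : Type v} [AddCommGroup M] [Module R M]
  (𝒜 : ℤ → Submodule R M) [DirectSum.Decomposition 𝒜]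

theorem scaleByDegree_apply_of_mem (χ : ℤ → R) {i : ℤ} {x : M} (hx : x ∈ 𝒜 i) :
    scaleByDegree 𝒜 χ x = χ i • x := by
  lift x to 𝒜 i using hx
  simp [scaleByDegree, DirectSum.decomposeLinearEquiv_apply, DirectSum.lmap_of]

theorem scaleByDegree_mem {χ : ℤ → R} {F : Submodule R M}
    (hF : ∀ x ∈ F, ∀ i, (DirectSum.decompose 𝒜 x i : M) ∈ F) {x : M} (hx : x ∈ F) :
    scaleByDegree 𝒜 χ x ∈ F := by
  classical
  rw [← DirectSum.sum_support_decompose 𝒜 x, map_sum]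
  refine Submodule.sum_mem _ fun i _ => ?_
  rw [scaleByDegree_apply_of_mem 𝒜 χ (SetLike.coe_mem _)]
  exact F.smul_mem _ (hF x hx i)

theorem map_scaleByDegree {N : Type w} [AddCommGroup N] [Module R N]
    (ℬ : ℤ → Submodule R N) [DirectSum.Decomposition ℬ] (χ : ℤ → R) (f : M →ₗ[R] N)
    (hf : ∀ i, ∀ x ∈ 𝒜 i, f x ∈ ℬ i) (x : M) :
    f (scaleByDegree 𝒜 χ x) = scaleByDegree ℬ χ (f x) := by
  classical
  rw [← DirectSum.sum_support_decompose 𝒜 x]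
  simp only [map_sum]
  refine Finset.sum_congr rfl fun i _ => ?_
  rw [scaleByDegree_apply_of_mem 𝒜 χ (SetLike.coe_mem _),
    scaleByDegree_apply_of_mem ℬ χ (hf i _ (SetLike.coe_mem _)), map_smul]

theorem scaleByDegree_scaleByDegree (χ ψ : ℤ → R) (x : M) :
    scaleByDegree 𝒜 χ (scaleByDegree 𝒜 ψ x) = scaleByDegree 𝒜 (fun i => χ i * ψ i) x := by
  classical
  rw [← DirectSum.sum_support_decompose 𝒜 x]
  simp only [map_sum]
  refine Finset.sum_congr rfl fun i _ => ?_
  simp only [scaleByDegree_apply_of_mem 𝒜 _ (SetLike.coe_mem (DirectSum.decompose 𝒜 x i)), map_smul,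
    smul_smul, mul_comm]

theorem parityPart_false_add_true (x : M) :
    parityPart 𝒜 false x + parityPart 𝒜 true x = x := by
  classical
  rw [← DirectSum.sum_support_decompose 𝒜 x]
  simp only [map_sum, ← Finset.sum_add_distrib]
  refine Finset.sum_congr rfl fun i _ => ?_
  simp only [parityPart, scaleByDegree_apply_of_mem 𝒜 _
    (SetLike.coe_mem (DirectSum.decompose 𝒜 x i))]
  by_cases h : Odd i <;> simp [h]

theorem parityPart_signInv (b : Bool) (x : M) :
    parityPart 𝒜 b (signInv 𝒜 x) = signInv 𝒜 (parityPart 𝒜 b x) := by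
  simp only [signInv, LinearMap.sub_apply, map_sub, parityPart, scaleByDegree_scaleByDegree,
    mul_comm]

theorem signedReindex_tprod {m n : ℕ} (e : Fin m ≃ Fin n) (x : Fin m → M) :
    signedReindex 𝒜 e (PiTensorProduct.tprod R x) = ∑ ε : Fin m → Bool, (koszulSign e ε : R) •
      PiTensorProduct.tprod R (fun i => parityPart 𝒜 (ε (e.symm i)) (x (e.symm i))) := by
  simp only [signedReindex, LinearMap.sum_apply, LinearMap.smul_apply, LinearMap.comp_apply,
      PiTensorProduct.map_tprod, LinearEquiv.coe_coe, PiTensorProduct.reindex_tprod]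

theorem map_signInv_signedReindex {m n : ℕ} (e : Fin m ≃ Fin n) (t : ⨂[R]^m M) :
    PiTensorProduct.map (fun _ => signInv 𝒜) (signedReindex 𝒜 e t) =
      signedReindex 𝒜 e (PiTensorProduct.map (fun _ => signInv 𝒜) t) := by
  induction t using PiTensorProduct.induction_on with
  | add a b ha hb => simp only [map_add, ha, hb]
  | smul_tprod r f =>
    simp only [map_smul]
    congr 1
    simp only [signedReindex_tprod, PiTensorProduct.map_tprod, map_sum, map_smul,
      parityPart_signInv]

theorem signedReindex_refl (n : ℕ) (t : ⨂[R]^n M) :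
    signedReindex 𝒜 (Equiv.refl (Fin n)) t = t := by
  classical
  have hs : ∀ ε : Fin n → Bool, koszulSign (Equiv.refl (Fin n)) ε = 1 := by
    intro ε
    refine Finset.prod_eq_one fun i _ => Finset.prod_eq_one fun j _ => ?_
    rw [if_neg]
    rintro ⟨h1, h2, -⟩
    exact absurd (h1.trans h2) (lt_irrefl _)
  induction t using PiTensorProduct.induction_on with
  | add a b ha hb => simp only [map_add, ha, hb]
  | smul_tprod r f =>
    simp only [map_smul]
    congr 1
    simp only [signedReindex_tprod, hs, Int.cast_one, one_smul, Equiv.refl_symm,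
      Equiv.refl_apply]
    rw [← (PiTensorProduct.tprod R).map_sum (fun i (b : Bool) => parityPart 𝒜 b (f i))]
    congr 1
    funext i
    rw [Fintype.sum_bool, add_comm, parityPart_false_add_true]

theorem koszulSign_finSum {a a' b b' : ℕ} (σ : Fin a ≃ Fin a') (τ : Fin b ≃ Fin b')
    (ε : Fin a → Bool) (ε' : Fin b → Bool) :
    koszulSign (finSum σ τ) (Fin.append ε ε') = koszulSign σ ε * koszulSign τ ε' := by
  have hl : ∀ i, finSum σ τ (Fin.castAdd b i) = Fin.castAdd b' (σ i) := by
    intro i; simp [finSum]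
  have hr : ∀ i, finSum σ τ (Fin.natAdd a i) = Fin.natAdd a' (τ i) := by
    intro i; simp [finSum]
  have hlt : ∀ {p q : ℕ} (i j : Fin p), Fin.castAdd q i < Fin.castAdd q j ↔ i < j :=
    fun _ _ => Iff.rfl
  have h1 : ∀ (i : Fin a') (j : Fin b'), ¬ Fin.natAdd a' j < Fin.castAdd b' i := by
    intro i j h
    have := Fin.lt_def.mp h
    simp at this; omega
  have h2 : ∀ (i : Fin a) (j : Fin b), ¬ Fin.natAdd a j < Fin.castAdd b i := by
    intro i j h
    have := Fin.lt_def.mp h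
    simp at this; omega
  unfold koszulSign
  rw [Fin.prod_univ_add]
  congr 1
  · refine Finset.prod_congr rfl fun i _ => ?_
    rw [Fin.prod_univ_add]
    simp [hl, hr, h1, hlt]
  · refine Finset.prod_congr rfl fun i _ => ?_
    rw [Fin.prod_univ_add]
    simp [hl, hr, h2]

theorem mulEquiv_tprod {a b : ℕ} (x : Fin a → M) (y : Fin b → M) :
    TensorPower.mulEquiv (R := R) (M := M) (n := a) (m := b)
      (PiTensorProduct.tprod R x ⊗ₜ PiTensorProduct.tprod R y) =
      PiTensorProduct.tprod R (Fin.append x y) :=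
  TensorPower.tprod_mul_tprod R x y

theorem signedReindex_mul {a a' b b' : ℕ} (σ : Fin a ≃ Fin a') (τ : Fin b ≃ Fin b')
    (t : ⨂[R]^a M) (u : ⨂[R]^b M) :
    signedReindex 𝒜 (finSum σ τ) (TensorPower.mulEquiv (t ⊗ₜ[R] u)) =
      TensorPower.mulEquiv (signedReindex 𝒜 σ t ⊗ₜ[R] signedReindex 𝒜 τ u) := by
  induction t using PiTensorProduct.induction_on with
  | add a b ha hb => simp only [map_add, TensorProduct.add_tmul, ha, hb]
  | smul_tprod r x =>
  induction u using PiTensorProduct.induction_on with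
  | add a b ha hb => simp only [map_add, TensorProduct.tmul_add, ha, hb]
  | smul_tprod s y =>
    simp only [map_smul, ← TensorProduct.smul_tmul', TensorProduct.tmul_smul]
    congr 2
    rw [mulEquiv_tprod, signedReindex_tprod, signedReindex_tprod, signedReindex_tprod,
      TensorProduct.sum_tmul, map_sum, ← (Fin.appendEquiv a b).sum_comp, Fintype.sum_prod_type]
    refine Finset.sum_congr rfl fun ε _ => ?_
    rw [TensorProduct.tmul_sum, map_sum]
    refine Finset.sum_congr rfl fun ε' _ => ?_
    have h : (fun i => parityPart 𝒜 (Fin.append ε ε' ((finSum σ τ).symm i))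
        (Fin.append x y ((finSum σ τ).symm i))) =
        Fin.append (fun i => parityPart 𝒜 (ε (σ.symm i)) (x (σ.symm i)))
          (fun i => parityPart 𝒜 (ε' (τ.symm i)) (y (τ.symm i))) := by
      funext i
      refine Fin.addCases (fun i => ?_) (fun i => ?_) i <;> simp [finSum]
    change (koszulSign (finSum σ τ) (Fin.append ε ε') : R) • PiTensorProduct.tprod R
      (fun i => parityPart 𝒜 (Fin.append ε ε' ((finSum σ τ).symm i))
        (Fin.append x y ((finSum σ τ).symm i))) = _
    rw [koszulSign_finSum, h, ← mulEquiv_tprod, ← TensorProduct.smul_tmul',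
      TensorProduct.tmul_smul, map_smul, map_smul, smul_smul, Int.cast_mul]

end GradedLemmas


/-! ### The generalized shuffle product before completion -/

section Shuffle

variable {R : Type u} [CommRing R] (C : HopfCooperad.{u, w} R)

theorem finSum_val {a a' b b' : ℕ} (σ : Fin a ≃ Fin a') (τ : Fin b ≃ Fin b') (i : Fin (a + b)) :
    (finSum σ τ i : ℕ) = if h : (i : ℕ) < a then (σ ⟨i, h⟩ : ℕ) else
      a' + (τ ⟨i - a, by omega⟩ : ℕ) := by
  refine Fin.addCases (fun i => ?_) (fun i => ?_) i
  · simp [finSum]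
  · simp [finSum]

theorem finAddFlip_val (a b : ℕ) (i : Fin (a + b)) :
    (finAddFlip i : ℕ) = if (i : ℕ) < a then b + i else i - a := by
  refine Fin.addCases (fun i => ?_) (fun i => ?_) i
  · simp
  · simp

theorem finSwap_val (a b c : ℕ) (i : Fin (a + b + c)) :
    (finSwap a b c i : ℕ) = if (i : ℕ) < a then (i : ℕ) else
      if (i : ℕ) < a + b then i + c else i - b := by
  simp only [finSwap, Equiv.trans_apply, finCongr_apply, Fin.val_cast, finSum_val, finAddFlip_val,
    Equiv.refl_apply]
  split_ifs <;> omega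

namespace HopfCooperad

theorem parityPart_map {m n : ℕ} (e : Fin m ≃ Fin n) (b : Bool) (x : C.obj m) :
    C.map e (parityPart (C.deg m) b x) = parityPart (C.deg n) b (C.map e x) :=
  map_scaleByDegree (C.deg m) (C.deg n) _ (C.map e).toLinearMap (C.map_deg e) x

theorem map_finSum_zero {m n : ℕ} (e : Fin m ≃ Fin n) (x : C.obj m) :
    C.map (finSum e (Equiv.refl (Fin 0))) x = C.map e x := by
  congr 1
  congr 1
  ext i
  rw [finSum_val, dif_pos (show (i : ℕ) < m from i.isLt)]
  rfl

theorem addInput_map {m n : ℕ} (e : Fin m ≃ Fin n) (x : C.obj m) :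
    C.addInput n (C.map e x) = C.map (finSum e (Equiv.refl (Fin 1))) (C.addInput m x) := by
  have h := C.decomp_map e (Equiv.refl (Fin 0)) x
  rw [map_finSum_zero] at h
  simp only [addInput, partialDecomp, LinearMap.comp_apply, LinearEquiv.coe_coe,
    AlgHom.toLinearMap_apply]
  rw [h]
  generalize (GradedTensorProduct.of R (C.deg (m + 1)) (C.deg 0)).symm (C.decomp m 0 x) = z
  induction z using TensorProduct.induction_on with
  | zero => simp
  | add a b ha hb => simp only [map_add, ha, hb]
  | tmul a b => simp [C.map_refl]

theorem addInputs_map {m n : ℕ} (e : Fin m ≃ Fin n) (k : ℕ) (x : C.obj m) :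
    C.addInputs n k (C.map e x) = C.map (finSum e (Equiv.refl (Fin k))) (C.addInputs m k x) := by
  induction k with
  | zero => exact (C.map_finSum_zero e x).symm
  | succ k ih =>
    simp only [addInputs, LinearMap.comp_apply, ih, addInput_map]
    rw [show finSum (finSum e (Equiv.refl (Fin k))) (Equiv.refl (Fin 1)) =
      finSum e (Equiv.refl (Fin (k + 1))) from ?_]
    ext i
    simp only [finSum_val, Equiv.refl_apply]
    split_ifs <;> omega

theorem parityPart_zero (y : C.obj 0) : parityPart (C.deg 0) false y = y ∧
    parityPart (C.deg 0) true y = 0 := by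
  have hy : y ∈ C.deg 0 0 := by
    have : y = algebraMap R _ (C.unitary y) := by
      apply C.unitary.injective
      simp
    rw [this]
    exact SetLike.algebraMap_mem_graded _ _
  constructor <;> simp [parityPart, scaleByDegree_apply_of_mem _ _ hy]

theorem addInput_addInput (n : ℕ) (x : C.obj n) :
    C.map (finSwap n 1 1) (C.addInput (n + 1) (C.addInput n x)) =
      C.addInput (n + 1) (C.addInput n x) := by
  let u : C.obj 0 →ₗ[R] R := C.unitary.toLinearMap
  let r : ∀ m, C.obj m ⊗[R] C.obj 0 →ₗ[R] C.obj m := fun m =>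
    (TensorProduct.rid R (C.obj m)).toLinearMap ∘ₗ TensorProduct.map LinearMap.id u
  let G : C.obj (n + 1 + 1) ⊗[R] (C.obj 0 ⊗[R] C.obj 0) →ₗ[R] C.obj (n + 1 + 1) :=
    (TensorProduct.rid R _).toLinearMap ∘ₗ
      TensorProduct.map LinearMap.id ((TensorProduct.lid R R).toLinearMap ∘ₗ TensorProduct.map u u)
  have hG : ∀ z, G (TensorProduct.map LinearMap.id (koszulSwap (C.deg 0) (C.deg 0)) z) = G z := by
    intro z
    induction z using TensorProduct.induction_on with
    | zero => simp
    | add a b ha hb => simp only [map_add, ha, hb]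
    | tmul a b =>
      induction b using TensorProduct.induction_on with
      | zero => simp
      | add b c hb hc => simp only [map_add, TensorProduct.tmul_add, hb, hc]
      | tmul b c =>
        simp [G, koszulSwap, (C.parityPart_zero b).1, (C.parityPart_zero b).2, mul_comm]
  have hf : ∀ (f : C.obj (n + 1) →ₗ[R] C.obj (n + 1 + 1) ⊗[R] C.obj 0)
      (z : C.obj (n + 1) ⊗[R] C.obj 0),
      G (TensorProduct.assoc R _ _ _ (TensorProduct.map f LinearMap.id z)) =
        r _ (f (r _ z)) := by
    intro f z
    induction z using TensorProduct.induction_on with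
    | zero => simp
    | add a b ha hb => simp only [map_add, ha, hb]
    | tmul a b =>
      simp only [r, TensorProduct.map_tmul, LinearMap.id_apply, LinearMap.comp_apply,
        LinearEquiv.coe_coe, TensorProduct.rid_tmul, map_smul]
      generalize f a = y
      induction y using TensorProduct.induction_on with
      | zero => simp
      | add a b ha hb => simp only [map_add, TensorProduct.add_tmul, smul_add, ha, hb]
      | tmul a c => simp [G, smul_smul, mul_comm]
  have hr : ∀ (f : C.obj (n + 1 + 1) →ₗ[R] C.obj (n + 1 + 1)) (z : C.obj (n + 1 + 1) ⊗[R] C.obj 0),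
      r _ (TensorProduct.map f LinearMap.id z) = f (r _ z) := by
    intro f z
    induction z using TensorProduct.induction_on with
    | zero => simp
    | add a b ha hb => simp only [map_add, ha, hb]
    | tmul a b => simp [r]
  have h0 : finSwap n 0 0 = Equiv.refl (Fin n) := by
    ext i
    refine (finSwap_val n 0 0 i).trans ?_
    have hi : (i : ℕ) < n + 0 := i.isLt
    split_ifs <;> rfl
  have h1 : finSwap n 0 1 = Equiv.refl (Fin (n + 1)) := by
    ext i
    refine (finSwap_val n 0 1 i).trans ?_
    have hi : (i : ℕ) < n + 1 := i.isLt
    simp only [Equiv.refl_apply]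
    split_ifs <;> omega
  have h := congrArg G (C.coassoc_par n 0 0 x)
  rw [hG] at h
  erw [hf, hf, h0, h1] at h
  simp only [LinearMap.comp_apply, AlgHom.toLinearMap_apply] at h
  erw [hr, C.map_refl, C.map_refl, C.map_refl] at h
  exact h

theorem addInputs_swap (n : ℕ) (x : C.obj n) : ∀ (m : ℕ) (i : Fin m),
    C.map (finSum (Equiv.refl (Fin n)) (Equiv.swap i.castSucc i.succ)) (C.addInputs n (m + 1) x) =
      C.addInputs n (m + 1) x
  | 0, i => i.elim0
  | m + 1, i => by
    refine Fin.lastCases ?_ (fun j => ?_) i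
    · have h : finSum (Equiv.refl (Fin n))
          (Equiv.swap (Fin.last m).castSucc (Fin.last m).succ) = finSwap (n + m) 1 1 := by
        ext j
        have hj : (j : ℕ) < n + (m + 1 + 1) := j.isLt
        refine (finSum_val _ _ j).trans (Eq.trans ?_ (finSwap_val (n + m) 1 1 j).symm)
        simp only [Equiv.refl_apply, Equiv.swap_apply_def, Fin.ext_iff]
        split_ifs <;> simp_all <;> omega
      rw [h]
      exact C.addInput_addInput (n + m) (C.addInputs n m x)
    · have h : finSum (Equiv.refl (Fin n)) (Equiv.swap j.castSucc.castSucc j.castSucc.succ) =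
          finSum (finSum (Equiv.refl (Fin n)) (Equiv.swap j.castSucc j.succ))
            (Equiv.refl (Fin 1)) := by
        ext k
        have hk : (k : ℕ) < n + (m + 1 + 1) := k.isLt
        refine (finSum_val _ _ k).trans
          (Eq.trans ?_ (finSum_val (a := n + (m + 1)) (b := 1) _ _ k).symm)
        simp only [finSum_val, Equiv.refl_apply, Equiv.swap_apply_def, Fin.ext_iff]
        split_ifs <;> simp_all <;> omega
      rw [h]
      exact (C.addInput_map _ _).symm.trans
        (congrArg (C.addInput (n + (m + 1))) (addInputs_swap n x m j))

theorem addInputs_perm (n : ℕ) (x : C.obj n) : ∀ (m : ℕ) (τ : Equiv.Perm (Fin m)),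
    C.map (finSum (Equiv.refl (Fin n)) τ) (C.addInputs n m x) = C.addInputs n m x
  | 0, τ => by
    rw [show finSum (Equiv.refl (Fin n)) τ = Equiv.refl (Fin n) from ?_]
    · exact C.map_refl _ _
    · ext i
      exact (finSum_val _ _ i).trans (dif_pos (show (i : ℕ) < n from i.isLt))
  | m + 1, τ => by
    have hτ : τ ∈ Submonoid.closure
        (Set.range fun i : Fin m => Equiv.swap i.castSucc i.succ) := by
      rw [Equiv.Perm.mclosure_swap_castSucc_succ]
      trivial
    induction hτ using Submonoid.closure_induction with
    | mem τ h =>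
      obtain ⟨i, rfl⟩ := h
      exact C.addInputs_swap n x m i
    | one =>
      rw [show finSum (Equiv.refl (Fin n)) (1 : Equiv.Perm (Fin (m + 1))) =
        Equiv.refl (Fin (n + (m + 1))) from ?_]
      · exact C.map_refl _ _
      · ext i
        simp only [finSum_val, Equiv.refl_apply, Equiv.Perm.coe_one, id_eq]
        split_ifs <;> omega
    | mul σ τ _ _ hσ hτ =>
      rw [show finSum (Equiv.refl (Fin n)) (σ * τ) =
        (finSum (Equiv.refl (Fin n)) τ).trans (finSum (Equiv.refl (Fin n)) σ) from ?_,
        C.map_trans, hτ, hσ]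
      ext i
      refine Fin.addCases (fun i => ?_) (fun i => ?_) i <;> simp [finSum]

theorem addInputsLeft_map {n m : ℕ} (σ : Equiv.Perm (Fin n)) (τ : Equiv.Perm (Fin m))
    (x : C.obj m) :
    C.addInputsLeft n m (C.map τ x) = C.map (finSum σ τ) (C.addInputsLeft n m x) := by
  have h : finAddFlip.trans (finSum σ τ) =
      ((finSum (Equiv.refl (Fin m)) σ).trans (finSum τ (Equiv.refl (Fin n)))).trans
        finAddFlip := by
    ext i
    refine Fin.addCases (fun i => ?_) (fun i => ?_) i <;> simp [finSum]
  simp only [addInputsLeft, LinearMap.comp_apply, AlgHom.toLinearMap_apply]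
  rw [← C.map_trans, h, C.map_trans, C.map_trans, C.addInputs_perm, C.addInputs_map]

theorem addInputs_map_perm {n m : ℕ} (σ : Equiv.Perm (Fin n)) (τ : Equiv.Perm (Fin m))
    (x : C.obj n) :
    C.addInputs n m (C.map σ x) = C.map (finSum σ τ) (C.addInputs n m x) := by
  have h : finSum σ τ =
      (finSum (Equiv.refl (Fin n)) τ).trans (finSum σ (Equiv.refl (Fin m))) := by
    ext i
    refine Fin.addCases (fun i => ?_) (fun i => ?_) i <;> simp [finSum]
  rw [h, C.map_trans, C.addInputs_perm, C.addInputs_map]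

end HopfCooperad

variable (V : CompleteGradedModule.{u, v} R)

/-- The product
`(c ⊗ x₁ ⋯ x_n) ⋆ (c' ⊗ y₁ ⋯ y_m) = ± (c₁ · c'₁) ⊗ x₁ ⋯ x_n y₁ ⋯ y_m`, where `c₁` and `c'₁` in
`u𝒞(n + m)` are obtained from `c` and `c'` by adding inputs, `·` is the Hopf product, and the sign
comes from moving `c'` past the `x_i`. -/
def starCell (n m : ℕ) : Cell C V 0 n →ₗ[R] Cell C V 0 m →ₗ[R] Cell C V 0 (n + m) :=
  TensorProduct.curry
    (TensorProduct.map
        (LinearMap.mul' R (C.obj (n + m)) ∘ₗ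
          TensorProduct.map (C.addInputs n m) (C.addInputsLeft n m))
        TensorPower.mulEquiv.toLinearMap ∘ₗ
      (TensorProduct.tensorTensorTensorComm R _ _ _ _).toLinearMap ∘ₗ
      (TensorProduct.map LinearMap.id
          (TensorProduct.map (parityPart (C.deg m) false) LinearMap.id) +
        TensorProduct.map
          (TensorProduct.map LinearMap.id (PiTensorProduct.map fun _ => signInv V.deg))
          (TensorProduct.map (parityPart (C.deg m) true) LinearMap.id)))

/-- The generalized shuffle product before passing to coinvariants and to the completion. -/
def starWords : Words C V 0 →ₗ[R] Words C V 0 →ₗ[R] Words C V 0 :=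
  DirectSum.toModule R ℕ _ fun n => (DirectSum.toModule R ℕ _ fun m =>
    ((starCell C V n m).compr₂ (DirectSum.lof R ℕ (Cell C V 0) (n + m))).flip).flip

theorem starWords_lof (n m : ℕ) (z : Cell C V 0 n) (y : Cell C V 0 m) :
    starWords C V (DirectSum.lof R ℕ _ n z) (DirectSum.lof R ℕ _ m y) =
      DirectSum.lof R ℕ _ (n + m) (starCell C V n m z y) := by
  simp [starWords, DirectSum.toModule_lof]

theorem starCell_tmul (n m : ℕ) (c : C.obj n) (t : ⨂[R]^n V.carrier) (c' : C.obj m)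
    (t' : ⨂[R]^m V.carrier) :
    starCell C V n m (c ⊗ₜ t) (c' ⊗ₜ t') =
      (C.addInputs n m c * C.addInputsLeft n m (parityPart (C.deg m) false c')) ⊗ₜ
        TensorPower.mulEquiv (t ⊗ₜ t') +
      (C.addInputs n m c * C.addInputsLeft n m (parityPart (C.deg m) true c')) ⊗ₜ
        TensorPower.mulEquiv ((PiTensorProduct.map (fun _ => signInv V.deg) t) ⊗ₜ t') := by
  simp [starCell]

theorem act_zero_tmul {m n : ℕ} (e : Fin m ≃ Fin n) (c : C.obj m) (t : ⨂[R]^m V.carrier) :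
    act C V 0 e (c ⊗ₜ t) = (C.map e c) ⊗ₜ signedReindex V.deg e t := by
  simp only [act, TensorProduct.map_tmul, AlgHom.toLinearMap_apply]
  rw [C.map_finSum_zero]

theorem starCell_act {n m : ℕ} (σ : Equiv.Perm (Fin n)) (τ : Equiv.Perm (Fin m))
    (z : Cell C V 0 n) (y : Cell C V 0 m) :
    starCell C V n m (act C V 0 σ z) (act C V 0 τ y) =
      act C V 0 (finSum σ τ) (starCell C V n m z y) := by
  induction z using TensorProduct.induction_on with
  | zero => simp
  | add a b ha hb => simp only [map_add, LinearMap.add_apply, ha, hb]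
  | tmul c t =>
  induction y using TensorProduct.induction_on with
  | zero => simp
  | add a b ha hb => simp only [map_add, ha, hb]
  | tmul c' t' =>
    rw [act_zero_tmul, act_zero_tmul, starCell_tmul, starCell_tmul, map_add, act_zero_tmul,
      act_zero_tmul, signedReindex_mul, signedReindex_mul, map_signInv_signedReindex,
      ← C.parityPart_map, ← C.parityPart_map, C.addInputs_map_perm σ τ, C.addInputsLeft_map σ τ,
      C.addInputsLeft_map σ τ, map_mul, map_mul]

theorem act_refl (n : ℕ) (z : Cell C V 0 n) : act C V 0 (Equiv.refl (Fin n)) z = z := by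
  induction z using TensorProduct.induction_on with
  | zero => simp
  | add a b ha hb => simp only [map_add, ha, hb]
  | tmul c t => rw [act_zero_tmul, C.map_refl, signedReindex_refl]

end Shuffle


/-! ### Completions -/

section Completion

variable {R : Type u} [CommRing R] {M : Type v} [AddCommGroup M] [Module R M]

/-- The completion `lim M / G_N` of a module with a descending filtration. -/
def completion (G : ℕ → Submodule R M) : Submodule R (∀ N, M ⧸ G N) where
  carrier := {x | ∀ m n, m ≤ n → ∃ e : M,
    Submodule.Quotient.mk e = x m ∧ Submodule.Quotient.mk e = x n}
  zero_mem' _ _ _ := ⟨0, rfl, rfl⟩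
  add_mem' {x y} hx hy m n h := by
    obtain ⟨e, h1, h2⟩ := hx m n h
    obtain ⟨e', h1', h2'⟩ := hy m n h
    exact ⟨e + e', by simp [h1, h1'], by simp [h2, h2']⟩
  smul_mem' r x hx m n h := by
    obtain ⟨e, h1, h2⟩ := hx m n h
    exact ⟨r • e, by simp [h1], by simp [h2]⟩

/-- The canonical map to the completion. -/
def toCompletion (G : ℕ → Submodule R M) : M →ₗ[R] completion G where
  toFun x := ⟨fun _ => Submodule.Quotient.mk x, fun _ _ _ => ⟨x, rfl, rfl⟩⟩
  map_add' _ _ := rfl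
  map_smul' _ _ := rfl

/-- The extension to completions of a bilinear map that is compatible with the filtration. -/
def completionMap₂ (G : ℕ → Submodule R M) (f : M →ₗ[R] M →ₗ[R] M)
    (hl : ∀ N, ∀ x ∈ G N, ∀ y, f x y ∈ G N) (hr : ∀ N x, ∀ y ∈ G N, f x y ∈ G N) :
    completion G →ₗ[R] completion G →ₗ[R] completion G :=
  let g (N : ℕ) : (M ⧸ G N) →ₗ[R] (M ⧸ G N) →ₗ[R] (M ⧸ G N) :=
    (G N).liftQ
      { toFun := fun x => (G N).mapQ (G N) (f x) (fun y hy => hr N x y hy)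
        map_add' := fun x y => by ext z; simp
        map_smul' := fun r x => by ext z; simp }
      (fun x hx => by
        rw [LinearMap.mem_ker]
        ext z
        simpa using hl N x hx z)
  LinearMap.mk₂ R
    (fun x y => ⟨fun N => g N (x.1 N) (y.1 N), fun m n h => by
      obtain ⟨e, h1, h2⟩ := x.2 m n h
      obtain ⟨e', h1', h2'⟩ := y.2 m n h
      exact ⟨f e e', by change _ = g m _ _; rw [← h1, ← h1']; rfl,
        by change _ = g n _ _; rw [← h2, ← h2']; rfl⟩⟩)
    (fun x x' y => by ext N; simp)
    (fun r x y => by ext N; simp)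
    (fun x y y' => by ext N; simp)
    (fun r x y => by ext N; simp)

end Completion

/-! ### The completed cofree coalgebra -/

section Completed

variable {R : Type u} [CommRing R] (C : HopfCooperad.{u, w} R) (V : CompleteGradedModule.{u, v} R)

theorem words_induction_lof {p : Words C V 0 → Prop} (h0 : p 0)
    (hadd : ∀ x y, p x → p y → p (x + y))
    (h : ∀ n z, p (DirectSum.lof R ℕ (Cell C V 0) n z)) (x : Words C V 0) : p x :=
  DirectSum.induction_on x h0 h hadd

theorem starWords_coinvRel_left {x : Words C V 0} (hx : x ∈ coinvRel C V) (y : Words C V 0) :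
    starWords C V x y ∈ coinvRel C V := by
  induction hx using Submodule.span_induction with
  | zero => simp
  | add a b _ _ ha hb => simpa using add_mem ha hb
  | smul r a _ ha => simpa using Submodule.smul_mem _ r ha
  | mem x hx =>
    obtain ⟨n, σ, z, rfl⟩ := hx
    induction y using words_induction_lof C V with
    | h0 => simp
    | hadd a b ha hb =>
      rw [map_add]
      exact add_mem ha hb
    | h m y =>
      rw [map_sub, LinearMap.sub_apply, starWords_lof, starWords_lof]
      refine Submodule.subset_span ⟨n + m, finSum σ (Equiv.refl (Fin m)), starCell C V n m z y, ?_⟩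
      rw [← starCell_act, act_refl]

theorem starWords_coinvRel_right (x : Words C V 0) {y : Words C V 0} (hy : y ∈ coinvRel C V) :
    starWords C V x y ∈ coinvRel C V := by
  induction hy using Submodule.span_induction with
  | zero => simp
  | add a b _ _ ha hb => simpa using add_mem ha hb
  | smul r a _ ha => simpa using Submodule.smul_mem _ r ha
  | mem y hy =>
    obtain ⟨m, τ, z, rfl⟩ := hy
    induction x using words_induction_lof C V with
    | h0 => simp
    | hadd a b ha hb =>
      rw [map_add, LinearMap.add_apply]
      exact add_mem ha hb
    | h n x =>
      rw [map_sub, starWords_lof, starWords_lof]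
      refine Submodule.subset_span ⟨n + m, finSum (Equiv.refl (Fin n)) τ, starCell C V n m x z, ?_⟩
      rw [← starCell_act, act_refl]

theorem F_zero (x : V.carrier) : x ∈ V.F 0 :=
  V.F_antitone (Nat.zero_le 1) (by rw [V.F_one]; trivial)

theorem signInv_mem_F {N : ℕ} {x : V.carrier} (hx : x ∈ V.F N) : signInv V.deg x ∈ V.F N :=
  sub_mem (scaleByDegree_mem V.deg (V.F_graded N) hx) (scaleByDegree_mem V.deg (V.F_graded N) hx)

theorem starWords_tprod_mem (N : ℕ) {n m : ℕ} (c : C.obj n) (c' : C.obj m)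
    (x : Fin n → V.carrier) (y : Fin m → V.carrier) (w : Fin n → ℕ) (w' : Fin m → ℕ)
    (hx : ∀ i, x i ∈ V.F (w i)) (hy : ∀ i, y i ∈ V.F (w' i))
    (hN : N ≤ ∑ i, w i + ∑ i, w' i) :
    starWords C V (DirectSum.lof R ℕ _ n (c ⊗ₜ PiTensorProduct.tprod R x))
      (DirectSum.lof R ℕ _ m (c' ⊗ₜ PiTensorProduct.tprod R y)) ∈ wordFil C V N := by
  rw [starWords_lof, starCell_tmul, PiTensorProduct.map_tprod, mulEquiv_tprod, mulEquiv_tprod,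
    map_add]
  refine add_mem (Submodule.subset_span ⟨n + m, _, _, Fin.append w w', ?_, ?_, rfl⟩)
    (Submodule.subset_span ⟨n + m, _, _, Fin.append w w', ?_, ?_, rfl⟩)
  · intro i
    refine Fin.addCases (fun i => ?_) (fun i => ?_) i <;> simp [hx, hy]
  · simpa [Fin.sum_univ_add] using hN
  · intro i
    refine Fin.addCases (fun i => ?_) (fun i => ?_) i <;> simp [hy, signInv_mem_F V (hx _)]
  · simpa [Fin.sum_univ_add] using hN

theorem words_induction {p : Words C V 0 → Prop} (h0 : p 0) (hadd : ∀ x y, p x → p y → p (x + y))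
    (hsmul : ∀ (r : R) x, p x → p (r • x))
    (h : ∀ n (c : C.obj n) (x : Fin n → V.carrier),
      p (DirectSum.lof R ℕ (Cell C V 0) n (c ⊗ₜ PiTensorProduct.tprod R x)))
    (x : Words C V 0) : p x := by
  induction x using words_induction_lof C V with
  | h0 => exact h0
  | hadd a b ha hb => exact hadd a b ha hb
  | h n z =>
    induction z using TensorProduct.induction_on with
    | zero => simpa using h0
    | add a b ha hb => simpa using hadd _ _ ha hb
    | tmul c t =>
      induction t using PiTensorProduct.induction_on with
      | add a b ha hb => simpa [TensorProduct.tmul_add] using hadd _ _ ha hb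
      | smul_tprod r x => rw [TensorProduct.tmul_smul, map_smul]; exact hsmul r _ (h n c x)

theorem starWords_wordFil_left {N : ℕ} {x : Words C V 0} (hx : x ∈ wordFil C V N)
    (y : Words C V 0) : starWords C V x y ∈ wordFil C V N := by
  induction hx using Submodule.span_induction with
  | zero => simp
  | add a b _ _ ha hb => simpa using add_mem ha hb
  | smul r a _ ha => simpa using Submodule.smul_mem _ r ha
  | mem x hx =>
    obtain ⟨n, c, x, w, hw, hN, rfl⟩ := hx
    induction y using words_induction C V with
    | h0 => simp
    | hadd a b ha hb => simpa using add_mem ha hb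
    | hsmul r a ha => simpa using Submodule.smul_mem _ r ha
    | h m c' y =>
      exact starWords_tprod_mem C V N c c' x y w 0 hw (fun i => F_zero V _) (by simpa using hN)

theorem starWords_wordFil_right {N : ℕ} (x : Words C V 0) {y : Words C V 0}
    (hy : y ∈ wordFil C V N) : starWords C V x y ∈ wordFil C V N := by
  induction hy using Submodule.span_induction with
  | zero => simp
  | add a b _ _ ha hb => simpa using add_mem ha hb
  | smul r a _ ha => simpa using Submodule.smul_mem _ r ha
  | mem y hy =>
    obtain ⟨m, c', y, w, hw, hN, rfl⟩ := hy
    induction x using words_induction C V with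
    | h0 => simp
    | hadd a b ha hb => simpa using add_mem ha hb
    | hsmul r a ha => simpa using Submodule.smul_mem _ r ha
    | h n c x =>
      exact starWords_tprod_mem C V N c c' x y 0 w (fun i => F_zero V _) hw (by simpa using hN)

/-- The filtration used for the completion: the coinvariance relations together with the
filtration coming from `V`. -/
def fil (N : ℕ) : Submodule R (Words C V 0) := coinvRel C V ⊔ wordFil C V N

/-- The completed cofree `u𝒞`-coalgebra on `V`, the completion of
`⨁ n, (u𝒞(n) ⊗ V^{⊗n})_{S_n}` with respect to the filtration induced by `V`. As `V = F¹V`, the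
arity `n` part lies in filtration `≥ n`, so this also completes with respect to the weight.
It is the completion of the total module: its elements may have nonzero components in
infinitely many degrees. Linear maps of degree `k` that preserve the filtrations are the same
for it and for the degreewise completion, which is dense. -/
abbrev Cofree : Type _ := completion (fil C V)

/-- The map from representatives to the completed cofree coalgebra. -/
abbrev toCofree : Words C V 0 →ₗ[R] Cofree C V := toCompletion (fil C V)

/-- The generalized shuffle product of the completed cofree coalgebra. (It is the morphism of
`u𝒞`-coalgebras which on cogenerators is given by `𝟙 ⋆ v = v ⋆ 𝟙 = v` and zero otherwise.) -/
def star : Cofree C V →ₗ[R] Cofree C V →ₗ[R] Cofree C V :=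
  completionMap₂ (fil C V) (starWords C V)
    (fun N x hx y => by
      obtain ⟨a, ha, b, hb, rfl⟩ := Submodule.mem_sup.mp hx
      rw [map_add, LinearMap.add_apply]
      exact add_mem (Submodule.mem_sup_left (starWords_coinvRel_left C V ha y))
        (Submodule.mem_sup_right (starWords_wordFil_left C V hb y)))
    (fun N x y hy => by
      obtain ⟨a, ha, b, hb, rfl⟩ := Submodule.mem_sup.mp hy
      rw [map_add]
      exact add_mem (Submodule.mem_sup_left (starWords_coinvRel_right C V x ha))
        (Submodule.mem_sup_right (starWords_wordFil_right C V x hb)))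

/-- The unitary operation `𝟙`. -/
def unitElement : Cofree C V :=
  toCofree C V (DirectSum.lof R ℕ (Cell C V 0) 0
    ((1 : C.obj 0) ⊗ₜ PiTensorProduct.tprod R Fin.elim0))

variable {C V}

/-- `e` represents `x` modulo the `N`-th step of the filtration. -/
def Represents (N : ℕ) (e : Words C V 0) (x : Cofree C V) : Prop :=
  x.1 N = Submodule.Quotient.mk e

/-- The `N`-th step of the filtration of the completed cofree coalgebra. -/
def InFil (N : ℕ) (x : Cofree C V) : Prop := Represents N 0 x

/-- `x` is homogeneous of degree `k`. -/
def HasDegree (k : ℤ) (x : Cofree C V) : Prop := ∀ N, ∃ e ∈ wordDeg C V k, Represents N e x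

/-- All components of `x` of arity greater than `n` vanish. -/
def ArityLE (n : ℕ) (x : Cofree C V) : Prop :=
  ∀ N, ∃ e : Words C V 0, (∀ m, n < m → e m = 0) ∧ Represents N e x

variable (C V) in
/-- The `N`-th step of the filtration of `u𝒞(k) ⊗ D^{⊗k}`, where `D` is the completed cofree
coalgebra. The completed tensor product is the completion with respect to this filtration, so
two elements become equal there if and only if they are congruent modulo all these submodules. -/
def tensorFil (k N : ℕ) : Submodule R (C.obj k ⊗[R] (⨂[R]^k (Cofree C V))) :=
  Submodule.span R {y | ∃ (c : C.obj k) (x : Fin k → Cofree C V) (w : Fin k → ℕ),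
    (∀ i, InFil (w i) (x i)) ∧ N ≤ ∑ i, w i ∧ y = c ⊗ₜ PiTensorProduct.tprod R x}

/-- `1 ⊗ π^{⊗k}`, where `π` is the map to the completed cofree coalgebra. -/
def tensorToCofree (k : ℕ) :
    C.obj k ⊗[R] (⨂[R]^k (Words C V 0)) →ₗ[R] C.obj k ⊗[R] (⨂[R]^k (Cofree C V)) :=
  TensorProduct.map LinearMap.id (PiTensorProduct.map fun _ => toCofree C V)

/-- The operator `d ⊗ 1 + ∑ⱼ 1 ⊗ (1 ⊗ ⋯ ⊗ Q ⊗ ⋯ ⊗ 1)` with `Q` in position `j`, for a map `Q` of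
degree `-1`, with Koszul signs. -/
def coderivationOp (Q : Cofree C V →ₗ[R] Cofree C V) (k : ℕ) :
    C.obj k ⊗[R] (⨂[R]^k (Words C V 0)) →ₗ[R] C.obj k ⊗[R] (⨂[R]^k (Cofree C V)) :=
  TensorProduct.map (C.d k) (PiTensorProduct.map fun _ => toCofree C V) +
    ∑ j : Fin k, TensorProduct.map (signInv (C.deg k)) (PiTensorProduct.map fun i =>
      if i < j then toCofree C V ∘ₗ wordSign C V
      else if i = j then Q ∘ₗ toCofree C V else toCofree C V)

/-- A curved `Ω𝒞`-algebra structure on `V`: a square-zero coderivation of degree `-1` of the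
cofree `u𝒞`-coalgebra which respects the filtrations. -/
structure IsCurvedAlgebra (Q : Cofree C V →ₗ[R] Cofree C V) : Prop where
  filtered : ∀ N x, InFil N x → InFil N (Q x)
  degree : ∀ k x, HasDegree k x → HasDegree (k - 1) (Q x)
  /-- `Q` restricts to the elements of bounded arity (the cofree coalgebra which is not completed
  with respect to the arity). -/
  arity : ∀ n x, ArityLE n x → ∃ m, ArityLE m (Q x)
  /-- In each arity `k` the structure map `δ_k` satisfies
  `δ_k Q = (d ⊗ 1 + ∑ⱼ 1 ⊗ (1 ⊗ ⋯ ⊗ Q ⊗ ⋯ ⊗ 1)) δ_k` in the completed tensor product. -/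
  coderivation : ∀ k N (x : Cofree C V) (e e' : Words C V 0), Represents N e x →
    Represents N e' (Q x) →
    tensorToCofree k (coproduct C V k e') - coderivationOp Q k (coproduct C V k e) ∈
      tensorFil C V k N
  square_zero : ∀ x, Q (Q x) = 0

/-- A morphism of `u𝒞`-`𝒜𝒮𝒮`-bialgebras `γ` from the group algebra `R[G]` of the additive group
`G` of `R` (with `u𝒞`-coalgebra structure `g ↦ η_k ⊗ g^{⊗k}`) to the completed cofree coalgebra
whose tangent vector at the basis element `g_r` is `r v`, for all `r ∈ R`. -/
structure IsOneParameterSubgroup (v : V.carrier) (γ : AddMonoidAlgebra R R →ₗ[R] Cofree C V) :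
    Prop where
  degree : ∀ a, HasDegree 0 (γ a)
  coalgebra : ∀ k N (r : R) (e : Words C V 0),
    Represents N e (γ (AddMonoidAlgebra.single r 1)) →
    tensorToCofree k (coproduct C V k e) - (1 : C.obj k) ⊗ₜ
      PiTensorProduct.tprod R (fun _ => γ (AddMonoidAlgebra.single r 1)) ∈ tensorFil C V k N
  map_one : γ 1 = unitElement C V
  map_mul : ∀ a b, γ (a * b) = star C V (γ a) (γ b)
  tangent : ∀ N (r : R) (e : Words C V 0), Represents N e (γ (AddMonoidAlgebra.single r 1)) →
    CurvedTwist.tangent C V e - r • v ∈ V.F N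

variable (C) in
/-- `exp(v) = γ_v(g_1)`, where `γ_v` is the one-parameter subgroup with tangent vector `v`. -/
def exp (v : V.carrier) : Cofree C V :=
  Classical.epsilon (IsOneParameterSubgroup (C := C) v) (AddMonoidAlgebra.single 1 1)

/-- `Q^v(x) = exp(-v) ⋆ Q(exp(v) ⋆ x)`. -/
def twist (Q : Cofree C V →ₗ[R] Cofree C V) (v : V.carrier) : Cofree C V →ₗ[R] Cofree C V :=
  star C V (exp C (-v)) ∘ₗ Q ∘ₗ star C V (exp C v)

end Completed

end CurvedTwist

end

noncomputable section

namespace CurvedTwist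

/-! ### Embeddings of finite ordinals -/

section Embeddings

/-! Why the theorem holds. Multiplication by `exp v` is a filtered coalgebra automorphism of degree
zero with inverse multiplication by `exp (-v)`, and conjugating a square-zero coderivation by such
an automorphism gives another one. The work lies in proving the morphism property over coinvariants,
with Koszul signs and in a completion. To control all three, identities are tested after
symmetrization.

Adding inputs dual to the unitary operation makes `u𝒞` a functor on finite ordinals and injections
(`HopfCooperad.ext`). Decorating the new inputs by an even `v` does the same for words. `spread`
with parameter `v` sums this action over all injections into `n` inputs. For `v = 0` only bijections
survive and it is the norm map of the symmetric group. Freeness, or division by `n!`, provides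
averaging maps that recover a word from its norms, modulo coinvariance relations and filtration
(`sub_symmetrize_mem`).

Two computations carry the proof. (1) An injection of `m` letters into `A + B` letters is a subset
together with an injection of it into `A` letters and of its complement into `B` letters. Hence
cutting a spread word into two blocks is the same as decomposing the word and spreading both factors
(`deconcat_spread`). Iterating, the coproduct with all factors spread is a function of the spread
word alone, by a formula `E` that does not involve `v` (`exists_coproduct_spread`). (2) Choose `e n`
in `u𝒞(n)` of degree zero whose symmetrization is the unit, and let the exponential be the sum of
the `e n ⊗ v^n`. A permutation of `n + m` letters is a placement of the last `m` letters and an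
ordering of the first `n`; summing over the orderings replaces `e n` by the unit of the Hopf
product. So spreading `exp v ⋆ x` by `0` is spreading `x` by `v` (`spread_starWords_expWord`).
Together, the symmetrized coproduct of `exp v ⋆ x` and the image of the coproduct of `x` under
multiplication of every factor by `exp v` are both `E` of the same spread word, so multiplication by
`exp v` is a coalgebra morphism.

Applying the projection to cogenerators to every factor of `δ_k` determines the norm in arity `k`
(`exists_reassemble`). So coalgebra morphisms may be compared after projection to cogenerators,
where multiplication by `exp v` adds `v` times the coefficient of `𝟙`. This yields `exp v ⋆ (exp w ⋆
x) = exp (v + w) ⋆ x`. In the same way grouplike elements are determined by their tangent vectors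
(`eq_of_grouplike`), and `exp v = exp v ⋆ 𝟙` is grouplike because `𝟙` is; existence and uniqueness
of `γ_v` follow.

Bounded arity of the twist comes from its being a coderivation: reassembling an arity `k` component
uses at least `k - 1` factors only through their cogenerators, so arity rises by at most one
(`arityLE_of_coderivation`). -/

theorem finSum_castAdd {a a' b b' : ℕ} (σ : Fin a ≃ Fin a') (τ : Fin b ≃ Fin b') (i : Fin a) :
    finSum σ τ (Fin.castAdd b i) = Fin.castAdd b' (σ i) := by
  simp [finSum]

theorem finSum_natAdd {a a' b b' : ℕ} (σ : Fin a ≃ Fin a') (τ : Fin b ≃ Fin b') (i : Fin b) :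
    finSum σ τ (Fin.natAdd a i) = Fin.natAdd a' (τ i) := by
  simp [finSum]

/-- The block sum of two embeddings. -/
def embSum {a a' b b' : ℕ} (j : Fin a ↪ Fin a') (k : Fin b ↪ Fin b') :
    Fin (a + b) ↪ Fin (a' + b') :=
  (finSumFinEquiv.symm.toEmbedding.trans (j.sumMap k)).trans finSumFinEquiv.toEmbedding

theorem embSum_castAdd {a a' b b' : ℕ} (j : Fin a ↪ Fin a') (k : Fin b ↪ Fin b') (i : Fin a) :
    embSum j k (Fin.castAdd b i) = Fin.castAdd b' (j i) := by
  simp [embSum]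

theorem embSum_natAdd {a a' b b' : ℕ} (j : Fin a ↪ Fin a') (k : Fin b ↪ Fin b') (i : Fin b) :
    embSum j k (Fin.natAdd a i) = Fin.natAdd a' (k i) := by
  simp [embSum]

theorem embSum_val {a a' b b' : ℕ} (j : Fin a ↪ Fin a') (k : Fin b ↪ Fin b') (i : Fin (a + b)) :
    (embSum j k i : ℕ) = if h : (i : ℕ) < a then (j ⟨i, h⟩ : ℕ) else
      a' + (k ⟨i - a, by omega⟩ : ℕ) := by
  refine Fin.addCases (fun i => ?_) (fun i => ?_) i
  · simp [embSum]
  · simp [embSum]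

theorem embSum_toEmbedding {a a' b b' : ℕ} (σ : Fin a ≃ Fin a') (τ : Fin b ≃ Fin b') :
    embSum σ.toEmbedding τ.toEmbedding = (finSum σ τ).toEmbedding := by
  ext i
  refine Fin.addCases (fun i => ?_) (fun i => ?_) i
  · simp [embSum, finSum]
  · simp [embSum, finSum]

theorem embSum_trans {a a' a'' b b' b'' : ℕ} (j : Fin a ↪ Fin a') (k : Fin b ↪ Fin b')
    (j' : Fin a' ↪ Fin a'') (k' : Fin b' ↪ Fin b'') :
    (embSum j k).trans (embSum j' k') = embSum (j.trans j') (k.trans k') := by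
  ext i
  refine Fin.addCases (fun i => ?_) (fun i => ?_) i
  · simp [embSum]
  · simp [embSum]

theorem embSum_refl (a b : ℕ) :
    embSum (Function.Embedding.refl (Fin a)) (Function.Embedding.refl (Fin b)) =
      Function.Embedding.refl _ := by
  ext i
  refine Fin.addCases (fun i => ?_) (fun i => ?_) i
  · simp [embSum]
  · simp [embSum]

/-- A bijection of `m + r` letters extending an embedding of the first `m` letters. -/
theorem exists_equiv_extending {m n : ℕ} (j : Fin m ↪ Fin n) :
    ∃ e : Fin (m + (n - m)) ≃ Fin n, ∀ i, e (Fin.castAdd _ i) = j i := by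
  classical
  have hc : Fintype.card ((Set.range j)ᶜ : Set (Fin n)) = n - m := by
    rw [Fintype.card_compl_set, Set.card_range_of_injective j.injective, Fintype.card_fin,
      Fintype.card_fin]
  let e₁ : Fin m ≃ Set.range j := Equiv.ofInjective j j.injective
  let e₂ : Fin (n - m) ≃ ((Set.range j)ᶜ : Set (Fin n)) := (Fintype.equivFinOfCardEq hc).symm
  refine ⟨finSumFinEquiv.symm.trans ((Equiv.sumCongr e₁ e₂).trans (Equiv.Set.sumCompl _)), ?_⟩
  intro i
  simp [e₁]

theorem fin_add_cases {a b : ℕ} (x : Fin (a + b)) :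
    (∃ k, x = Fin.castAdd b k) ∨ ∃ k, x = Fin.natAdd a k :=
  Fin.addCases (fun i => Or.inl ⟨i, rfl⟩) (fun i => Or.inr ⟨i, rfl⟩) x

/-- A permutation fixing the first `a` letters is a block sum. -/
theorem exists_finSum_refl_left {a b : ℕ} (ρ : Equiv.Perm (Fin (a + b)))
    (h : ∀ i, ρ (Fin.castAdd b i) = Fin.castAdd b i) :
    ∃ τ : Equiv.Perm (Fin b), ρ = finSum (Equiv.refl (Fin a)) τ := by
  have hr : ∀ i, ∃ k, ρ (Fin.natAdd a i) = Fin.natAdd a k := by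
    intro i
    obtain ⟨k, hk⟩ | ⟨k, hk⟩ := fin_add_cases (ρ (Fin.natAdd a i))
    · rw [← h k] at hk
      have := congrArg Fin.val (ρ.injective hk)
      simp at this
      omega
    · exact ⟨k, hk⟩
  choose f hf using hr
  have hinj : Function.Injective f := by
    intro x y hxy
    have := hf x
    rw [hxy, ← hf y] at this
    simpa using ρ.injective this
  refine ⟨Equiv.ofBijective f (Finite.injective_iff_bijective.mp hinj), ?_⟩
  ext i
  refine Fin.addCases (fun i => ?_) (fun i => ?_) i
  · rw [h, finSum_castAdd]
    rfl
  · rw [hf, finSum_natAdd]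
    rfl

/-- A permutation fixing the last `b` letters is a block sum. -/
theorem exists_finSum_refl_right {a b : ℕ} (ρ : Equiv.Perm (Fin (a + b)))
    (h : ∀ i, ρ (Fin.natAdd a i) = Fin.natAdd a i) :
    ∃ τ : Equiv.Perm (Fin a), ρ = finSum τ (Equiv.refl (Fin b)) := by
  have hr : ∀ i, ∃ k, ρ (Fin.castAdd b i) = Fin.castAdd b k := by
    intro i
    obtain ⟨k, hk⟩ | ⟨k, hk⟩ := fin_add_cases (ρ (Fin.castAdd b i))
    · exact ⟨k, hk⟩
    · rw [← h k] at hk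
      have := congrArg Fin.val (ρ.injective hk)
      simp at this
      omega
  choose f hf using hr
  have hinj : Function.Injective f := by
    intro x y hxy
    have := hf x
    rw [hxy, ← hf y] at this
    simpa using ρ.injective this
  refine ⟨Equiv.ofBijective f (Finite.injective_iff_bijective.mp hinj), ?_⟩
  ext i
  refine Fin.addCases (fun i => ?_) (fun i => ?_) i
  · rw [hf, finSum_castAdd]
    rfl
  · rw [h, finSum_natAdd]
    rfl

theorem embedding_eq_zero_of_lt {M : Type*} [AddCommMonoid M] {m n : ℕ} (h : n < m)
    (f : (Fin m ↪ Fin n) → M) : ∑ j, f j = 0 := by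
  have : IsEmpty (Fin m ↪ Fin n) := ⟨fun j => by
    have := Fintype.card_le_of_embedding j
    simp at this
    omega⟩
  simp

/-- Splitting an embedding into a disjoint union according to the block of the image. -/
def embSplit {m : ℕ} (A B : ℕ)
    (x : Σ s : Finset (Fin m), (Fin s.card ↪ Fin A) × (Fin sᶜ.card ↪ Fin B)) :
    Fin m ↪ Fin (A + B) :=
  (splitEquiv x.1).toEmbedding.trans (embSum x.2.1 x.2.2)

theorem splitEquiv_symm_castAdd_mem {m : ℕ} (s : Finset (Fin m)) (i : Fin s.card) :
    (splitEquiv s).symm (Fin.castAdd _ i) ∈ s := by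
  simp [splitEquiv]

theorem splitEquiv_symm_natAdd_notMem {m : ℕ} (s : Finset (Fin m)) (i : Fin sᶜ.card) :
    (splitEquiv s).symm (Fin.natAdd _ i) ∉ s := by
  have : (splitEquiv s).symm (Fin.natAdd _ i) ∈ sᶜ := by
    simp only [splitEquiv, Equiv.symm_trans_apply, Equiv.symm_symm,
      finSumFinEquiv_symm_apply_natAdd,
      finSumEquivOfFinset_inr]
    exact Finset.orderEmbOfFin_mem _ _ _
  simpa using this

/-- The subset is recovered as the preimage of the first block. This bijection is the combinatorial
core of the compatibility between spreading and decomposing. -/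
theorem embSplit_bijective {m : ℕ} (A B : ℕ) :
    Function.Bijective (embSplit (m := m) A B) := by
  classical
  have key : ∀ x i, i ∈ x.1 ↔ (embSplit (m := m) A B x i : ℕ) < A := by
    rintro ⟨s, j, k⟩ i
    obtain ⟨i, rfl⟩ := (splitEquiv s).symm.surjective i
    refine Fin.addCases (fun i => ?_) (fun i => ?_) i
    · simp only [splitEquiv_symm_castAdd_mem, true_iff, embSplit, Function.Embedding.trans_apply,
        Equiv.toEmbedding_apply, Equiv.apply_symm_apply, embSum_castAdd, Fin.val_castAdd]
      exact (j i).isLt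
    · simp [splitEquiv_symm_natAdd_notMem, embSplit, embSum_natAdd]
  constructor
  · rintro ⟨s, j, k⟩ ⟨s', j', k'⟩ h
    have hs : s = s' := by
      ext i
      rw [key ⟨s, j, k⟩ i, key ⟨s', j', k'⟩ i, h]
    subst hs
    have hj : j = j' := by
      ext i
      have := DFunLike.congr_fun h ((splitEquiv s).symm (Fin.castAdd _ i))
      simpa [embSplit, embSum_castAdd] using congrArg Fin.val this
    have hk : k = k' := by
      ext i
      have := DFunLike.congr_fun h ((splitEquiv s).symm (Fin.natAdd _ i))
      simpa [embSplit, embSum_natAdd] using congrArg Fin.val this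
    rw [hj, hk]
  · intro f
    let s : Finset (Fin m) := Finset.univ.filter fun i => (f i : ℕ) < A
    have h1 : ∀ i, (f ((splitEquiv s).symm (Fin.castAdd _ i)) : ℕ) < A := fun i => by
      simpa [s] using splitEquiv_symm_castAdd_mem s i
    have h2 : ∀ i, A ≤ (f ((splitEquiv s).symm (Fin.natAdd _ i)) : ℕ) := fun i => by
      simpa [s] using splitEquiv_symm_natAdd_notMem s i
    refine ⟨⟨s, ⟨fun i => ⟨_, h1 i⟩, fun x y hxy => ?_⟩, ⟨fun i => ⟨f ((splitEquiv s).symm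
      (Fin.natAdd _ i)) - A, by have := (f ((splitEquiv s).symm (Fin.natAdd _ i))).isLt
                                have := h2 i
                                omega⟩,
      fun x y hxy => ?_⟩⟩, ?_⟩
    · simpa using f.injective (Fin.ext (Fin.mk.inj_iff.mp hxy))
    · have := Fin.mk.inj_iff.mp hxy
      have hx := h2 x
      have hy := h2 y
      have := (splitEquiv s).symm.injective (f.injective (Fin.ext (show
        (f ((splitEquiv s).symm (Fin.natAdd _ x)) : ℕ) =
          f ((splitEquiv s).symm (Fin.natAdd _ y)) by omega)))
      simpa using this
    · refine Function.Embedding.ext fun i => ?_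
      obtain ⟨i, rfl⟩ := (splitEquiv s).symm.surjective i
      refine Fin.addCases (fun i => ?_) (fun i => ?_) i
      · simp only [embSplit, Function.Embedding.trans_apply,
        Equiv.toEmbedding_apply, Equiv.apply_symm_apply, embSum_castAdd]
        rfl
      · simp only [embSplit, Function.Embedding.trans_apply,
        Equiv.toEmbedding_apply, Equiv.apply_symm_apply, embSum_natAdd]
        have := h2 i
        refine Fin.ext ?_
        change A + ((f ((splitEquiv s).symm (Fin.natAdd _ i)) : ℕ) - A) = _
        omega

theorem exists_equiv_extending_right {m n r : ℕ} (hr : r + m = n) (j : Fin m ↪ Fin n) :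
    ∃ e : Fin (r + m) ≃ Fin n, ∀ i, e (Fin.natAdd r i) = j i := by
  subst hr
  obtain ⟨e, he⟩ := exists_equiv_extending j
  refine ⟨finAddFlip.trans ((finCongr (by omega)).trans e), fun i => ?_⟩
  rw [← he i]
  simp only [Equiv.trans_apply, finAddFlip_apply_natAdd]
  rfl

/-- A sum over all permutations of `n + m` letters, as a sum over the images of the last `m`
letters. -/
theorem sum_perm_eq_sum_embedding {M : Type*} [AddCommMonoid M] (n m : ℕ)
    (f : Equiv.Perm (Fin (n + m)) → M) :
    ∑ σ, f σ = ∑ j : Fin m ↪ Fin (n + m), ∑ τ : Equiv.Perm (Fin n),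
      f ((finSum τ (Equiv.refl (Fin m))).trans (exists_equiv_extending_right rfl j).choose) := by
  rw [← Fintype.sum_prod_type']
  symm
  refine Fintype.sum_bijective (fun x : (Fin m ↪ Fin (n + m)) × Equiv.Perm (Fin n) =>
    (finSum x.2 (Equiv.refl (Fin m))).trans (exists_equiv_extending_right rfl x.1).choose)
    ?_ _ _ fun _ => rfl
  constructor
  · rintro ⟨j, τ⟩ ⟨j', τ'⟩ h
    have hj : j = j' := by
      refine Function.Embedding.ext fun i => ?_
      have := DFunLike.congr_fun h (Fin.natAdd n i)
      simpa [finSum_natAdd, (exists_equiv_extending_right rfl j).choose_spec,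
        (exists_equiv_extending_right rfl j').choose_spec] using this
    subst hj
    have hτ : τ = τ' := by
      ext i
      have := DFunLike.congr_fun h (Fin.castAdd m i)
      exact congrArg Fin.val (by simpa [finSum_castAdd] using this)
    rw [hτ]
  · intro σ
    let j : Fin m ↪ Fin (n + m) := (Fin.natAddEmb n).trans σ.toEmbedding
    have hj := (exists_equiv_extending_right rfl j).choose_spec
    -- After undoing the chosen extension, the permutation fixes the last `m` letters, so only an
    -- ordering of the first `n` remains.
    obtain ⟨τ, hτ⟩ := exists_finSum_refl_right
      (σ.trans (exists_equiv_extending_right rfl j).choose.symm) (fun i => by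
        rw [Equiv.trans_apply, Equiv.symm_apply_eq, hj i]
        rfl)
    refine ⟨(j, τ), ?_⟩
    change (finSum τ (Equiv.refl (Fin m))).trans _ = σ
    rw [← hτ]
    ext i
    simp

end Embeddings

/-! ### Adding inputs along embeddings -/

namespace HopfCooperad

variable {R : Type u} [CommRing R] (C : HopfCooperad.{u, w} R)

/-- The map `u𝒞(m) → u𝒞(n)`, dual to inserting unitary operations into the inputs outside the image
of an embedding. -/
def ext {m n : ℕ} (j : Fin m ↪ Fin n) : C.obj m →ₗ[R] C.obj n :=
  (C.map (exists_equiv_extending j).choose).toLinearMap ∘ₗ C.addInputs m (n - m)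

/-- Two extensions of `j` to bijections differ by a permutation of the added inputs, and `addInputs`
is invariant under those. Hence the choice in `ext` is immaterial. -/
theorem ext_eq {m n r : ℕ} (j : Fin m ↪ Fin n) (e : Fin (m + r) ≃ Fin n)
    (h : ∀ i, e (Fin.castAdd r i) = j i) (x : C.obj m) :
    C.ext j x = C.map e (C.addInputs m r x) := by
  obtain rfl : r = n - m := by
    have := Fintype.card_congr e
    simp at this
    omega
  have h' := (exists_equiv_extending j).choose_spec
  simp only [ext, LinearMap.comp_apply, AlgHom.toLinearMap_apply]
  set e' := (exists_equiv_extending j).choose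
  obtain ⟨τ, hτ⟩ := exists_finSum_refl_left (e.trans e'.symm) (fun i => by
    rw [Equiv.trans_apply, Equiv.symm_apply_eq, h, h'])
  have : e = (finSum (Equiv.refl (Fin m)) τ).trans e' := by
    rw [← hτ]
    ext i
    simp
  rw [this, C.map_trans, C.addInputs_perm]

theorem ext_toEmbedding {m n : ℕ} (e : Fin m ≃ Fin n) (x : C.obj m) :
    C.ext e.toEmbedding x = C.map e x :=
  C.ext_eq (r := 0) e.toEmbedding e (fun _ => rfl) x

theorem ext_castAdd (m r : ℕ) (x : C.obj m) :
    C.ext (Fin.castAddEmb r) x = C.addInputs m r x := by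
  rw [C.ext_eq (r := r) (Fin.castAddEmb r) (Equiv.refl _) (fun _ => rfl) x, C.map_refl]

theorem ext_natAdd (m r : ℕ) (x : C.obj m) :
    C.ext (Fin.natAddEmb r) x = C.addInputsLeft r m x := by
  rw [C.ext_eq (r := r) (Fin.natAddEmb r) finAddFlip (fun i => by simp) x]
  rfl

theorem addInputs_add (m r : ℕ) (x : C.obj m) : ∀ s : ℕ,
    C.map (finCongr (Nat.add_assoc m r s)) (C.addInputs (m + r) s (C.addInputs m r x)) =
      C.addInputs m (r + s) x
  | 0 => C.map_refl _ _
  | s + 1 => by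
    have h := congrArg (C.addInput (m + (r + s))) (addInputs_add m r x s)
    rw [addInput_map] at h
    refine Eq.trans ?_ h
    rw [show finSum (finCongr (Nat.add_assoc m r s)) (Equiv.refl (Fin 1)) =
      finCongr (Nat.add_assoc m r (s + 1)) from ?_]
    · rfl
    · ext i
      simp only [finSum_val, Equiv.refl_apply, finCongr_apply, Fin.val_cast]
      split_ifs <;> omega

/-- Functoriality on injections: extensions of `j` and `k` combine to an extension of the composite,
and `ext_eq` allows its use. -/
theorem ext_trans {l m n : ℕ} (j : Fin l ↪ Fin m) (k : Fin m ↪ Fin n) (x : C.obj l) :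
    C.ext (j.trans k) x = C.ext k (C.ext j x) := by
  obtain ⟨e, he⟩ := exists_equiv_extending j
  obtain ⟨f, hf⟩ := exists_equiv_extending k
  rw [C.ext_eq j e he, C.ext_eq k f hf, C.addInputs_map, ← C.map_trans,
    C.ext_eq (r := (m - l) + (n - m)) (j.trans k)
      ((finCongr (Nat.add_assoc l (m - l) (n - m)).symm).trans
        ((finSum e (Equiv.refl (Fin (n - m)))).trans f)), ← C.addInputs_add, ← C.map_trans]
  · rfl
  · intro i
    rw [Equiv.trans_apply, Equiv.trans_apply, show finCongr (Nat.add_assoc l (m - l) (n - m)).symm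
      (Fin.castAdd _ i) = Fin.castAdd _ (Fin.castAdd _ i) from rfl, finSum_castAdd, he, hf]
    rfl

theorem map_ext {l m n : ℕ} (j : Fin l ↪ Fin m) (e : Fin m ≃ Fin n) (x : C.obj l) :
    C.map e (C.ext j x) = C.ext (j.trans e.toEmbedding) x := by
  rw [ext_trans, ext_toEmbedding]

theorem ext_map {l m n : ℕ} (e : Fin l ≃ Fin m) (j : Fin m ↪ Fin n) (x : C.obj l) :
    C.ext j (C.map e x) = C.ext (e.toEmbedding.trans j) x := by
  rw [ext_trans, ext_toEmbedding]

/-- The partial decompositions are maps of unital algebras. Through this fact the symmetrized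
exponential disappears from Hopf products. -/
theorem addInput_one (n : ℕ) : C.addInput n 1 = 1 := by
  simp only [addInput, partialDecomp, LinearMap.comp_apply, LinearEquiv.coe_coe,
    AlgHom.toLinearMap_apply, map_one]
  have : (GradedTensorProduct.of R (C.deg (n + 1)) (C.deg 0)).symm 1 = 1 ⊗ₜ 1 := rfl
  rw [this]
  simp

theorem addInputs_one (n : ℕ) : ∀ m, C.addInputs n m 1 = 1
  | 0 => rfl
  | m + 1 => by
    simp only [addInputs, LinearMap.comp_apply]
    rw [addInputs_one n m, addInput_one]

theorem ext_one {m n : ℕ} (j : Fin m ↪ Fin n) : C.ext j 1 = 1 := by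
  simp [ext, addInputs_one]

end HopfCooperad

/-! ### Partial decompositions and added inputs -/

namespace HopfCooperad

variable {R : Type u} [CommRing R] (C : HopfCooperad.{u, w} R)

/-- The evaluation `M ⊗ u𝒞(0) → M`. -/
def contractUnit (M : Type*) [AddCommGroup M] [Module R M] : M ⊗[R] C.obj 0 →ₗ[R] M :=
  (TensorProduct.rid R M).toLinearMap ∘ₗ TensorProduct.map LinearMap.id C.unitary.toLinearMap

theorem contractUnit_tmul {M : Type*} [AddCommGroup M] [Module R M] (x : M) (c : C.obj 0) :
    C.contractUnit M (x ⊗ₜ c) = C.unitary c • x := by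
  simp [contractUnit]

theorem contractUnit_map {M N : Type*} [AddCommGroup M] [Module R M] [AddCommGroup N] [Module R N]
    (f : M →ₗ[R] N) (z : M ⊗[R] C.obj 0) :
    C.contractUnit N (TensorProduct.map f LinearMap.id z) = f (C.contractUnit M z) := by
  induction z using TensorProduct.induction_on with
  | zero => simp
  | add a b ha hb => simp only [map_add, ha, hb]
  | tmul a b => simp [contractUnit_tmul]

theorem addInput_eq (n : ℕ) (x : C.obj n) :
    C.addInput n x = C.contractUnit _ (C.partialDecomp n 0 x) := rfl

theorem partialDecomp_map {a a' b b' : ℕ} (σ : Fin a ≃ Fin a') (τ : Fin b ≃ Fin b')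
    (x : C.obj (a + b)) :
    C.partialDecomp a' b' (C.map (finSum σ τ) x) =
      TensorProduct.map (C.map (finSum σ (Equiv.refl (Fin 1)))).toLinearMap (C.map τ).toLinearMap
        (C.partialDecomp a b x) :=
  C.decomp_map σ τ x

theorem partialDecomp_one (a b : ℕ) : C.partialDecomp a b 1 = 1 ⊗ₜ 1 := by
  simp only [partialDecomp, LinearMap.comp_apply, AlgHom.toLinearMap_apply, map_one]
  rfl

/-- Sequential coassociativity with an empty innermost block, after evaluating the factor in
`u𝒞(0)`. -/
theorem partialDecomp_addInput_right (a b : ℕ) (x : C.obj (a + b)) :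
    C.partialDecomp a (b + 1) (C.addInput (a + b) x) =
      TensorProduct.map LinearMap.id (C.addInput b) (C.partialDecomp a b x) := by
  let G : C.obj (a + 1) ⊗[R] (C.obj (b + 1) ⊗[R] C.obj 0) →ₗ[R]
      C.obj (a + 1) ⊗[R] C.obj (b + 1) :=
    TensorProduct.map LinearMap.id (C.contractUnit _)
  have h := congrArg G (C.coassoc_seq a b 0 x)
  have h0 : C.map (finCongr (Nat.add_assoc a b 0).symm) x = x := C.map_refl _ x
  have h1 : ∀ z : C.obj (a + 1) ⊗[R] C.obj b,
      G (TensorProduct.map LinearMap.id (C.partialDecomp b 0) z) =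
        TensorProduct.map LinearMap.id (C.addInput b) z := by
    intro z
    induction z using TensorProduct.induction_on with
    | zero => simp
    | add a b ha hb => simp only [map_add, ha, hb]
    | tmul a b => simp [G, addInput_eq]
  have h2 : ∀ z : (C.obj (a + 1) ⊗[R] C.obj (b + 1)) ⊗[R] C.obj 0,
      G (TensorProduct.assoc R _ _ _ z) = C.contractUnit _ z := by
    intro z
    induction z using TensorProduct.induction_on with
    | zero => simp
    | add a b ha hb => simp only [map_add, ha, hb]
    | tmul a c =>
      induction a using TensorProduct.induction_on with
      | zero => simp
      | add a b ha hb => simp only [map_add, TensorProduct.add_tmul, ha, hb]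
      | tmul a b => simp [G, contractUnit_tmul]
  have h3 := (h1 (C.partialDecomp a b x)).symm.trans h
  rw [h2] at h3
  erw [h0] at h3
  rw [h3, addInput_eq]
  exact (C.contractUnit_map (C.partialDecomp a (b + 1)) (C.partialDecomp (a + b) 0 x)).symm

theorem finSwap_one_one (a : ℕ) : (finSwap a 1 1).trans (finSwap a 1 1) = Equiv.refl _ := by
  ext i
  rw [Equiv.trans_apply, finSwap_val, finSwap_val]
  simp only [Equiv.refl_apply]
  have := i.isLt
  split_ifs <;> omega

/-- Parallel coassociativity with one block empty. The Koszul switch is an ordinary switch there,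
because `u𝒞(0)` is in degree zero. The block exchange moves the new input in front of the block that
is split off. -/
theorem partialDecomp_addInput_left (a b : ℕ) (x : C.obj (a + b)) :
    C.partialDecomp (a + 1) b (C.map (finSwap a b 1) (C.addInput (a + b) x)) =
      TensorProduct.map ((C.map (finSwap a 1 1)).toLinearMap ∘ₗ C.addInput (a + 1)) LinearMap.id
        (C.partialDecomp a b x) := by
  let G : C.obj (a + 1 + 1) ⊗[R] (C.obj 0 ⊗[R] C.obj b) →ₗ[R] C.obj (a + 1 + 1) ⊗[R] C.obj b :=
    TensorProduct.map LinearMap.id (C.contractUnit _ ∘ₗ (TensorProduct.comm R _ _).toLinearMap)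
  have hG : ∀ z, G (TensorProduct.map LinearMap.id (koszulSwap (C.deg b) (C.deg 0)) z) =
      TensorProduct.map LinearMap.id (C.contractUnit _) z := by
    intro z
    induction z using TensorProduct.induction_on with
    | zero => simp
    | add a b ha hb => simp only [map_add, ha, hb]
    | tmul a b =>
      induction b using TensorProduct.induction_on with
      | zero => simp
      | add b c hb hc => simp only [map_add, TensorProduct.tmul_add, hb, hc]
      | tmul b c =>
        simp only [G, koszulSwap, signInv, (C.parityPart_zero c).1, (C.parityPart_zero c).2,
          TensorProduct.map_tmul, LinearMap.id_apply, LinearMap.comp_apply, LinearMap.add_apply,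
          LinearMap.sub_apply, LinearEquiv.coe_coe, TensorProduct.comm_tmul, map_add, sub_zero,
          contractUnit_tmul, ← TensorProduct.tmul_add, parityPart_false_add_true]
  have h2 : ∀ z : (C.obj (a + 1 + 1) ⊗[R] C.obj b) ⊗[R] C.obj 0,
      TensorProduct.map LinearMap.id (C.contractUnit _) (TensorProduct.assoc R _ _ _ z) =
        C.contractUnit _ z := by
    intro z
    induction z using TensorProduct.induction_on with
    | zero => simp
    | add a b ha hb => simp only [map_add, ha, hb]
    | tmul a c =>
      induction a using TensorProduct.induction_on with
      | zero => simp
      | add a b ha hb => simp only [map_add, TensorProduct.add_tmul, ha, hb]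
      | tmul a b => simp [contractUnit_tmul]
  have h3 : ∀ (f : C.obj (a + 1) →ₗ[R] C.obj (a + 1 + 1) ⊗[R] C.obj 0)
      (z : C.obj (a + 1) ⊗[R] C.obj b),
      G (TensorProduct.assoc R _ _ _ (TensorProduct.map f LinearMap.id z)) =
        TensorProduct.map (C.contractUnit _ ∘ₗ f) LinearMap.id z := by
    intro f z
    induction z using TensorProduct.induction_on with
    | zero => simp
    | add a b ha hb => simp only [map_add, ha, hb]
    | tmul a c =>
      simp only [TensorProduct.map_tmul, LinearMap.comp_apply, LinearMap.id_apply]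
      generalize f a = y
      induction y using TensorProduct.induction_on with
      | zero => simp
      | add a b ha hb => simp only [map_add, TensorProduct.add_tmul, ha, hb]
      | tmul a d => simp [G, contractUnit_tmul, TensorProduct.smul_tmul]
  have hs0 : finSwap a b 0 = Equiv.refl _ := by
    ext i
    refine (finSwap_val a b 0 i).trans ?_
    have hi : (i : ℕ) < a + b := i.isLt
    simp only [Equiv.refl_apply]
    split_ifs <;> omega
  have hs1 : finSwap a 0 1 = Equiv.refl (Fin (a + 1)) := by
    ext i
    refine (finSwap_val a 0 1 i).trans ?_
    have hi : (i : ℕ) < a + 1 := i.isLt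
    simp only [Equiv.refl_apply]
    split_ifs <;> omega
  have h := congrArg G (C.coassoc_par a b 0 x)
  rw [hG, h2] at h
  have hl := C.contractUnit_map
      ((TensorProduct.map (C.map (finSwap a 1 1)).toLinearMap LinearMap.id) ∘ₗ
    C.partialDecomp (a + 1) b ∘ₗ (C.map (finSwap a b 1)).toLinearMap) (C.partialDecomp (a + b) 0 x)
  have hr := h3 (C.partialDecomp (a + 1) 0 ∘ₗ (C.map (finSwap a 0 1)).toLinearMap)
    (C.partialDecomp a b (C.map (finSwap a b 0) x))
  have h4 := (hl.symm.trans h).trans hr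
  rw [hs0, hs1, C.map_refl] at h4
  -- Exchanging the last two inputs is an involution; applying it once more clears it from the
  -- left-hand side.
  have h5 := congrArg (TensorProduct.map (C.map (finSwap a 1 1)).toLinearMap
    (LinearMap.id (R := R) (M := C.obj b))) h4
  have hinv : (C.map (finSwap a 1 1)).toLinearMap ∘ₗ (C.map (finSwap a 1 1)).toLinearMap =
      LinearMap.id := by
    ext y
    simp only [LinearMap.comp_apply, AlgHom.toLinearMap_apply, LinearMap.id_apply]
    rw [← C.map_trans, finSwap_one_one, C.map_refl]
  rw [← LinearMap.comp_apply, LinearMap.comp_apply (TensorProduct.map _ _), ← LinearMap.comp_apply,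
    ← LinearMap.comp_assoc, ← TensorProduct.map_comp, hinv, LinearMap.id_comp, TensorProduct.map_id,
    LinearMap.id_comp, ← LinearMap.comp_apply (TensorProduct.map _ _),
    ← TensorProduct.map_comp] at h5
  refine h5.trans ?_
  congr 2
  ext y
  change _ = C.map _ (C.contractUnit _ (C.partialDecomp (a + 1) 0 y))
  simp only [LinearMap.comp_apply, AlgHom.toLinearMap_apply, C.map_refl]

/-- Compatibility of the partial decompositions with added inputs. -/
def ExtCompatible {a a' b b' : ℕ} (j : Fin a ↪ Fin a') (k : Fin b ↪ Fin b') : Prop :=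
  ∀ x : C.obj (a + b), C.partialDecomp a' b' (C.ext (embSum j k) x) =
    TensorProduct.map (C.ext (embSum j (Function.Embedding.refl (Fin 1)))) (C.ext k)
      (C.partialDecomp a b x)

variable {C} in
theorem ExtCompatible.trans {a a' a'' b b' b'' : ℕ} {j : Fin a ↪ Fin a'} {k : Fin b ↪ Fin b'}
    {j' : Fin a' ↪ Fin a''} {k' : Fin b' ↪ Fin b''} (h : C.ExtCompatible j k)
    (h' : C.ExtCompatible j' k') : C.ExtCompatible (j.trans j') (k.trans k') := by
  intro x
  rw [← embSum_trans, C.ext_trans, h', h, ← LinearMap.comp_apply, ← TensorProduct.map_comp]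
  congr 2
  · ext y
    rw [LinearMap.comp_apply, ← C.ext_trans, embSum_trans]
    rfl
  · ext y
    rw [LinearMap.comp_apply, ← C.ext_trans]

theorem extCompatible_equiv {a a' b b' : ℕ} (σ : Fin a ≃ Fin a') (τ : Fin b ≃ Fin b') :
    C.ExtCompatible σ.toEmbedding τ.toEmbedding := by
  intro x
  rw [embSum_toEmbedding, C.ext_toEmbedding, C.partialDecomp_map]
  congr 2
  · ext y
    have := C.ext_toEmbedding (finSum σ (Equiv.refl (Fin 1))) y
    rw [← embSum_toEmbedding] at this
    exact this.symm
  · ext y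
    exact (C.ext_toEmbedding τ y).symm

theorem ext_refl {n : ℕ} (x : C.obj n) : C.ext (Function.Embedding.refl _) x = x :=
  (C.ext_toEmbedding (Equiv.refl _) x).trans (C.map_refl _ x)

theorem extCompatible_right (a b : ℕ) :
    C.ExtCompatible (Function.Embedding.refl (Fin a)) (Fin.castAddEmb (n := b) 1) := by
  intro x
  have h : embSum (Function.Embedding.refl (Fin a)) (Fin.castAddEmb (n := b) 1) =
      Fin.castAddEmb (n := a + b) 1 := by
    ext i
    refine (embSum_val _ _ i).trans ?_
    simp only [Function.Embedding.refl_apply, Fin.castAddEmb_apply, Fin.val_castAdd]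
    split_ifs <;> omega
  rw [h]
  have h1 := C.ext_castAdd (a + b) 1 x
  refine (congrArg (C.partialDecomp a (b + 1)) h1).trans
    ((C.partialDecomp_addInput_right a b x).trans ?_)
  congr 2
  · ext y
    rw [embSum_refl]
    exact (C.ext_refl y).symm
  · ext y
    exact (C.ext_castAdd b 1 y).symm

theorem embSum_castAddEmb_one (a b : ℕ) :
    embSum (Fin.castAddEmb (n := a) 1) (Function.Embedding.refl (Fin b)) =
      (Fin.castAddEmb (n := a + b) 1).trans (finSwap a b 1).toEmbedding := by
  ext i
  have h : (((Fin.castAddEmb (n := a + b) 1).trans (finSwap a b 1).toEmbedding i : Fin _) : ℕ) =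
    if (i : ℕ) < a then (i : ℕ) else if (i : ℕ) < a + b then i + 1 else i - b :=
    finSwap_val a b 1 _
  rw [h]
  refine (embSum_val _ _ i).trans ?_
  simp only [Function.Embedding.refl_apply, Fin.castAddEmb_apply, Fin.val_castAdd]
  split_ifs <;> omega

theorem extCompatible_left (a b : ℕ) :
    C.ExtCompatible (Fin.castAddEmb (n := a) 1) (Function.Embedding.refl (Fin b)) := by
  intro x
  rw [embSum_castAddEmb_one, ← C.map_ext, C.ext_castAdd]
  refine (C.partialDecomp_addInput_left a b x).trans ?_
  congr 2
  · ext y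
    rw [embSum_castAddEmb_one, ← C.map_ext, C.ext_castAdd]
    rfl
  · ext y
    exact (C.ext_refl y).symm

theorem extCompatible_castAdd (a b r s : ℕ) :
    C.ExtCompatible (Fin.castAddEmb (n := a) r) (Fin.castAddEmb (n := b) s) := by
  have h1 : C.ExtCompatible (Fin.castAddEmb (n := a) r) (Function.Embedding.refl (Fin b)) := by
    induction r with
    | zero => exact C.extCompatible_equiv (Equiv.refl _) (Equiv.refl _)
    | succ r ih =>
      have h := ih.trans (C.extCompatible_left (a + r) b)
      rw [show (Fin.castAddEmb (n := a) r).trans (Fin.castAddEmb 1) =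
        (Fin.castAddEmb (n := a) (r + 1) : Fin a ↪ Fin (a + r + 1)) from rfl,
        show (Function.Embedding.refl (Fin b)).trans (Function.Embedding.refl (Fin b)) =
        Function.Embedding.refl (Fin b) from rfl] at h
      exact h
  have h2 : C.ExtCompatible (Function.Embedding.refl (Fin (a + r)))
      (Fin.castAddEmb (n := b) s) := by
    induction s with
    | zero => exact C.extCompatible_equiv (Equiv.refl _) (Equiv.refl _)
    | succ s ih =>
      have h := ih.trans (C.extCompatible_right (a + r) (b + s))
      rw [show (Fin.castAddEmb (n := b) s).trans (Fin.castAddEmb 1) =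
        (Fin.castAddEmb (n := b) (s + 1) : Fin b ↪ Fin (b + s + 1)) from rfl,
        show (Function.Embedding.refl (Fin (a + r))).trans (Function.Embedding.refl _) =
        Function.Embedding.refl _ from rfl] at h
      exact h
  have h := h1.trans h2
  rw [show (Fin.castAddEmb (n := a) r).trans (Function.Embedding.refl _) =
    Fin.castAddEmb (n := a) r from rfl,
    show (Function.Embedding.refl (Fin b)).trans (Fin.castAddEmb s) =
    Fin.castAddEmb (n := b) s from rfl] at h
  exact h

/-- Every injection is an inclusion of an initial segment followed by a bijection. The bijections
are covered by equivariance, and the inclusions by adding one input at a time on either side of the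
decomposition. -/
theorem partialDecomp_ext {a a' b b' : ℕ} (j : Fin a ↪ Fin a') (k : Fin b ↪ Fin b')
    (x : C.obj (a + b)) :
    C.partialDecomp a' b' (C.ext (embSum j k) x) =
      TensorProduct.map (C.ext (embSum j (Function.Embedding.refl (Fin 1)))) (C.ext k)
        (C.partialDecomp a b x) := by
  obtain ⟨e, he⟩ := exists_equiv_extending j
  obtain ⟨f, hf⟩ := exists_equiv_extending k
  have hj : j = (Fin.castAddEmb _).trans e.toEmbedding :=
    Function.Embedding.ext fun i => (he i).symm
  have hk : k = (Fin.castAddEmb _).trans f.toEmbedding :=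
    Function.Embedding.ext fun i => (hf i).symm
  have := (C.extCompatible_castAdd a b (a' - a) (b' - b)).trans (C.extCompatible_equiv e f)
  rw [← hj, ← hk] at this
  exact this x

/-! ### Degrees of operations with added inputs. -/

theorem mem_deg_zero (y : C.obj 0) : y ∈ C.deg 0 0 := by
  have : y = algebraMap R _ (C.unitary y) := by
    apply C.unitary.injective
    simp
  rw [this]
  exact SetLike.algebraMap_mem_graded _ _

theorem mem_deg_one_zero (y : C.obj 1) : y ∈ C.deg 1 0 := by
  have : y = algebraMap R _ (C.counit y) := by
    apply C.counit.injective
    simp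
  rw [this]
  exact SetLike.algebraMap_mem_graded _ _

/-- The decomposition is homogeneous and `u𝒞(0)` lies in degree zero, so evaluating that factor does
not shift degrees. -/
theorem addInput_deg (n : ℕ) (i : ℤ) {x : C.obj n} (hx : x ∈ C.deg n i) :
    C.addInput n x ∈ C.deg (n + 1) i := by
  have h : C.partialDecomp n 0 x ∈ tensorDeg (C.deg (n + 1)) (C.deg 0) i := C.decomp_deg n 0 i x hx
  rw [addInput_eq]
  suffices tensorDeg (C.deg (n + 1)) (C.deg 0) i ≤ (C.deg (n + 1) i).comap (C.contractUnit _) from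
    this h
  refine iSup_le fun p => Submodule.map₂_le.mpr fun y hy z hz => ?_
  rw [Submodule.mem_comap]
  change C.contractUnit _ (y ⊗ₜ z) ∈ _
  rw [contractUnit_tmul]
  by_cases hz0 : z = 0
  · simp [hz0]
  · have := DirectSum.degree_eq_of_mem_mem (C.deg 0) hz (C.mem_deg_zero z) hz0
    obtain rfl : p = i := by omega
    exact Submodule.smul_mem _ _ hy

theorem addInputs_deg (n : ℕ) (i : ℤ) {x : C.obj n} (hx : x ∈ C.deg n i) :
    ∀ m, C.addInputs n m x ∈ C.deg (n + m) i
  | 0 => hx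
  | m + 1 => C.addInput_deg _ _ (addInputs_deg n i hx m)

theorem addInputsLeft_deg (n m : ℕ) (i : ℤ) {x : C.obj m} (hx : x ∈ C.deg m i) :
    C.addInputsLeft n m x ∈ C.deg (n + m) i :=
  C.map_deg _ _ _ (C.addInputs_deg m i hx n)

end HopfCooperad

/-! ### Inserting an even element into tensor powers -/

/-! ### Koszul signs of injections. -/

section Signs

/-- The Koszul sign of an injective map. -/
def embSign {m n : ℕ} (f : Fin m → Fin n) (ε : Fin m → Bool) : ℤ :=
  ∏ i, ∏ j, if i < j ∧ f j < f i ∧ ε i = true ∧ ε j = true then -1 else 1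

/-- Groups the terms at `(i, j)` and `(j, i)`. An injection may reverse a pair, so a sign indexed by
`f i < f j` must be rewritten over pairs `i < j` before two signs can be compared. -/
theorem prod_prod_eq_of_lt {m : ℕ} (a : Fin m → Fin m → ℤ) (h : ∀ i, a i i = 1) :
    ∏ i, ∏ j, a i j = ∏ i, ∏ j, if i < j then a i j * a j i else 1 := by
  have h1 : ∀ i j, a i j = (if i < j then a i j else 1) * (if j < i then a i j else 1) := by
    intro i j
    rcases lt_trichotomy i j with hij | hij | hij
    · simp [hij, hij.not_gt]
    · simp [hij, h]
    · simp [hij, hij.not_gt]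
  have h2 : ∀ i j, (if i < j then a i j * a j i else 1) =
      (if i < j then a i j else 1) * (if i < j then a j i else 1) := by
    intro i j
    split_ifs <;> simp
  simp_rw [h2]
  conv_lhs =>
    enter [2, i, 2, j]
    rw [h1]
  simp_rw [Finset.prod_mul_distrib]
  congr 1
  exact Finset.prod_comm

/-- The Koszul sign of a composition of injective maps. -/
theorem embSign_comp {l m n : ℕ} (f : Fin l ↪ Fin m) (g : Fin m ↪ Fin n) (ε : Fin l → Bool) :
    embSign (g ∘ f) ε =
      embSign f ε * embSign g (Function.extend f ε fun _ => false) := by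
  have hext : ∀ i, Function.extend f ε (fun _ => false) (f i) = ε i :=
    fun i => f.injective.extend_apply _ _ _
  have hext' : ∀ i, i ∉ Set.range f → Function.extend f ε (fun _ => false) i = false :=
    fun i hi => Function.extend_apply' _ _ _ hi
  have hg : embSign g (Function.extend f ε fun _ => false) =
      ∏ i, ∏ j, if f i < f j ∧ g (f j) < g (f i) ∧ ε i = true ∧ ε j = true then -1 else 1 := by
    unfold embSign
    symm
    refine Finset.prod_of_injOn f (f.injective.injOn) (by simp) (fun i _ hi => ?_) (fun i _ => ?_)
    · refine Finset.prod_eq_one fun j _ => if_neg ?_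
      rw [hext' i (by simpa using hi)]
      simp
    · refine Finset.prod_of_injOn f (f.injective.injOn) (by simp) (fun j _ hj => ?_)
        (fun j _ => ?_)
      · refine if_neg ?_
        rw [hext' j (by simpa using hj)]
        simp
      · rw [hext, hext]
  rw [hg]
  unfold embSign
  rw [prod_prod_eq_of_lt (fun i j => if f i < f j ∧ g (f j) < g (f i) ∧ ε i = true ∧ ε j = true
    then (-1 : ℤ) else 1) (fun i => by simp), ← Finset.prod_mul_distrib]
  refine Finset.prod_congr rfl fun i _ => ?_
  rw [← Finset.prod_mul_distrib]
  refine Finset.prod_congr rfl fun j _ => ?_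
  -- For a single pair, the composite inverts it exactly when one of `f` and `g` does and the other
  -- does not.
  by_cases hij : i < j
  · have hf : f i ≠ f j := fun h => hij.ne (f.injective h)
    have hgf : g (f i) ≠ g (f j) := fun h => hf (g.injective h)
    simp only [hij, true_and, if_true, Function.comp_apply]
    rcases lt_or_gt_of_ne hf with h1 | h1 <;> rcases lt_or_gt_of_ne hgf with h2 | h2 <;>
      simp [h1, h2, h1.not_gt, h2.not_gt] <;> cases ε i <;> cases ε j <;> simp
  · simp [hij]

theorem embSign_embSum {a a' b b' : ℕ} (j : Fin a ↪ Fin a') (k : Fin b ↪ Fin b')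
    (ε : Fin a → Bool) (ε' : Fin b → Bool) :
    embSign (embSum j k) (Fin.append ε ε') = embSign j ε * embSign k ε' := by
  have hlt : ∀ {p q : ℕ} (i j : Fin p), Fin.castAdd q i < Fin.castAdd q j ↔ i < j :=
    fun _ _ => Iff.rfl
  have h1 : ∀ (i : Fin a') (j : Fin b'), ¬ Fin.natAdd a' j < Fin.castAdd b' i := by
    intro i j h
    have := Fin.lt_def.mp h
    simp at this; omega
  have h2 : ∀ (i : Fin a) (j : Fin b), ¬ Fin.natAdd a j < Fin.castAdd b i := by
    intro i j h
    have := Fin.lt_def.mp h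
    simp at this; omega
  unfold embSign
  rw [Fin.prod_univ_add]
  congr 1
  · refine Finset.prod_congr rfl fun i _ => ?_
    rw [Fin.prod_univ_add]
    simp [embSum_castAdd, embSum_natAdd, h1, hlt]
  · refine Finset.prod_congr rfl fun i _ => ?_
    rw [Fin.prod_univ_add]
    simp [embSum_castAdd, embSum_natAdd, h2]

end Signs

/-! ### Tensor powers as functors on injections, with an even filler. -/

section Tensor

variable {R : Type u} [CommRing R] {M : Type v} [AddCommGroup M] [Module R M]
  (𝒜 : ℤ → Submodule R M) [DirectSum.Decomposition 𝒜]

theorem parityPart_parityPart (b c : Bool) (x : M) :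
    parityPart 𝒜 b (parityPart 𝒜 c x) = if b = c then parityPart 𝒜 b x else 0 := by
  simp only [parityPart, scaleByDegree_scaleByDegree]
  split_ifs with h
  · subst h
    congr 2
    ext i
    split_ifs <;> simp
  · have : (fun i : ℤ => (if (Odd i ↔ b = true) then (1 : R) else 0) *
        (if (Odd i ↔ c = true) then 1 else 0)) = fun _ => 0 := by
      ext i
      cases b <;> cases c <;> simp_all
    classical
    rw [← DirectSum.sum_support_decompose 𝒜 x, map_sum]
    refine Finset.sum_eq_zero fun i _ => ?_
    rw [scaleByDegree_apply_of_mem 𝒜 _ (SetLike.coe_mem _)]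
    exact (congrArg (· • _) (congrFun this i)).trans (zero_smul _ _)

/-- The factors of a pure tensor have parities prescribed by `η`. -/
def IsPure {m : ℕ} (η : Fin m → Bool) (x : Fin m → M) : Prop :=
  ∀ i, parityPart 𝒜 (η i) (x i) = x i

theorem parityPart_of_pure {b : Bool} {x : M} (hx : parityPart 𝒜 b x = x) (c : Bool) :
    parityPart 𝒜 c x = if c = b then x else 0 := by
  rw [← hx, parityPart_parityPart]
  split_ifs with h
  · rw [h]
  · rfl

theorem signInv_of_pure {b : Bool} {x : M} (hx : parityPart 𝒜 b x = x) :
    signInv 𝒜 x = (if b = true then (-1 : R) else 1) • x := by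
  simp only [signInv, LinearMap.sub_apply, parityPart_of_pure 𝒜 hx]
  cases b <;> simp

theorem parityPart_false_of_mem {x : M} (hx : x ∈ 𝒜 0) : parityPart 𝒜 false x = x := by
  simp [parityPart, scaleByDegree_apply_of_mem 𝒜 _ hx]

/-- Linear maps agree if they agree on pure tensors with factors of pure parity. -/
theorem tensorPower_ext {N : Type*} [AddCommGroup N] [Module R N] {m : ℕ}
    {f g : ⨂[R]^m M →ₗ[R] N}
    (h : ∀ (η : Fin m → Bool) (x : Fin m → M), IsPure 𝒜 η x →
      f (PiTensorProduct.tprod R x) = g (PiTensorProduct.tprod R x)) : f = g := by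
  classical
  refine PiTensorProduct.ext (MultilinearMap.ext fun x => ?_)
  have hx : x = fun i => ∑ b : Bool, parityPart 𝒜 b (x i) := by
    funext i
    rw [Fintype.sum_bool, add_comm, parityPart_false_add_true]
  change f (PiTensorProduct.tprod R x) = g (PiTensorProduct.tprod R x)
  rw [hx, (PiTensorProduct.tprod R).map_sum, map_sum, map_sum]
  exact Finset.sum_congr rfl fun η _ => h η _ fun i => by rw [parityPart_parityPart, if_pos rfl]

/-- In the sum over parity patterns, every pattern other than `η` kills some factor, so one sign is
left. -/
theorem signedReindex_tprod_of_pure {m n : ℕ} (e : Fin m ≃ Fin n) {η : Fin m → Bool}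
    {x : Fin m → M} (hx : IsPure 𝒜 η x) :
    signedReindex 𝒜 e (PiTensorProduct.tprod R x) =
      (embSign e η : R) • PiTensorProduct.tprod R (fun i => x (e.symm i)) := by
  rw [signedReindex_tprod, Finset.sum_eq_single η]
  · congr 2
    funext i
    exact hx _
  · intro ε _ hε
    obtain ⟨i, hi⟩ := Function.ne_iff.mp hε
    rw [(PiTensorProduct.tprod R).map_coord_zero (e i), smul_zero]
    rw [Equiv.symm_apply_apply, parityPart_of_pure 𝒜 (hx i), if_neg hi]
  · simp

/-- Moving the factors along an embedding, with Koszul signs, and filling up with `v`. -/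
def extTensor (v : M) {m n : ℕ} (j : Fin m ↪ Fin n) : ⨂[R]^m M →ₗ[R] ⨂[R]^n M :=
  signedReindex 𝒜 (exists_equiv_extending j).choose ∘ₗ TensorPower.mulEquiv.toLinearMap ∘ₗ
    (TensorProduct.mk R _ _).flip (PiTensorProduct.tprod R fun _ => v)

theorem isPure_append {a b : ℕ} {η : Fin a → Bool} {η' : Fin b → Bool} {x : Fin a → M}
    {y : Fin b → M} (hx : IsPure 𝒜 η x) (hy : IsPure 𝒜 η' y) :
    IsPure 𝒜 (Fin.append η η') (Fin.append x y) := by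
  intro i
  refine Fin.addCases (fun i => ?_) (fun i => ?_) i
  · simpa using hx i
  · simpa using hy i

theorem isPure_extend {v : M} (hv : v ∈ 𝒜 0) {m n : ℕ} (j : Fin m ↪ Fin n) {η : Fin m → Bool}
    {x : Fin m → M} (hx : IsPure 𝒜 η x) :
    IsPure 𝒜 (Function.extend j η fun _ => false) (Function.extend j x fun _ => v) := by
  intro i
  by_cases hi : ∃ k, j k = i
  · obtain ⟨k, rfl⟩ := hi
    rw [j.injective.extend_apply, j.injective.extend_apply, hx]
  · rw [Function.extend_apply' _ _ _ hi, Function.extend_apply' _ _ _ hi,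
      parityPart_false_of_mem 𝒜 hv]

theorem extend_append_comp {X : Type*} {m n r : ℕ} (j : Fin m ↪ Fin n) (e : Fin (m + r) ≃ Fin n)
    (he : ∀ i, e (Fin.castAdd r i) = j i) (x : Fin m → X) (c : X) (i : Fin n) :
    Fin.append x (fun _ => c) (e.symm i) = Function.extend j x (fun _ => c) i := by
  obtain ⟨i, rfl⟩ := e.surjective i
  rw [Equiv.symm_apply_apply]
  refine Fin.addCases (fun i => ?_) (fun i => ?_) i
  · rw [he, j.injective.extend_apply, Fin.append_left]
  · rw [Fin.append_right, Function.extend_apply']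
    rintro ⟨k, hk⟩
    rw [← he] at hk
    have := congrArg Fin.val (e.injective hk)
    simp at this
    omega

/-- The inserted copies of `v` are even and enter no sign, so the sign is that of `j` itself. In
particular the result does not depend on the extension chosen in `extTensor`. -/
theorem extTensor_tprod_of_pure {v : M} (hv : v ∈ 𝒜 0) {m n : ℕ} (j : Fin m ↪ Fin n)
    {η : Fin m → Bool} {x : Fin m → M}
    (hx : IsPure 𝒜 η x) :
    extTensor 𝒜 v j (PiTensorProduct.tprod R x) =
      (embSign j η : R) • PiTensorProduct.tprod R (Function.extend j x fun _ => v) := by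
  have he := (exists_equiv_extending j).choose_spec
  set e := (exists_equiv_extending j).choose with he'
  have hp := isPure_append 𝒜 hx (η' := fun _ : Fin (n - m) => false) (y := fun _ => v)
    (fun _ => parityPart_false_of_mem 𝒜 hv)
  simp only [extTensor, LinearMap.comp_apply, LinearMap.flip_apply, TensorProduct.mk_apply,
    LinearEquiv.coe_coe, mulEquiv_tprod]
  rw [signedReindex_tprod_of_pure 𝒜 _ hp, ← he']
  congr 2
  · have h1 := embSign_comp (Fin.castAddEmb (n - m)) e.toEmbedding η
    have h2 : (e.toEmbedding ∘ Fin.castAddEmb (n - m) : Fin m → Fin n) = j := funext he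
    have h3 : embSign (Fin.castAddEmb (n := m) (n - m)) η = 1 := by
      refine Finset.prod_eq_one fun i _ => Finset.prod_eq_one fun k _ => if_neg ?_
      rintro ⟨h1, h2, -⟩
      exact absurd (h1.trans h2) (lt_irrefl _)
    have h4 : Function.extend (Fin.castAddEmb (n - m)) η (fun _ => false) =
        Fin.append η fun _ => false := by
      funext i
      exact (extend_append_comp (Fin.castAddEmb (n - m)) (Equiv.refl _) (fun _ => rfl) η false
        i).symm
    rw [h2, h3, h4, one_mul] at h1
    rw [h1]
    rfl
  · funext i
    exact extend_append_comp j e he x v i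

/-- Together with `signedReindex_comp_extTensor`, functoriality with respect to bijections on either
side. Signs multiply by `embSign_comp`, since the filler is even. -/
theorem extTensor_comp_signedReindex {v : M} (hv : v ∈ 𝒜 0) {l m n : ℕ}
    (e : Fin l ≃ Fin m) (j : Fin m ↪ Fin n)
    (t : ⨂[R]^l M) :
    extTensor 𝒜 v j (signedReindex 𝒜 e t) = extTensor 𝒜 v (e.toEmbedding.trans j) t := by
  rw [← LinearMap.comp_apply]
  congr 1
  refine tensorPower_ext 𝒜 fun η x hx => ?_
  have hx' : IsPure 𝒜 (fun i => η (e.symm i)) (fun i => x (e.symm i)) := fun i => hx _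
  have h1 : ∀ {X : Type _} (y : Fin l → X) (c : X), Function.extend e.toEmbedding y (fun _ => c) =
      fun i => y (e.symm i) := by
    intro X y c
    funext i
    obtain ⟨i, rfl⟩ := e.surjective i
    rw [Equiv.symm_apply_apply]
    exact e.injective.extend_apply y _ i
  rw [LinearMap.comp_apply, signedReindex_tprod_of_pure 𝒜 e hx, map_smul,
    extTensor_tprod_of_pure 𝒜 hv j hx', extTensor_tprod_of_pure 𝒜 hv _ hx, smul_smul]
  congr 1
  · have := embSign_comp e.toEmbedding j η
    rw [h1] at this
    rw [← Int.cast_mul]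
    exact congrArg _ this.symm
  · congr 1
    funext i
    by_cases hi : ∃ k, j k = i
    · obtain ⟨k, rfl⟩ := hi
      obtain ⟨k, rfl⟩ := e.surjective k
      rw [j.injective.extend_apply, Equiv.symm_apply_apply]
      exact ((e.toEmbedding.trans j).injective.extend_apply x _ k).symm
    · rw [Function.extend_apply' _ _ _ hi, Function.extend_apply']
      rintro ⟨k, hk⟩
      exact hi ⟨e k, hk⟩

theorem signedReindex_comp_extTensor {v : M} (hv : v ∈ 𝒜 0) {l m n : ℕ}
    (j : Fin l ↪ Fin m) (e : Fin m ≃ Fin n)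
    (t : ⨂[R]^l M) :
    signedReindex 𝒜 e (extTensor 𝒜 v j t) = extTensor 𝒜 v (j.trans e.toEmbedding) t := by
  rw [← LinearMap.comp_apply]
  congr 1
  refine tensorPower_ext 𝒜 fun η x hx => ?_
  rw [LinearMap.comp_apply, extTensor_tprod_of_pure 𝒜 hv j hx, map_smul,
    signedReindex_tprod_of_pure 𝒜 e (isPure_extend 𝒜 hv j hx),
    extTensor_tprod_of_pure 𝒜 hv _ hx, smul_smul]
  congr 1
  · have := embSign_comp j e.toEmbedding η
    rw [← Int.cast_mul]
    exact congrArg _ this.symm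
  · congr 1
    funext i
    obtain ⟨i, rfl⟩ := e.surjective i
    rw [Equiv.symm_apply_apply]
    by_cases hi : ∃ k, j k = i
    · obtain ⟨k, rfl⟩ := hi
      rw [j.injective.extend_apply]
      exact ((j.trans e.toEmbedding).injective.extend_apply x _ k).symm
    · rw [Function.extend_apply' _ _ _ hi, Function.extend_apply']
      rintro ⟨k, hk⟩
      exact hi ⟨k, e.injective hk⟩

/-- No pair from different blocks is inverted, so the signs of the two blocks multiply and the
insertion is monoidal. -/
theorem extTensor_embSum {v : M} (hv : v ∈ 𝒜 0) {a a' b b' : ℕ}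
    (j : Fin a ↪ Fin a') (k : Fin b ↪ Fin b')
    (t : ⨂[R]^a M) (u : ⨂[R]^b M) :
    extTensor 𝒜 v (embSum j k) (TensorPower.mulEquiv (t ⊗ₜ[R] u)) =
      TensorPower.mulEquiv (extTensor 𝒜 v j t ⊗ₜ[R] extTensor 𝒜 v k u) := by
  let f : ⨂[R]^a M →ₗ[R] ⨂[R]^b M →ₗ[R] ⨂[R]^(a' + b') M :=
    TensorProduct.curry (extTensor 𝒜 v (embSum j k) ∘ₗ TensorPower.mulEquiv.toLinearMap)
  let g : ⨂[R]^a M →ₗ[R] ⨂[R]^b M →ₗ[R] ⨂[R]^(a' + b') M :=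
    TensorProduct.curry (TensorPower.mulEquiv.toLinearMap ∘ₗ
      TensorProduct.map (extTensor 𝒜 v j) (extTensor 𝒜 v k))
  suffices h : f = g from LinearMap.congr_fun (LinearMap.congr_fun h t) u
  refine tensorPower_ext 𝒜 fun η x hx => tensorPower_ext 𝒜 fun η' y hy => ?_
  change extTensor 𝒜 v (embSum j k)
      (TensorPower.mulEquiv (PiTensorProduct.tprod R x ⊗ₜ PiTensorProduct.tprod R y)) =
    TensorPower.mulEquiv (extTensor 𝒜 v j (PiTensorProduct.tprod R x) ⊗ₜ
      extTensor 𝒜 v k (PiTensorProduct.tprod R y))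
  rw [mulEquiv_tprod, extTensor_tprod_of_pure 𝒜 hv _ (isPure_append 𝒜 hx hy),
    extTensor_tprod_of_pure 𝒜 hv j hx, extTensor_tprod_of_pure 𝒜 hv k hy,
    ← TensorProduct.smul_tmul', TensorProduct.tmul_smul, map_smul, map_smul, mulEquiv_tprod,
    smul_smul, embSign_embSum, Int.cast_mul]
  congr 2
  funext i
  obtain ⟨i, rfl⟩ | ⟨i, rfl⟩ := fin_add_cases i
  · rw [Fin.append_left]
    by_cases hi : ∃ l, j l = i
    · obtain ⟨l, rfl⟩ := hi
      rw [j.injective.extend_apply, ← embSum_castAdd j k, (embSum j k).injective.extend_apply,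
        Fin.append_left]
    · rw [Function.extend_apply' _ _ _ hi, Function.extend_apply']
      rintro ⟨l, hl⟩
      obtain ⟨l, rfl⟩ | ⟨l, rfl⟩ := fin_add_cases l
      · rw [embSum_castAdd] at hl
        exact hi ⟨l, by simpa using hl⟩
      · rw [embSum_natAdd] at hl
        have := congrArg Fin.val hl
        simp at this
        omega
  · rw [Fin.append_right]
    by_cases hi : ∃ l, k l = i
    · obtain ⟨l, rfl⟩ := hi
      rw [k.injective.extend_apply, ← embSum_natAdd j k, (embSum j k).injective.extend_apply,
        Fin.append_right]
    · rw [Function.extend_apply' _ _ _ hi, Function.extend_apply']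
      rintro ⟨l, hl⟩
      obtain ⟨l, rfl⟩ | ⟨l, rfl⟩ := fin_add_cases l
      · rw [embSum_castAdd] at hl
        have := congrArg Fin.val hl
        simp at this
        omega
      · rw [embSum_natAdd] at hl
        exact hi ⟨l, by simpa using hl⟩

/-- A shift preserves order and carries no sign. This is the shape in which the powers of `v` stand
in a shuffle product with the exponential on the left. -/
theorem extTensor_natAdd {v : M} (hv : v ∈ 𝒜 0) {m : ℕ} (n : ℕ) (t : ⨂[R]^m M) :
    extTensor 𝒜 v (Fin.natAddEmb n) t =
      TensorPower.mulEquiv (PiTensorProduct.tprod R (fun _ : Fin n => v) ⊗ₜ[R] t) := by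
  let g : ⨂[R]^m M →ₗ[R] ⨂[R]^(n + m) M := TensorPower.mulEquiv.toLinearMap ∘ₗ
    TensorProduct.mk R _ _ (PiTensorProduct.tprod R (fun _ : Fin n => v))
  suffices h : extTensor 𝒜 v (Fin.natAddEmb n) = g from LinearMap.congr_fun h t
  refine tensorPower_ext 𝒜 fun η x hx => ?_
  change _ = TensorPower.mulEquiv
    (PiTensorProduct.tprod R (fun _ : Fin n => v) ⊗ₜ PiTensorProduct.tprod R x)
  rw [mulEquiv_tprod, extTensor_tprod_of_pure 𝒜 hv _ hx]
  have h3 : embSign (Fin.natAddEmb (m := m) n) η = 1 := by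
    refine Finset.prod_eq_one fun i _ => Finset.prod_eq_one fun k _ => if_neg ?_
    rintro ⟨h1, h2, -⟩
    have := Fin.lt_def.mp h2
    simp at this
    exact absurd (h1.trans this) (lt_irrefl _)
  rw [h3, Int.cast_one, one_smul]
  congr 1
  funext i
  obtain ⟨i, rfl⟩ | ⟨i, rfl⟩ := fin_add_cases i
  · rw [Fin.append_left, Function.extend_apply']
    rintro ⟨l, hl⟩
    have := congrArg Fin.val hl
    simp at this
    omega
  · rw [Fin.append_right]
    exact (Fin.natAddEmb n).injective.extend_apply _ _ i

theorem extTensor_toEmbedding {m n : ℕ} (e : Fin m ≃ Fin n) (t : ⨂[R]^m M) :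
    extTensor 𝒜 (0 : M) e.toEmbedding t = signedReindex 𝒜 e t := by
  congr 1
  refine tensorPower_ext 𝒜 fun η x hx => ?_
  rw [extTensor_tprod_of_pure 𝒜 (zero_mem _) _ hx, signedReindex_tprod_of_pure 𝒜 e hx]
  congr 2
  funext i
  obtain ⟨i, rfl⟩ := e.surjective i
  rw [Equiv.symm_apply_apply]
  exact e.injective.extend_apply _ _ i

/-- An injection that is not onto leaves a slot to be filled with `0`. For this reason spreading by
`0` reduces to a sum over bijections. -/
theorem extTensor_zero_of_lt {m n : ℕ} (h : m < n) (j : Fin m ↪ Fin n) (t : ⨂[R]^m M) :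
    extTensor 𝒜 (0 : M) j t = 0 := by
  suffices hs : extTensor 𝒜 (0 : M) j = (0 : ⨂[R]^m M →ₗ[R] ⨂[R]^n M) by
    rw [hs, LinearMap.zero_apply]
  refine tensorPower_ext 𝒜 fun η x hx => ?_
  rw [extTensor_tprod_of_pure 𝒜 (zero_mem _) _ hx, LinearMap.zero_apply]
  obtain ⟨i, hi⟩ : ∃ i, i ∉ Set.range j := by
    by_contra! hc
    have := Fintype.card_le_of_surjective j hc
    simp at this
    omega
  rw [(PiTensorProduct.tprod R).map_coord_zero i, smul_zero]
  exact Function.extend_apply' _ _ _ hi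

theorem extTensor_elim0 {v : M} (hv : v ∈ 𝒜 0) {n : ℕ} (j : Fin 0 ↪ Fin n) (x : Fin 0 → M) :
    extTensor 𝒜 v j (PiTensorProduct.tprod R x) = PiTensorProduct.tprod R fun _ => v := by
  rw [extTensor_tprod_of_pure 𝒜 hv j (η := Fin.elim0) fun i => i.elim0]
  have : embSign j Fin.elim0 = 1 := by simp [embSign]
  rw [this, Int.cast_one, one_smul]
  congr 1
  funext i
  exact Function.extend_apply' _ _ _ (by rintro ⟨k, -⟩; exact k.elim0)

theorem map_signInv_extTensor {v : M} (hv : v ∈ 𝒜 0) {m n : ℕ} (j : Fin m ↪ Fin n) (t : ⨂[R]^m M) :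
    PiTensorProduct.map (fun _ => signInv 𝒜) (extTensor 𝒜 v j t) =
      extTensor 𝒜 v j (PiTensorProduct.map (fun _ => signInv 𝒜) t) := by
  have hv' : signInv 𝒜 v = v := by
    simpa using signInv_of_pure 𝒜 (parityPart_false_of_mem 𝒜 hv)
  simp only [extTensor, LinearMap.comp_apply, LinearMap.flip_apply, TensorProduct.mk_apply,
    LinearEquiv.coe_coe]
  rw [map_signInv_signedReindex]
  congr 1
  induction t using PiTensorProduct.induction_on with
  | add a b ha hb => simp only [map_add, TensorProduct.add_tmul, ha, hb]
  | smul_tprod r x =>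
    simp only [map_smul, ← TensorProduct.smul_tmul', mulEquiv_tprod, PiTensorProduct.map_tprod]
    congr 2
    funext i
    obtain ⟨i, rfl⟩ | ⟨i, rfl⟩ := fin_add_cases i <;> simp [hv']

end Tensor

/-! ### Spreading words over all larger arities -/

section Spread

variable {R : Type u} [CommRing R] (C : HopfCooperad.{u, w} R)

namespace HopfCooperad

theorem ext_deg {m n : ℕ} (j : Fin m ↪ Fin n) (i : ℤ) {x : C.obj m} (hx : x ∈ C.deg m i) :
    C.ext j x ∈ C.deg n i :=
  C.map_deg _ _ _ (C.addInputs_deg m i hx _)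

theorem parityPart_ext {m n : ℕ} (j : Fin m ↪ Fin n) (b : Bool) (x : C.obj m) :
    C.ext j (parityPart (C.deg m) b x) = parityPart (C.deg n) b (C.ext j x) :=
  map_scaleByDegree (C.deg m) (C.deg n) _ (C.ext j) (fun i _ hx => C.ext_deg j i hx) x

end HopfCooperad

variable (V : CompleteGradedModule.{u, v} R)

/-- The action of an embedding on operations decorated by elements of `V`: the new inputs of the
operation are dual to the unitary operation, and they are decorated by `v`. -/
def extCell (p : ℕ) (v : V.carrier) {m n : ℕ} (j : Fin m ↪ Fin n) :
    Cell C V p m →ₗ[R] Cell C V p n :=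
  TensorProduct.map (C.ext (embSum j (Function.Embedding.refl (Fin p)))) (extTensor V.deg v j)

variable {v : V.carrier}

theorem extCell_act (hv : v ∈ V.deg 0) (p : ℕ) {l m n : ℕ} (e : Fin l ≃ Fin m) (j : Fin m ↪ Fin n)
    (z : Cell C V p l) :
    extCell C V p v j (act C V p e z) = extCell C V p v (e.toEmbedding.trans j) z := by
  rw [extCell, extCell, act, ← LinearMap.comp_apply, ← TensorProduct.map_comp]
  congr 2
  · ext c
    rw [LinearMap.comp_apply, AlgHom.toLinearMap_apply, C.ext_map, ← embSum_toEmbedding,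
      embSum_trans]
    rfl
  · exact LinearMap.ext fun t => extTensor_comp_signedReindex V.deg hv e j t

theorem extCell_refl (hv : v ∈ V.deg 0) (p : ℕ) {n : ℕ} (z : Cell C V p n) :
    extCell C V p v (Function.Embedding.refl (Fin n)) z = z := by
  have h1 : C.ext (embSum (Function.Embedding.refl (Fin n)) (Function.Embedding.refl (Fin p))) =
      LinearMap.id := by
    rw [embSum_refl]
    exact LinearMap.ext C.ext_refl
  have h2 : extTensor V.deg v (Function.Embedding.refl (Fin n)) = LinearMap.id := by
    refine tensorPower_ext V.deg fun η y hy => ?_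
    rw [extTensor_tprod_of_pure V.deg hv _ hy]
    have h3 : embSign (Function.Embedding.refl (Fin n)) η = 1 :=
      Finset.prod_eq_one fun i _ => Finset.prod_eq_one fun j _ => if_neg fun h =>
        absurd (h.1.trans h.2.1) (lt_irrefl _)
    rw [h3, Int.cast_one, one_smul, LinearMap.id_apply]
    congr 1
    funext i
    exact (Function.Embedding.refl (Fin n)).injective.extend_apply _ _ i
  rw [extCell, h1, h2, TensorProduct.map_id, LinearMap.id_apply]

/-- The sum over all embeddings of the inputs into `n` inputs. -/
def spread (p : ℕ) (v : V.carrier) (n : ℕ) : Words C V p →ₗ[R] Words C V p :=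
  DirectSum.toModule R ℕ _ fun m => ∑ j : Fin m ↪ Fin n,
    DirectSum.lof R ℕ (Cell C V p) n ∘ₗ extCell C V p v j

theorem spread_lof (p : ℕ) (v : V.carrier) (m n : ℕ) (z : Cell C V p m) :
    spread C V p v n (DirectSum.lof R ℕ (Cell C V p) m z) =
      ∑ j : Fin m ↪ Fin n, DirectSum.lof R ℕ (Cell C V p) n (extCell C V p v j z) := by
  simp [spread, DirectSum.toModule_lof]

theorem spread_lof_of_lt (p : ℕ) (v : V.carrier) {m n : ℕ} (h : n < m) (z : Cell C V p m) :
    spread C V p v n (DirectSum.lof R ℕ (Cell C V p) m z) = 0 := by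
  rw [spread_lof, embedding_eq_zero_of_lt h]

theorem spread_zero_lof_of_ne (p : ℕ) {m n : ℕ} (h : m ≠ n) (z : Cell C V p m) :
    spread C V p 0 n (DirectSum.lof R ℕ (Cell C V p) m z) = 0 := by
  rcases lt_or_gt_of_ne h with h | h
  · rw [spread_lof]
    refine Finset.sum_eq_zero fun j _ => ?_
    have : extCell C V p 0 j = 0 := by
      rw [extCell, show extTensor V.deg 0 j = 0 from
        LinearMap.ext fun t => extTensor_zero_of_lt V.deg h j t, TensorProduct.map_zero_right]
    rw [this, LinearMap.zero_apply, map_zero]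
  · exact spread_lof_of_lt C V p 0 h z

/-- Injections between sets of equal finite size are bijections, so spreading by `0` is the norm
map. -/
theorem spread_zero_lof_self (p n : ℕ) (z : Cell C V p n) :
    spread C V p 0 n (DirectSum.lof R ℕ (Cell C V p) n z) =
      ∑ σ : Equiv.Perm (Fin n), DirectSum.lof R ℕ (Cell C V p) n (act C V p σ z) := by
  rw [spread_lof]
  refine (Fintype.sum_bijective (fun σ : Equiv.Perm (Fin n) => σ.toEmbedding)
    ⟨fun σ τ h => Equiv.ext fun i => DFunLike.congr_fun h i, fun j =>
      ⟨Equiv.ofBijective j (Finite.injective_iff_bijective.mp j.injective), rfl⟩⟩ _ _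
    fun σ => ?_).symm
  congr 1
  rw [extCell, act]
  congr 2
  · ext c
    have := C.ext_toEmbedding (finSum σ (Equiv.refl (Fin p))) c
    rw [← embSum_toEmbedding] at this
    exact this.symm
  · exact LinearMap.ext fun t => (extTensor_toEmbedding V.deg σ t).symm

/-- Precomposing with a permutation only permutes the injections, so spreading by any even `v`
factors through coinvariants. -/
theorem spread_act (hv : v ∈ V.deg 0) (p n : ℕ) {m : ℕ} (σ : Equiv.Perm (Fin m))
    (z : Cell C V p m) :
    spread C V p v n (DirectSum.lof R ℕ (Cell C V p) m (act C V p σ z)) =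
      spread C V p v n (DirectSum.lof R ℕ (Cell C V p) m z) := by
  rw [spread_lof, spread_lof]
  refine Fintype.sum_equiv (Equiv.embeddingCongr σ.symm (Equiv.refl (Fin n))) _ _ fun j => ?_
  rw [extCell_act C V hv]
  rfl

theorem distribute_map {a a' b b' k k' l l' : ℕ} (f : C.obj k →ₗ[R] C.obj k')
    (g : C.obj l →ₗ[R] C.obj l')
    (hg : ∀ b x, g (parityPart (C.deg l) b x) = parityPart (C.deg l') b (g x))
    (s : ⨂[R]^a V.carrier →ₗ[R] ⨂[R]^a' V.carrier) (t : ⨂[R]^b V.carrier →ₗ[R] ⨂[R]^b' V.carrier)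
    (hs : ∀ x, PiTensorProduct.map (fun _ => signInv V.deg) (s x) =
      s (PiTensorProduct.map (fun _ => signInv V.deg) x))
    (y : C.obj k ⊗[R] C.obj l) (x : (⨂[R]^a V.carrier) ⊗[R] (⨂[R]^b V.carrier)) :
    distribute C V k' l' a' b' (TensorProduct.map f g y ⊗ₜ TensorProduct.map s t x) =
      TensorProduct.map (TensorProduct.map f s) (TensorProduct.map g t)
        (distribute C V k l a b (y ⊗ₜ x)) := by
  induction y using TensorProduct.induction_on with
  | zero => simp
  | add y y' hy hy' => simp only [map_add, TensorProduct.add_tmul, hy, hy']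
  | tmul c c' =>
    induction x using TensorProduct.induction_on with
    | zero => simp
    | add y y' hy hy' => simp only [map_add, TensorProduct.tmul_add, hy, hy']
    | tmul x x' =>
      simp [distribute, hg, hs]

/-- The decomposition of an operation into an operation on the last `B` decorated inputs and an
operation on the remaining ones. -/
def deconcatCell (p A B : ℕ) : Cell C V p (A + B) →ₗ[R] Cell C V (p + 1) A ⊗[R] Cell C V 0 B :=
  distribute C V (A + (p + 1)) B A B ∘ₗ
    TensorProduct.map (C.partialDecomp (A + p) B ∘ₗ (C.map (finSwap A B p)).toLinearMap)
      (TensorPower.mulEquiv (n := A) (m := B)).symm.toLinearMap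

theorem peel_lof (p m : ℕ) (z : Cell C V p m) :
    peel C V p (DirectSum.lof R ℕ (Cell C V p) m z) = ∑ s : Finset (Fin m),
      TensorProduct.map (DirectSum.lof R ℕ (Cell C V (p + 1)) s.card)
        (DirectSum.lof R ℕ (Cell C V 0) sᶜ.card)
        (deconcatCell C V p s.card sᶜ.card (act C V p (splitEquiv s) z)) := by
  simp only [peel, DirectSum.toModule_lof, LinearMap.sum_apply, LinearMap.comp_apply, deconcatCell]

theorem embSum_finSwap {a a' b b' : ℕ} (j : Fin a ↪ Fin a') (k : Fin b ↪ Fin b') (p : ℕ) :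
    (embSum (embSum j k) (Function.Embedding.refl (Fin p))).trans (finSwap a' b' p).toEmbedding =
      (finSwap a b p).toEmbedding.trans
        (embSum (embSum j (Function.Embedding.refl (Fin p))) k) := by
  ext i
  rw [Function.Embedding.trans_apply, Function.Embedding.trans_apply, Equiv.toEmbedding_apply,
    Equiv.toEmbedding_apply, finSwap_val]
  obtain ⟨i, rfl⟩ | ⟨i, rfl⟩ := fin_add_cases i
  · obtain ⟨i, rfl⟩ | ⟨i, rfl⟩ := fin_add_cases i
    · have h : finSwap a b p (Fin.castAdd p (Fin.castAdd b i)) =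
          Fin.castAdd b (Fin.castAdd p i) := by
        ext
        rw [finSwap_val]
        simp
      rw [h]
      simp [embSum_castAdd]
    · have h : finSwap a b p (Fin.castAdd p (Fin.natAdd a i)) =
          Fin.natAdd (a + p) i := by
        ext
        rw [finSwap_val]
        simp
        omega
      rw [h]
      simp [embSum_castAdd, embSum_natAdd]
      omega
  · have h : finSwap a b p (Fin.natAdd (a + b) i) = Fin.castAdd b (Fin.natAdd a i) := by
      ext
      rw [finSwap_val]
      simp
      split_ifs <;> omega
    rw [h]
    simp [embSum_castAdd, embSum_natAdd]
    split_ifs <;> omega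

/-- Compatibility with block sums holds on operations by `partialDecomp_ext` and on tensors by
`extTensor_embSum`. The marked inputs follow along through identity embeddings, and the evenness of
`v` keeps the interchange sign unchanged. -/
theorem deconcatCell_extCell (hv : v ∈ V.deg 0) (p : ℕ) {a a' b b' : ℕ} (j : Fin a ↪ Fin a')
    (k : Fin b ↪ Fin b') (z : Cell C V p (a + b)) :
    deconcatCell C V p a' b' (extCell C V p v (embSum j k) z) =
      TensorProduct.map (extCell C V (p + 1) v j) (extCell C V 0 v k)
        (deconcatCell C V p a b z) := by
  induction z using TensorProduct.induction_on with
  | zero => simp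
  | add a b ha hb => simp only [map_add, ha, hb]
  | tmul c t =>
    obtain ⟨t, rfl⟩ := TensorPower.mulEquiv.surjective t
    have h1 : TensorPower.mulEquiv.symm (extTensor V.deg v (embSum j k) (TensorPower.mulEquiv t)) =
        TensorProduct.map (extTensor V.deg v j) (extTensor V.deg v k) t := by
      rw [LinearEquiv.symm_apply_eq]
      induction t using TensorProduct.induction_on with
      | zero => simp
      | add a b ha hb => simp only [map_add, ha, hb]
      | tmul x y => exact extTensor_embSum V.deg hv j k x y
    simp only [deconcatCell, extCell, LinearMap.comp_apply, TensorProduct.map_tmul,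
      LinearEquiv.coe_coe, h1, LinearEquiv.symm_apply_apply, AlgHom.toLinearMap_apply]
    rw [C.map_ext, embSum_finSwap, ← C.ext_map, C.partialDecomp_ext]
    have h2 : embSum (embSum j (Function.Embedding.refl (Fin p)))
        (Function.Embedding.refl (Fin 1)) =
        embSum j (Function.Embedding.refl (Fin (p + 1))) := by
      ext i
      refine (embSum_val _ _ i).trans (Eq.trans ?_ (embSum_val (a := a) (b := p + 1) _ _ i).symm)
      have := i.isLt
      simp only [embSum_val, Function.Embedding.refl_apply]
      split_ifs <;> omega
    have h3 : embSum k (Function.Embedding.refl (Fin 0)) = k := by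
      ext i
      exact (embSum_val _ _ i).trans (dif_pos (show (i : ℕ) < b from i.isLt))
    refine (distribute_map C V _ _ (C.parityPart_ext k) _ _
      (map_signInv_extTensor V.deg hv j) _ _).trans ?_
    rw [h2, h3]
    rfl

/-- The deconcatenation of words of length `A + B`. -/
def deconcat (p A B : ℕ) : Words C V p →ₗ[R] Words C V (p + 1) ⊗[R] Words C V 0 :=
  TensorProduct.map (DirectSum.lof R ℕ (Cell C V (p + 1)) A)
      (DirectSum.lof R ℕ (Cell C V 0) B) ∘ₗ deconcatCell C V p A B ∘ₗ
    DirectSum.component R ℕ (Cell C V p) (A + B)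

/-- The subset summed over in `peel` and the injections of its two parts amount to one injection
into `A + B` letters (`embSplit_bijective`). On the left a single decomposition at a fixed place
replaces the sum over all subsets. -/
theorem deconcat_spread (hv : v ∈ V.deg 0) (p A B : ℕ) (x : Words C V p) :
    deconcat C V p A B (spread C V p v (A + B) x) =
      TensorProduct.map (spread C V (p + 1) v A) (spread C V 0 v B) (peel C V p x) := by
  induction x using DirectSum.induction_on with
  | zero => simp
  | add a b ha hb => simp only [map_add, ha, hb]
  | of m z =>
    change deconcat C V p A B (spread C V p v (A + B) (DirectSum.lof R ℕ (Cell C V p) m z)) =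
      TensorProduct.map (spread C V (p + 1) v A) (spread C V 0 v B)
        (peel C V p (DirectSum.lof R ℕ (Cell C V p) m z))
    have hd : ∀ y, deconcat C V p A B (DirectSum.lof R ℕ (Cell C V p) (A + B) y) =
        TensorProduct.map (DirectSum.lof R ℕ (Cell C V (p + 1)) A)
          (DirectSum.lof R ℕ (Cell C V 0) B) (deconcatCell C V p A B y) := by
      intro y
      simp only [deconcat, LinearMap.comp_apply, DirectSum.component.lof_self]
    have hs : ∀ s t (y : Cell C V (p + 1) s ⊗[R] Cell C V 0 t),
        TensorProduct.map (spread C V (p + 1) v A) (spread C V 0 v B)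
          (TensorProduct.map (DirectSum.lof R ℕ (Cell C V (p + 1)) s)
            (DirectSum.lof R ℕ (Cell C V 0) t) y) =
        ∑ j : Fin s ↪ Fin A, ∑ k : Fin t ↪ Fin B,
          TensorProduct.map (DirectSum.lof R ℕ (Cell C V (p + 1)) A)
            (DirectSum.lof R ℕ (Cell C V 0) B)
            (TensorProduct.map (extCell C V (p + 1) v j) (extCell C V 0 v k) y) := by
      intro s t y
      induction y using TensorProduct.induction_on with
      | zero => simp
      | add a b ha hb => simp only [map_add, ha, hb, Finset.sum_add_distrib]
      | tmul x y =>
        simp only [TensorProduct.map_tmul, spread_lof, TensorProduct.sum_tmul,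
          TensorProduct.tmul_sum]
        exact Finset.sum_comm
    rw [spread_lof, map_sum, peel_lof, map_sum]
    simp_rw [hd, hs, ← deconcatCell_extCell C V hv, extCell_act C V hv]
    simp_rw [← Fintype.sum_prod_type']
    rw [← Fintype.sum_sigma']
    exact (Fintype.sum_bijective (embSplit A B) (embSplit_bijective A B) _ _ fun _ => rfl).symm

end Spread

/-! ### Iterated decompositions -/

section Cons

variable {R : Type u} [CommRing R]

theorem consTensor_tprod {W : Type v} [AddCommGroup W] [Module R W] (k : ℕ) (x : W)
    (y : Fin k → W) :
    consTensor W k (x ⊗ₜ[R] PiTensorProduct.tprod R y) =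
      PiTensorProduct.tprod R (Fin.cons x y : Fin (k + 1) → W) := by
  simp [consTensor]

theorem map_consTensor {W : Type v} [AddCommGroup W] [Module R W] {X : Type w} [AddCommGroup X]
    [Module R X] (k : ℕ) (f : Fin (k + 1) → W →ₗ[R] X) (x : W) (u : ⨂[R]^k W) :
    PiTensorProduct.map f (consTensor W k (x ⊗ₜ[R] u)) =
      consTensor X k (f 0 x ⊗ₜ[R] PiTensorProduct.map (fun i => f i.succ) u) := by
  induction u using PiTensorProduct.induction_on with
  | add a b ha hb => simp only [map_add, TensorProduct.tmul_add, ha, hb]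
  | smul_tprod r y =>
    simp only [TensorProduct.tmul_smul, map_smul, consTensor_tprod, PiTensorProduct.map_tprod]
    congr 2
    funext i
    refine Fin.cases ?_ (fun i => ?_) i <;> simp

/-- The inverse of `consTensor`. -/
def unconsTensor (W : Type v) [AddCommGroup W] [Module R W] (k : ℕ) :
    ⨂[R]^(k + 1) W →ₗ[R] W ⊗[R] (⨂[R]^k W) :=
  PiTensorProduct.lift
    { toFun := fun x => x 0 ⊗ₜ PiTensorProduct.tprod R (Fin.tail x)
      map_update_add' := fun {inst} x i y z => by
        obtain rfl : inst = instDecidableEqFin _ := Subsingleton.elim _ _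
        refine Fin.cases ?_ (fun i => ?_) i
        · simp [Fin.tail_update_zero, TensorProduct.add_tmul]
        · have h0 : ∀ y, Function.update x i.succ y 0 = x 0 := fun y =>
            Function.update_of_ne (Fin.succ_ne_zero i).symm y x
          simp [Fin.tail_update_succ, TensorProduct.tmul_add, h0]
      map_update_smul' := fun {inst} x i r y => by
        obtain rfl : inst = instDecidableEqFin _ := Subsingleton.elim _ _
        refine Fin.cases ?_ (fun i => ?_) i
        · simp [Fin.tail_update_zero, TensorProduct.smul_tmul]
        · have h0 : ∀ y, Function.update x i.succ y 0 = x 0 := fun y =>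
            Function.update_of_ne (Fin.succ_ne_zero i).symm y x
          simp [Fin.tail_update_succ, h0] }

theorem unconsTensor_tprod {W : Type v} [AddCommGroup W] [Module R W] (k : ℕ)
    (x : Fin (k + 1) → W) :
    unconsTensor W k (PiTensorProduct.tprod R x) =
      x 0 ⊗ₜ PiTensorProduct.tprod R (Fin.tail x) := by
  simp [unconsTensor]

theorem unconsTensor_consTensor {W : Type v} [AddCommGroup W] [Module R W] (k : ℕ) (x : W)
    (u : ⨂[R]^k W) : unconsTensor W k (consTensor W k (x ⊗ₜ[R] u)) = x ⊗ₜ u := by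
  induction u using PiTensorProduct.induction_on with
  | add a b ha hb => simp only [map_add, TensorProduct.tmul_add, ha, hb]
  | smul_tprod r y =>
    simp [TensorProduct.tmul_smul, map_smul, consTensor_tprod, unconsTensor_tprod]

end Cons

section IterPeel

variable {R : Type u} [CommRing R] (C : HopfCooperad.{u, w} R) (V : CompleteGradedModule.{u, v} R)

theorem iterPeel_succ (k : ℕ) (x : Words C V 0) :
    iterPeel C V (k + 1) x = TensorProduct.map LinearMap.id (consTensor (Words C V 0) k)
      (TensorProduct.assoc R _ _ _
        (TensorProduct.map (peel C V k) LinearMap.id (iterPeel C V k x))) := rfl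

/-- Spreading the factors of an iterated decomposition only depends on the spread word, by a
formula that does not involve the decoration of the new inputs. -/
theorem exists_iterPeel_spread (k : ℕ) : ∀ (n : Fin k → ℕ) (A : ℕ),
    ∃ E : Words C V 0 →ₗ[R] Words C V k ⊗[R] (⨂[R]^k (Words C V 0)), ∀ v ∈ V.deg 0, ∀ x,
      TensorProduct.map (spread C V k v A) (PiTensorProduct.map fun i => spread C V 0 v (n i))
        (iterPeel C V k x) = E (spread C V 0 v (A + ∑ i, n i) x) := by
  induction k with
  | zero =>
    intro n A
    refine ⟨(TensorProduct.mk R _ _).flip (PiTensorProduct.tprod R Fin.elim0), fun v _ x => ?_⟩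
    simp only [iterPeel, LinearMap.flip_apply, TensorProduct.mk_apply, TensorProduct.map_tmul,
      PiTensorProduct.map_tprod, Finset.univ_eq_empty, Finset.sum_empty, add_zero]
    congr 2
    exact Subsingleton.elim _ _
  | succ k ih =>
    intro n A
    -- The factor split off last has index `0`. Before that step its `n 0` inputs still belong to
    -- the root, which therefore has `A + n 0` decorated inputs.
    obtain ⟨E, hE⟩ := ih (fun i => n i.succ) (A + n 0)
    refine ⟨TensorProduct.map LinearMap.id (consTensor (Words C V 0) k) ∘ₗ
      (TensorProduct.assoc R _ _ _).toLinearMap ∘ₗ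
      TensorProduct.map (deconcat C V k A (n 0)) LinearMap.id ∘ₗ E, fun v hv x => ?_⟩
    have key : ∀ z : Words C V k ⊗[R] (⨂[R]^k (Words C V 0)),
        TensorProduct.map (spread C V (k + 1) v A)
          (PiTensorProduct.map fun i => spread C V 0 v (n i))
          (TensorProduct.map LinearMap.id (consTensor (Words C V 0) k)
            (TensorProduct.assoc R _ _ _ (TensorProduct.map (peel C V k) LinearMap.id z))) =
        TensorProduct.map LinearMap.id (consTensor (Words C V 0) k)
          (TensorProduct.assoc R _ _ _ (TensorProduct.map (deconcat C V k A (n 0)) LinearMap.id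
            (TensorProduct.map (spread C V k v (A + n 0))
              (PiTensorProduct.map fun i => spread C V 0 v (n i.succ)) z))) := by
      intro z
      induction z using TensorProduct.induction_on with
      | zero => simp
      | add a b ha hb => simp only [map_add, ha, hb]
      | tmul y u =>
        simp only [TensorProduct.map_tmul, LinearMap.id_apply, deconcat_spread C V hv]
        generalize peel C V k y = q
        induction q using TensorProduct.induction_on with
        | zero => simp
        | add a b ha hb => simp only [map_add, TensorProduct.add_tmul, ha, hb]
        | tmul a b =>
          simp only [TensorProduct.map_tmul, TensorProduct.assoc_tmul, LinearMap.id_apply,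
            map_consTensor]
    rw [iterPeel_succ, key, hE v hv, Fin.sum_univ_succ, ← add_assoc]
    rfl

/-- Only the empty set injects into the empty set, and `rootPart` also keeps only operations without
decorated inputs. -/
theorem rootPart_spread_zero (k : ℕ) {v : V.carrier} (hv : v ∈ V.deg 0) (x : Words C V k) :
    rootPart C V k (spread C V k v 0 x) = rootPart C V k x := by
  induction x using DirectSum.induction_on with
  | zero => simp
  | add a b ha hb => simp only [map_add, ha, hb]
  | of m z =>
    change rootPart C V k (spread C V k v 0 (DirectSum.lof R ℕ (Cell C V k) m z)) =
      rootPart C V k (DirectSum.lof R ℕ (Cell C V k) m z)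
    cases m with
    | zero =>
      rw [spread_lof, Fintype.sum_unique, show (default : Fin 0 ↪ Fin 0) =
        Function.Embedding.refl _ from Subsingleton.elim _ _, extCell_refl C V hv]
    | succ m =>
      rw [spread_lof_of_lt C V k v (Nat.succ_pos m)]
      simp [rootPart, DirectSum.component.of]

/-- Spreading the factors of the coproduct only depends on the spread word. -/
theorem exists_coproduct_spread (k : ℕ) (n : Fin k → ℕ) :
    ∃ E : Words C V 0 →ₗ[R] C.obj k ⊗[R] (⨂[R]^k (Words C V 0)), ∀ v ∈ V.deg 0, ∀ x,
      TensorProduct.map LinearMap.id (PiTensorProduct.map fun i => spread C V 0 v (n i))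
        (coproduct C V k x) = E (spread C V 0 v (∑ i, n i) x) := by
  -- The root of a coproduct has all its inputs marked, hence `A = 0`.
  obtain ⟨E, hE⟩ := exists_iterPeel_spread C V k n 0
  refine ⟨TensorProduct.map (rootPart C V k) LinearMap.id ∘ₗ E, fun v hv x => ?_⟩
  have h := hE v hv x
  rw [zero_add] at h
  rw [LinearMap.comp_apply, ← h, coproduct, LinearMap.comp_apply]
  generalize iterPeel C V k x = z
  induction z using TensorProduct.induction_on with
  | zero => simp
  | add a b ha hb => simp only [map_add, ha, hb]
  | tmul y u => simp [rootPart_spread_zero C V k hv]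

end IterPeel

/-! ### Compatibility with the filtrations -/

section Filtration

variable {R : Type u} [CommRing R] (C : HopfCooperad.{u, w} R) (V : CompleteGradedModule.{u, v} R)

/-- The filtration induced by that of `V` on operations with `p` marked inputs. -/
def markedFil (p N : ℕ) : Submodule R (Words C V p) :=
  Submodule.span R {y | ∃ (n : ℕ) (c : C.obj (n + p)) (x : Fin n → V.carrier) (w : Fin n → ℕ),
    (∀ i, x i ∈ V.F (w i)) ∧ N ≤ ∑ i, w i ∧
    y = DirectSum.lof R ℕ (Cell C V p) n (c ⊗ₜ PiTensorProduct.tprod R x)}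

theorem markedFil_zero (N : ℕ) : markedFil C V 0 N = wordFil C V N := rfl

theorem parityPart_mem_F {N : ℕ} {x : V.carrier} (b : Bool) (hx : x ∈ V.F N) :
    parityPart V.deg b x ∈ V.F N :=
  scaleByDegree_mem V.deg (V.F_graded N) hx

/-- The filtration of a tensor product of two modules of words. -/
def markedFil₂ (p q N : ℕ) : Submodule R (Words C V p ⊗[R] Words C V q) :=
  Submodule.span R {z | ∃ (a b : ℕ) (y : Words C V p) (x : Words C V q),
    y ∈ markedFil C V p a ∧ x ∈ markedFil C V q b ∧ N ≤ a + b ∧ z = y ⊗ₜ x}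

theorem deconcatCell_mem (p A B N : ℕ) (c : C.obj (A + B + p)) (x : Fin (A + B) → V.carrier)
    (w : Fin (A + B) → ℕ) (hx : ∀ i, x i ∈ V.F (w i)) (hN : N ≤ ∑ i, w i) :
    TensorProduct.map (DirectSum.lof R ℕ (Cell C V (p + 1)) A) (DirectSum.lof R ℕ (Cell C V 0) B)
      (deconcatCell C V p A B (c ⊗ₜ PiTensorProduct.tprod R x)) ∈ markedFil₂ C V (p + 1) 0 N := by
  have hsplit : TensorPower.mulEquiv.symm (PiTensorProduct.tprod R x) =
      (PiTensorProduct.tprod R fun i => x (Fin.castAdd B i)) ⊗ₜ[R]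
        (PiTensorProduct.tprod R fun i => x (Fin.natAdd A i)) := by
    rw [LinearEquiv.symm_apply_eq, mulEquiv_tprod]
    congr 1
    funext i
    obtain ⟨i, rfl⟩ | ⟨i, rfl⟩ := fin_add_cases i <;> simp
  simp only [deconcatCell, LinearMap.comp_apply, TensorProduct.map_tmul, LinearEquiv.coe_coe,
    hsplit]
  generalize C.partialDecomp _ _ _ = z
  induction z using TensorProduct.induction_on with
  | zero => simp
  | add a b ha hb =>
    simp only [map_add, TensorProduct.add_tmul]
    exact add_mem ha hb
  | tmul c c' =>
    simp only [distribute, LinearMap.comp_apply, LinearMap.add_apply, TensorProduct.map_tmul,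
      LinearEquiv.coe_coe, LinearMap.id_apply, PiTensorProduct.map_tprod, map_add,
      TensorProduct.tensorTensorTensorComm_tmul]
    have hsum : N ≤ ∑ i, w (Fin.castAdd B i) + ∑ i, w (Fin.natAdd A i) := by
      rwa [← Fin.sum_univ_add]
    refine add_mem (Submodule.subset_span ⟨_, _, _, _, Submodule.subset_span
        ⟨A, _, _, fun i => w (Fin.castAdd B i), ?_, le_rfl, rfl⟩, Submodule.subset_span
        ⟨B, _, _, fun i => w (Fin.natAdd A i), ?_, le_rfl, rfl⟩, hsum, rfl⟩)
      (Submodule.subset_span ⟨_, _, _, _, Submodule.subset_span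
        ⟨A, _, _, fun i => w (Fin.castAdd B i), ?_, le_rfl, rfl⟩, Submodule.subset_span
        ⟨B, _, _, fun i => w (Fin.natAdd A i), ?_, le_rfl, rfl⟩, hsum, rfl⟩)
    · exact fun i => hx _
    · exact fun i => hx _
    · exact fun i => signInv_mem_F V (hx _)
    · exact fun i => hx _

theorem peel_mem (p N : ℕ) {x : Words C V p} (hx : x ∈ markedFil C V p N) :
    peel C V p x ∈ markedFil₂ C V (p + 1) 0 N := by
  suffices h : markedFil C V p N ≤ (markedFil₂ C V (p + 1) 0 N).comap (peel C V p) from h hx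
  refine Submodule.span_le.mpr ?_
  rintro _ ⟨n, c, x, w, hw, hN, rfl⟩
  change peel C V p _ ∈ markedFil₂ C V (p + 1) 0 N
  rw [peel_lof]
  refine Submodule.sum_mem _ fun s _ => ?_
  simp only [act, TensorProduct.map_tmul, signedReindex_tprod, TensorProduct.tmul_sum, map_sum,
    TensorProduct.tmul_smul, map_smul]
  refine Submodule.sum_mem _ fun ε _ => Submodule.smul_mem _ _ ?_
  refine deconcatCell_mem C V p _ _ N _ _ (fun i => w ((splitEquiv s).symm i)) ?_ ?_
  · exact fun i => parityPart_mem_F V _ (hw _)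
  · rw [Equiv.sum_comp (splitEquiv s).symm w]
    exact hN

/-- The filtration of `u𝒞(k) ⊗ D^{⊗k}` before completion. -/
def rootFil (k N : ℕ) : Submodule R (C.obj k ⊗[R] (⨂[R]^k (Words C V 0))) :=
  Submodule.span R {y | ∃ (c : C.obj k) (x : Fin k → Words C V 0) (w : Fin k → ℕ),
    (∀ i, x i ∈ wordFil C V (w i)) ∧ N ≤ ∑ i, w i ∧ y = c ⊗ₜ PiTensorProduct.tprod R x}

/-- The filtration of the target of the iterated decomposition. -/
def peelFil (k N : ℕ) : Submodule R (Words C V k ⊗[R] (⨂[R]^k (Words C V 0))) :=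
  Submodule.span R {z | ∃ (a : ℕ) (y : Words C V k) (x : Fin k → Words C V 0) (w : Fin k → ℕ),
    y ∈ markedFil C V k a ∧ (∀ i, x i ∈ wordFil C V (w i)) ∧ N ≤ a + ∑ i, w i ∧
    z = y ⊗ₜ PiTensorProduct.tprod R x}

theorem iterPeel_mem (k N : ℕ) {x : Words C V 0} (hx : x ∈ wordFil C V N) :
    iterPeel C V k x ∈ peelFil C V k N := by
  induction k with
  | zero =>
    exact Submodule.subset_span ⟨N, x, Fin.elim0, Fin.elim0, hx, fun i => i.elim0, by simp, rfl⟩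
  | succ k ih =>
    rw [iterPeel_succ]
    suffices h : ∀ z ∈ peelFil C V k N, TensorProduct.map LinearMap.id
        (consTensor (Words C V 0) k) (TensorProduct.assoc R _ _ _
          (TensorProduct.map (peel C V k) LinearMap.id z)) ∈ peelFil C V (k + 1) N from h _ ih
    intro z hz
    induction hz using Submodule.span_induction with
    | zero => simp
    | add a b _ _ ha hb => simpa only [map_add] using add_mem ha hb
    | smul r a _ ha => simpa only [map_smul] using Submodule.smul_mem _ r ha
    | mem z hz =>
      obtain ⟨a, y, x, w, hy, hx, hN, rfl⟩ := hz
      have h := peel_mem C V k a hy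
      rw [TensorProduct.map_tmul, LinearMap.id_apply]
      generalize peel C V k y = q at h
      induction h using Submodule.span_induction with
      | zero => simp
      | add a b _ _ ha hb => simpa only [map_add, TensorProduct.add_tmul] using add_mem ha hb
      | smul r a _ ha =>
        simpa only [map_smul, ← TensorProduct.smul_tmul'] using Submodule.smul_mem _ r ha
      | mem q hq =>
        obtain ⟨b, b', y', x', hy', hx', hb, rfl⟩ := hq
        rw [TensorProduct.assoc_tmul, TensorProduct.map_tmul, consTensor_tprod]
        refine Submodule.subset_span ⟨b, y', _, Fin.cons b' w, hy', fun i => ?_, ?_, rfl⟩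
        · refine Fin.cases ?_ (fun i => ?_) i
          · exact hx'
          · simpa using hx i
        · rw [Fin.sum_univ_succ]
          simp only [Fin.cons_zero, Fin.cons_succ]
          omega

/-- The operations kept by `rootPart` have no decorated inputs and so no weight. In a coproduct all
the weight thus sits in the factors that were split off. -/
theorem rootPart_eq_zero {k N : ℕ} (hN : 0 < N) {x : Words C V k} (hx : x ∈ markedFil C V k N) :
    rootPart C V k x = 0 := by
  suffices h : markedFil C V k N ≤ LinearMap.ker (rootPart C V k) from h hx
  refine Submodule.span_le.mpr ?_
  rintro _ ⟨n, c, x, w, hw, hN', rfl⟩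
  change rootPart C V k _ = 0
  cases n with
  | zero =>
    simp at hN'
    omega
  | succ n => simp [rootPart, DirectSum.component.of]

theorem coproduct_mem (k N : ℕ) {x : Words C V 0} (hx : x ∈ wordFil C V N) :
    coproduct C V k x ∈ rootFil C V k N := by
  have h := iterPeel_mem C V k N hx
  rw [coproduct, LinearMap.comp_apply]
  suffices hs : peelFil C V k N ≤
      (rootFil C V k N).comap (TensorProduct.map (rootPart C V k) LinearMap.id) from hs h
  refine Submodule.span_le.mpr ?_
  rintro _ ⟨a, y, x, w, hy, hx, hN, rfl⟩
  change TensorProduct.map (rootPart C V k) LinearMap.id _ ∈ rootFil C V k N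
  rw [TensorProduct.map_tmul]
  rcases Nat.eq_zero_or_pos a with rfl | ha
  · exact Submodule.subset_span ⟨_, _, w, hx, by simpa using hN, rfl⟩
  · rw [rootPart_eq_zero C V ha hy, TensorProduct.zero_tmul]
    exact zero_mem _

end Filtration

/-! ### Recovering words from the cogenerators -/

section Tangent

variable {R : Type u} [CommRing R] (C : HopfCooperad.{u, w} R) (V : CompleteGradedModule.{u, v} R)

/-- The coefficient of the unitary operation. -/
def unitCoeff : Words C V 0 →ₗ[R] R :=
  C.unitary.toLinearMap ∘ₗ (TensorProduct.rid R (C.obj 0)).toLinearMap ∘ₗ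
    TensorProduct.map LinearMap.id (PiTensorProduct.isEmptyEquiv (Fin 0)).toLinearMap ∘ₗ
    DirectSum.component R ℕ (Cell C V 0) 0

theorem tangent_lof_one (c : C.obj 1) (x : Fin 1 → V.carrier) :
    tangent C V (DirectSum.lof R ℕ (Cell C V 0) 1 (c ⊗ₜ PiTensorProduct.tprod R x)) =
      C.counit c • x 0 := by
  have h := DirectSum.component.lof_self R (ι := ℕ) (M := Cell C V 0) 1
    (c ⊗ₜ PiTensorProduct.tprod R x)
  have h' := congrArg (fun z : C.obj 1 ⊗[R] (⨂[R]^1 V.carrier) => TensorProduct.lid R V.carrier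
    (TensorProduct.map C.counit.toLinearMap
      (PiTensorProduct.subsingletonEquiv (0 : Fin 1)).toLinearMap z)) h
  refine Eq.trans h' ?_
  simp

theorem tangent_lof_of_ne {n : ℕ} (h : n ≠ 1) (z : Cell C V 0 n) :
    tangent C V (DirectSum.lof R ℕ (Cell C V 0) n z) = 0 := by
  simp [tangent, DirectSum.component.of, h]

theorem unitCoeff_lof_zero (c : C.obj 0) (x : Fin 0 → V.carrier) :
    unitCoeff C V (DirectSum.lof R ℕ (Cell C V 0) 0 (c ⊗ₜ PiTensorProduct.tprod R x)) =
      C.unitary c := by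
  have h := DirectSum.component.lof_self R (ι := ℕ) (M := Cell C V 0) 0
    (c ⊗ₜ PiTensorProduct.tprod R x)
  have h' := congrArg (fun z : C.obj 0 ⊗[R] (⨂[R]^0 V.carrier) => C.unitary
    (TensorProduct.rid R (C.obj 0) (TensorProduct.map LinearMap.id
      (PiTensorProduct.isEmptyEquiv (Fin 0)).toLinearMap z))) h
  refine Eq.trans h' ?_
  simp

theorem unitCoeff_lof_of_ne {n : ℕ} (h : n ≠ 0) (z : Cell C V 0 n) :
    unitCoeff C V (DirectSum.lof R ℕ (Cell C V 0) n z) = 0 := by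
  simp [unitCoeff, DirectSum.component.of, h]

theorem unit_eq (c : C.obj 0) : c = C.unitary c • 1 := by
  apply C.unitary.injective
  simp

/-- Only arities `0` and `1` inject into one letter. Arity `1` is unchanged, while a multiple of the
unitary operation acquires one input decorated by `v`. -/
theorem tangent_spread {v : V.carrier} (hv : v ∈ V.deg 0) (x : Words C V 0) :
    tangent C V (spread C V 0 v 1 x) = tangent C V x + unitCoeff C V x • v := by
  induction x using words_induction C V with
  | h0 => simp
  | hadd a b ha hb =>
    simp only [map_add, ha, hb, add_smul]
    abel
  | hsmul r a ha => simp only [map_smul, ha, smul_add, smul_assoc]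
  | h n c x =>
    match n with
    | 0 =>
      have h1 : ∀ j : Fin (0 + 0) ↪ Fin (1 + 0), C.counit (C.ext j c) = C.unitary c := by
        intro j
        have h := congrArg (fun y => C.counit (C.ext j y)) (unit_eq C c)
        have h2 : C.ext j (1 : C.obj 0) = 1 := C.ext_one j
        refine h.trans ?_
        simp [h2]
      have h2 : tangent C V (DirectSum.lof R ℕ (Cell C V 0) 0
          (c ⊗ₜ PiTensorProduct.tprod R x)) = 0 := tangent_lof_of_ne C V Nat.zero_ne_one _
      rw [spread_lof, Fintype.sum_unique, h2, (zero_add : ∀ y : V.carrier, 0 + y = y),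
        unitCoeff_lof_zero, extCell,
        TensorProduct.map_tmul, extTensor_elim0 V.deg hv]
      refine (tangent_lof_one C V _ _).trans ?_
      rw [← h1]
    | 1 =>
      have h3 : unitCoeff C V (DirectSum.lof R ℕ (Cell C V 0) 1
          (c ⊗ₜ PiTensorProduct.tprod R x)) = 0 := unitCoeff_lof_of_ne C V Nat.one_ne_zero _
      have h4 : ∀ j : Fin 1 ↪ Fin 1, j = Function.Embedding.refl _ :=
        fun j => Function.Embedding.ext fun _ => Subsingleton.elim _ _
      rw [h3, zero_smul, (add_zero : ∀ y : V.carrier, y + 0 = y), spread_lof,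
        Finset.sum_eq_single (Function.Embedding.refl _)
        (fun j _ hj => absurd (h4 j) hj) (fun h => absurd (Finset.mem_univ _) h),
        extCell_refl C V hv]
    | n + 2 =>
      rw [spread_lof_of_lt C V 0 v (by omega), tangent_lof_of_ne C V (by omega),
        unitCoeff_lof_of_ne C V (by omega)]
      simp

/-- Turning the last marked input into a decorated one. -/
def unmarkCell (p A : ℕ) : Cell C V (p + 1) A ⊗[R] V.carrier →ₗ[R] Cell C V p (A + 1) :=
  TensorProduct.map (C.map (finSwap A 1 p).symm).toLinearMap TensorPower.mulEquiv.toLinearMap ∘ₗ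
    (TensorProduct.assoc R (C.obj (A + (p + 1))) (⨂[R]^A V.carrier)
      (⨂[R]^1 V.carrier)).toLinearMap ∘ₗ
    TensorProduct.map LinearMap.id
      (PiTensorProduct.subsingletonEquiv (s := fun _ : Fin 1 => V.carrier) (R := R)
        0).symm.toLinearMap

/-- Turning the last marked input into a decorated one. -/
def unmark (p : ℕ) : Words C V (p + 1) ⊗[R] V.carrier →ₗ[R] Words C V p :=
  TensorProduct.lift (DirectSum.toModule R ℕ _ fun A =>
    TensorProduct.curry (DirectSum.lof R ℕ (Cell C V p) (A + 1) ∘ₗ unmarkCell C V p A))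

theorem unmark_lof (p A : ℕ) (z : Cell C V (p + 1) A) (x : V.carrier) :
    unmark C V p (DirectSum.lof R ℕ (Cell C V (p + 1)) A z ⊗ₜ x) =
      DirectSum.lof R ℕ (Cell C V p) (A + 1) (unmarkCell C V p A (z ⊗ₜ x)) := by
  simp [unmark, DirectSum.toModule_lof]

theorem unmarkCell_tmul (p A : ℕ) (c : C.obj (A + (p + 1))) (t : ⨂[R]^A V.carrier)
    (x : V.carrier) :
    unmarkCell C V p A ((c ⊗ₜ t) ⊗ₜ x) = C.map (finSwap A 1 p).symm c ⊗ₜ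
      TensorPower.mulEquiv (t ⊗ₜ[R] PiTensorProduct.tprod R fun _ : Fin 1 => x) := by
  simp only [unmarkCell, LinearMap.comp_apply, TensorProduct.map_tmul, LinearMap.id_apply,
    LinearEquiv.coe_coe, TensorProduct.assoc_tmul, AlgHom.toLinearMap_apply]
  have h : (PiTensorProduct.subsingletonEquiv (s := fun _ : Fin 1 => V.carrier) (R := R) 0).symm x =
      PiTensorProduct.tprod R fun _ : Fin 1 => x := by
    rw [LinearEquiv.symm_apply_eq]
    simp
  rw [h]

theorem counit_parityPart_false (c : C.obj 1) : parityPart (C.deg 1) false c = c :=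
  parityPart_false_of_mem _ (C.mem_deg_one_zero c)

theorem counit_parityPart_true (c : C.obj 1) : parityPart (C.deg 1) true c = 0 := by
  rw [parityPart_of_pure (C.deg 1) (counit_parityPart_false C c)]
  simp

/-- Grafting back the cogenerator of a split-off input is the right counit axiom. No sign arises
because `u𝒞(1)` is in degree zero. -/
theorem unmark_deconcat (p A : ℕ) (x : Words C V p) :
    unmark C V p (TensorProduct.map LinearMap.id (tangent C V) (deconcat C V p A 1 x)) =
      DirectSum.lof R ℕ (Cell C V p) (A + 1) (x (A + 1)) := by
  have hx : deconcat C V p A 1 x = TensorProduct.map (DirectSum.lof R ℕ (Cell C V (p + 1)) A)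
      (DirectSum.lof R ℕ (Cell C V 0) 1) (deconcatCell C V p A 1 (x (A + 1))) := rfl
  rw [hx]
  generalize (x (A + 1) : Cell C V p (A + 1)) = z
  induction z using TensorProduct.induction_on with
  | zero => simp
  | add a b ha hb => simp only [map_add, ha, hb]
  | tmul c t =>
    obtain ⟨t, rfl⟩ := TensorPower.mulEquiv.surjective t
    induction t using TensorProduct.induction_on with
    | zero => simp
    | add a b ha hb => simp only [map_add, TensorProduct.tmul_add, ha, hb]
    | tmul t s =>
      induction s using PiTensorProduct.induction_on with
      | add a b ha hb => simp only [map_add, TensorProduct.tmul_add, ha, hb]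
      | smul_tprod r s =>
        simp only [TensorProduct.tmul_smul, map_smul]
        congr 1
        have key : ∀ y : C.obj (A + p + 1) ⊗[R] C.obj 1,
            unmark C V p (TensorProduct.map LinearMap.id (tangent C V)
              (TensorProduct.map (DirectSum.lof R ℕ (Cell C V (p + 1)) A)
                (DirectSum.lof R ℕ (Cell C V 0) 1) (distribute C V (A + (p + 1)) 1 A 1
                  (y ⊗ₜ (t ⊗ₜ PiTensorProduct.tprod R s))))) =
              DirectSum.lof R ℕ (Cell C V p) (A + 1)
                (C.map (finSwap A 1 p).symm (TensorProduct.rid R _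
                  (TensorProduct.map LinearMap.id C.counit.toLinearMap y)) ⊗ₜ
                  TensorPower.mulEquiv (t ⊗ₜ[R] PiTensorProduct.tprod R s)) := by
          intro y
          induction y using TensorProduct.induction_on with
          | zero => simp
          | add a b ha hb => simp only [map_add, TensorProduct.add_tmul, ha, hb]
          | tmul c c' =>
            have hd : distribute C V (A + (p + 1)) 1 A 1
                ((c ⊗ₜ c') ⊗ₜ (t ⊗ₜ PiTensorProduct.tprod R s)) =
                (c ⊗ₜ t) ⊗ₜ (c' ⊗ₜ PiTensorProduct.tprod R s) := by
              simp [distribute, counit_parityPart_false, counit_parityPart_true]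
            have hs : (fun _ : Fin 1 => s 0) = s := by
              funext i
              rw [Subsingleton.elim i 0]
            rw [hd, TensorProduct.map_tmul, TensorProduct.map_tmul, LinearMap.id_apply]
            erw [tangent_lof_one]
            rw [TensorProduct.tmul_smul, map_smul, unmark_lof]
            erw [unmarkCell_tmul]
            rw [hs, ← map_smul, TensorProduct.smul_tmul']
            simp
        refine Eq.trans ?_ ((key (C.partialDecomp (A + p) 1 (C.map (finSwap A 1 p) c))).trans ?_)
        · simp only [deconcatCell, LinearMap.comp_apply, TensorProduct.map_tmul,
            LinearEquiv.coe_coe, LinearEquiv.symm_apply_apply, AlgHom.toLinearMap_apply]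
        · have h := C.decomp_counit (A + p) (C.map (finSwap A 1 p) c)
          congr 2
          refine (congrArg (C.map (finSwap A 1 p).symm) h).trans ?_
          rw [← C.map_trans, Equiv.self_trans_symm, C.map_refl]

theorem unmark_mem (p a b : ℕ) {y : Words C V (p + 1)} (hy : y ∈ markedFil C V (p + 1) a)
    {x : V.carrier} (hx : x ∈ V.F b) : unmark C V p (y ⊗ₜ x) ∈ markedFil C V p (a + b) := by
  suffices h : markedFil C V (p + 1) a ≤ (markedFil C V p (a + b)).comap
      (unmark C V p ∘ₗ (TensorProduct.mk R _ _).flip x) from h hy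
  refine Submodule.span_le.mpr ?_
  rintro _ ⟨n, c, y, w, hw, hN, rfl⟩
  change unmark C V p (DirectSum.lof R ℕ (Cell C V (p + 1)) n (c ⊗ₜ PiTensorProduct.tprod R y) ⊗ₜ x)
    ∈ markedFil C V p (a + b)
  rw [unmark_lof]
  erw [unmarkCell_tmul]
  rw [mulEquiv_tprod]
  refine Submodule.subset_span ⟨n + 1, _, _, Fin.append w fun _ => b, fun i => ?_, ?_, rfl⟩
  · obtain ⟨i, rfl⟩ | ⟨i, rfl⟩ := fin_add_cases i
    · simpa using hw i
    · simpa using hx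
  · rw [Fin.sum_univ_add]
    simpa using hN

/-- The map `S` undoes the iterated decomposition when all split-off factors have arity one: the
factor at index `0` was split off last and is grafted back first, onto the input marked last. All
orders in which the inputs were split off contribute, hence the norm on the right. -/
theorem exists_reassemble_iterPeel (k : ℕ) : ∀ A : ℕ,
    ∃ S : Words C V k ⊗[R] (⨂[R]^k V.carrier) →ₗ[R] Words C V 0,
      (∀ a (y : Words C V k) (w : Fin k → ℕ) (x : Fin k → V.carrier), y ∈ markedFil C V k a →
        (∀ i, x i ∈ V.F (w i)) → S (y ⊗ₜ PiTensorProduct.tprod R x) ∈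
          wordFil C V (a + ∑ i, w i)) ∧
      ∀ x, S (TensorProduct.map (spread C V k 0 A) (PiTensorProduct.map fun _ => tangent C V)
        (iterPeel C V k x)) = spread C V 0 0 (A + k) x := by
  induction k with
  | zero =>
    intro A
    refine ⟨(TensorProduct.rid R _).toLinearMap ∘ₗ TensorProduct.map LinearMap.id
      (PiTensorProduct.isEmptyEquiv (Fin 0)).toLinearMap, fun a y w x hy _ => ?_, fun x => ?_⟩
    · rw [← markedFil_zero]
      simpa using hy
    · simp [iterPeel]
  | succ k ih =>
    intro A
    -- Grafting one factor back gives the root one more decorated input.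
    obtain ⟨S, hS, hS'⟩ := ih (A + 1)
    refine ⟨S ∘ₗ TensorProduct.map (unmark C V k) LinearMap.id ∘ₗ
      (TensorProduct.assoc R _ _ _).symm.toLinearMap ∘ₗ
      TensorProduct.map LinearMap.id (unconsTensor V.carrier k), fun a y w x hy hx => ?_,
      fun x => ?_⟩
    · simp only [LinearMap.comp_apply, TensorProduct.map_tmul, LinearMap.id_apply,
        unconsTensor_tprod, LinearEquiv.coe_coe, TensorProduct.assoc_symm_tmul]
      rw [Fin.sum_univ_succ, ← add_assoc]
      exact hS _ _ _ _ (unmark_mem C V k a (w 0) hy (hx 0)) fun i => hx i.succ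
    · have key : ∀ z : Words C V k ⊗[R] (⨂[R]^k (Words C V 0)),
          TensorProduct.map (unmark C V k) LinearMap.id ((TensorProduct.assoc R _ _ _).symm
            (TensorProduct.map LinearMap.id (unconsTensor V.carrier k)
              (TensorProduct.map (spread C V (k + 1) 0 A)
                (PiTensorProduct.map fun _ => tangent C V)
                (TensorProduct.map LinearMap.id (consTensor (Words C V 0) k)
                  (TensorProduct.assoc R _ _ _
                    (TensorProduct.map (peel C V k) LinearMap.id z)))))) =
          TensorProduct.map (spread C V k 0 (A + 1)) (PiTensorProduct.map fun _ => tangent C V)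
            z := by
        intro z
        induction z using TensorProduct.induction_on with
        | zero => simp
        | add a b ha hb => simp only [map_add, ha, hb]
        | tmul y u =>
          have hy : unmark C V k (TensorProduct.map (spread C V (k + 1) 0 A) (tangent C V)
              (peel C V k y)) = spread C V k 0 (A + 1) y := by
            have h1 : spread C V k 0 (A + 1) y = DirectSum.lof R ℕ (Cell C V k) (A + 1)
                (spread C V k 0 (A + 1) y (A + 1)) := by
              induction y using DirectSum.induction_on with
              | zero => simp
              | add a b ha hb =>
                rw [map_add, DirectSum.add_apply, map_add, ← ha, ← hb]
              | of m z =>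
                change spread C V k 0 (A + 1) (DirectSum.lof R ℕ (Cell C V k) m z) =
                  DirectSum.lof R ℕ (Cell C V k) (A + 1)
                    (spread C V k 0 (A + 1) (DirectSum.lof R ℕ (Cell C V k) m z) (A + 1))
                rw [spread_lof, ← map_sum]
                congr 1
                exact (DirectSum.of_eq_same _ _).symm
            -- Cutting off a block of size one turns the spread of `y` into its decomposition with
            -- both factors spread; the second is spread by `0` to arity one, which `tangent` does
            -- not notice.
            rw [h1, ← unmark_deconcat, deconcat_spread C V (zero_mem _)]
            generalize peel C V k y = q
            congr 1
            induction q using TensorProduct.induction_on with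
            | zero => simp
            | add a b ha hb => simp only [map_add, ha, hb]
            | tmul a b =>
              simp only [TensorProduct.map_tmul, LinearMap.id_apply,
                tangent_spread C V (zero_mem (V.deg 0)), smul_zero, add_zero]
          rw [TensorProduct.map_tmul (spread C V k 0 (A + 1)), ← hy, TensorProduct.map_tmul,
            LinearMap.id_apply]
          generalize peel C V k y = q
          induction q using TensorProduct.induction_on with
          | zero => simp
          | add a b ha hb => simp only [map_add, TensorProduct.add_tmul, ha, hb]
          | tmul a b =>
            simp only [TensorProduct.map_tmul, TensorProduct.assoc_tmul, LinearMap.id_apply,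
              map_consTensor, unconsTensor_consTensor, TensorProduct.assoc_symm_tmul]
      simp only [LinearMap.comp_apply, LinearEquiv.coe_coe, iterPeel_succ]
      rw [key, hS', add_assoc, add_comm 1 k]

/-- A word is determined, up to the action of the symmetric group, by the values of its coproduct
on cogenerators. -/
theorem exists_reassemble (k : ℕ) :
    ∃ S : C.obj k ⊗[R] (⨂[R]^k V.carrier) →ₗ[R] Words C V 0,
      (∀ c (w : Fin k → ℕ) (x : Fin k → V.carrier), (∀ i, x i ∈ V.F (w i)) →
        S (c ⊗ₜ PiTensorProduct.tprod R x) ∈ wordFil C V (∑ i, w i)) ∧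
      ∀ x, S (TensorProduct.map LinearMap.id (PiTensorProduct.map fun _ => tangent C V)
        (coproduct C V k x)) = spread C V 0 0 k x := by
  obtain ⟨S, hS, hS'⟩ := exists_reassemble_iterPeel C V k 0
  let e := (finCongr (Nat.zero_add k)).trans Fin.revPerm
  -- A section of `rootPart`, undoing the reversal of the marked inputs.
  let r : C.obj k →ₗ[R] Words C V k := DirectSum.lof R ℕ (Cell C V k) 0 ∘ₗ
    (TensorProduct.mk R _ _).flip (PiTensorProduct.tprod R Fin.elim0) ∘ₗ (C.map e.symm).toLinearMap
  have hr : ∀ y, r (rootPart C V k y) = spread C V k 0 0 y := by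
    intro y
    induction y using DirectSum.induction_on with
    | zero => simp
    | add a b ha hb => simp only [map_add, ha, hb]
    | of m z =>
      change r (rootPart C V k (DirectSum.lof R ℕ (Cell C V k) m z)) =
        spread C V k 0 0 (DirectSum.lof R ℕ (Cell C V k) m z)
      cases m with
      | zero =>
        rw [spread_lof, Fintype.sum_unique, show (default : Fin 0 ↪ Fin 0) =
          Function.Embedding.refl _ from Subsingleton.elim _ _,
          extCell_refl C V (zero_mem (V.deg 0))]
        induction z using TensorProduct.induction_on with
        | zero => simp
        | add a b ha hb => simp only [map_add, ha, hb]
        | tmul c t =>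
          induction t using PiTensorProduct.induction_on with
          | add a b ha hb => simp only [map_add, TensorProduct.tmul_add, ha, hb]
          | smul_tprod s t =>
            simp only [TensorProduct.tmul_smul, map_smul]
            congr 1
            rw [Subsingleton.elim t Fin.elim0]
            have h1 : rootPart C V k (DirectSum.lof R ℕ (Cell C V k) 0
                (c ⊗ₜ PiTensorProduct.tprod R Fin.elim0)) = C.map e c := by
              simp [rootPart, DirectSum.component.lof_self, e]
            rw [h1]
            simp only [r, LinearMap.comp_apply, AlgHom.toLinearMap_apply]
            rw [← C.map_trans, Equiv.self_trans_symm, C.map_refl]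
            rfl
      | succ m =>
        rw [spread_lof_of_lt C V k 0 (Nat.succ_pos m)]
        simp [rootPart, DirectSum.component.of]
  refine ⟨S ∘ₗ TensorProduct.map r LinearMap.id, fun c w x hx => ?_, fun x => ?_⟩
  · have h := hS 0 (r c) w x (Submodule.subset_span
      ⟨0, _, Fin.elim0, Fin.elim0, fun i => i.elim0, Nat.zero_le _, rfl⟩) hx
    rwa [zero_add] at h
  · have h := hS' x
    rw [zero_add] at h
    rw [← h, coproduct, LinearMap.comp_apply, LinearMap.comp_apply]
    congr 1
    generalize iterPeel C V k x = z
    induction z using TensorProduct.induction_on with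
    | zero => simp
    | add a b ha hb => simp only [map_add, ha, hb]
    | tmul y u => simp [hr]

end Tangent

/-! ### Averaging over the symmetric groups -/

namespace HopfCooperad

variable {R : Type u} [CommRing R] (C : HopfCooperad.{u, w} R)

/-- A family of maps that average to the identity over the symmetric groups. -/
def IsAveraging (π : ∀ n, C.obj n →ₗ[R] C.obj n) : Prop :=
  ∀ n x, ∑ σ : Equiv.Perm (Fin n), C.map σ.symm (π n (C.map σ x)) = x

/-- A family of elements of degree zero that symmetrize to the units. -/
def IsSymmetrizing (e : ∀ n, C.obj n) : Prop :=
  ∀ n, e n ∈ C.deg n 0 ∧ ∑ σ : Equiv.Perm (Fin n), C.map σ (e n) = 1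

/-- For a basis of a free module over the group ring, take the projection to the coefficients of the
identity permutation. -/
theorem exists_averaging_of_free (hC : C.IsSymmetricFree) : ∃ π, C.IsAveraging π := by
  classical
  refine ⟨fun n => ?_, ?_⟩
  · let b := (hC n).choose_spec.choose
    have hb := (hC n).choose_spec.choose_spec
    exact (Module.Basis.mk hb.2.1 hb.2.2.ge).constr R
      fun p => if p.2 = Equiv.refl _ then b p.1 else 0
  · intro n
    let b := (hC n).choose_spec.choose
    have hb := (hC n).choose_spec.choose_spec
    let B := Module.Basis.mk hb.2.1 hb.2.2.ge
    let π := B.constr R fun p => if p.2 = Equiv.refl _ then b p.1 else 0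
    have hB : ∀ i σ, C.map σ (b i) = B (i, σ) := fun i σ => by
      rw [Module.Basis.mk_apply]
    suffices h : (∑ σ : Equiv.Perm (Fin n),
        (C.map σ.symm).toLinearMap ∘ₗ π ∘ₗ (C.map σ).toLinearMap) = LinearMap.id by
      intro x
      have := LinearMap.congr_fun h x
      simpa only [LinearMap.sum_apply, LinearMap.comp_apply, AlgHom.toLinearMap_apply,
        LinearMap.id_apply] using this
    refine B.ext ?_
    rintro ⟨i, τ⟩
    have hπ : ∀ σ, π (B (i, σ)) = if σ = Equiv.refl _ then b i else 0 :=
      fun σ => B.constr_basis R _ _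
    simp only [LinearMap.sum_apply, LinearMap.comp_apply, AlgHom.toLinearMap_apply,
      LinearMap.id_apply]
    -- Only the inverse of `τ` moves the translate by `τ` back to the chosen representative, the one
    -- basis vector per orbit that the projection keeps.
    rw [← hB, Finset.sum_eq_single τ.symm]
    · rw [← C.map_trans, hB, hπ, if_pos (by simp), Equiv.symm_symm]
    · intro σ _ hσ
      rw [← C.map_trans, hB, hπ, if_neg, map_zero]
      intro h
      apply hσ
      ext i
      have := DFunLike.congr_fun h (τ.symm i)
      simp at this
      rw [this]
    · simp

/-- Division by `n!`, the number of terms in the sum. -/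
theorem exists_averaging_of_rat [Algebra ℚ R] : ∃ π, C.IsAveraging π := by
  refine ⟨fun n => algebraMap ℚ R (1 / (n.factorial : ℚ)) • LinearMap.id, fun n x => ?_⟩
  have h : ∀ σ : Equiv.Perm (Fin n), C.map σ.symm (C.map σ x) = x := fun σ => by
    rw [← C.map_trans, Equiv.self_trans_symm, C.map_refl]
  simp only [LinearMap.smul_apply, LinearMap.id_apply, map_smul, h, Finset.sum_const,
    Finset.card_univ, Fintype.card_perm, Fintype.card_fin]
  rw [← Nat.cast_smul_eq_nsmul R, smul_smul, ← map_natCast (algebraMap ℚ R), ← map_mul,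
    mul_one_div_cancel (Nat.cast_ne_zero.mpr n.factorial_ne_zero), map_one, one_smul]

theorem exists_averaging (hC : C.IsSymmetricFree ∨ Nonempty (Algebra ℚ R)) :
    ∃ π, C.IsAveraging π := by
  rcases hC with hC | ⟨⟨hC⟩⟩
  · exact C.exists_averaging_of_free hC
  · exact C.exists_averaging_of_rat

/-- Apply the averaging identity to the unit, which all permutations fix, and reindex by inversion.
Averaging families are not required to be homogeneous, so the degree zero part is taken; this is
harmless because the unit has degree zero. -/
theorem exists_symmetrizing {π : ∀ n, C.obj n →ₗ[R] C.obj n} (hπ : C.IsAveraging π) :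
    ∃ e, C.IsSymmetrizing e := by
  let χ : ℤ → R := fun i => if i = 0 then 1 else 0
  refine ⟨fun n => scaleByDegree (C.deg n) χ (π n 1), fun n => ⟨?_, ?_⟩⟩
  · classical
    change scaleByDegree (C.deg n) χ (π n 1) ∈ C.deg n 0
    rw [← DirectSum.sum_support_decompose (C.deg n) (π n 1), map_sum]
    refine Submodule.sum_mem _ fun i _ => ?_
    rw [scaleByDegree_apply_of_mem (C.deg n) χ (SetLike.coe_mem _)]
    by_cases hi : i = 0
    · subst hi
      exact Submodule.smul_mem _ _ (SetLike.coe_mem _)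
    · simp [χ, hi]
  · have h1 : ∀ σ : Equiv.Perm (Fin n), C.map σ (scaleByDegree (C.deg n) χ (π n 1)) =
        scaleByDegree (C.deg n) χ (C.map σ (π n 1)) := fun σ =>
      map_scaleByDegree (C.deg n) (C.deg n) χ (C.map σ).toLinearMap (C.map_deg σ) _
    have h2 := hπ n 1
    simp only [map_one] at h2
    rw [← Equiv.sum_comp (Equiv.inv (Equiv.Perm (Fin n)))] at h2
    simp_rw [h1]
    rw [← map_sum]
    have h3 : ∑ σ : Equiv.Perm (Fin n), C.map σ (π n 1) = 1 := h2
    rw [h3, scaleByDegree_apply_of_mem (C.deg n) χ (SetLike.GradedOne.one_mem)]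
    simp [χ]

end HopfCooperad

/-! ### Multiplication by the exponential, before completion -/

section ExpWord

variable {R : Type u} [CommRing R] (C : HopfCooperad.{u, w} R) (V : CompleteGradedModule.{u, v} R)

/-- The exponential, truncated at arity `K`. -/
def expWord (e : ∀ n, C.obj n) (v : V.carrier) (K : ℕ) : Words C V 0 :=
  ∑ n ∈ Finset.range K, DirectSum.lof R ℕ (Cell C V 0) n
    (e n ⊗ₜ PiTensorProduct.tprod R fun _ => v)

/-- Moving `c'` past copies of an even `v` costs no sign, so the two parity parts recombine. -/
theorem starCell_even {v : V.carrier} (hv : v ∈ V.deg 0) {n m : ℕ} (c : C.obj n) (c' : C.obj m)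
    (t : ⨂[R]^m V.carrier) :
    starCell C V n m (c ⊗ₜ PiTensorProduct.tprod R fun _ => v) (c' ⊗ₜ t) =
      (C.addInputs n m c * C.addInputsLeft n m c') ⊗ₜ
        TensorPower.mulEquiv ((PiTensorProduct.tprod R fun _ : Fin n => v) ⊗ₜ[R] t) := by
  have hv' : signInv V.deg v = v := by
    simpa using signInv_of_pure V.deg (parityPart_false_of_mem V.deg hv)
  rw [starCell_tmul, PiTensorProduct.map_tprod, hv', ← TensorProduct.add_tmul, ← mul_add,
    ← map_add, parityPart_false_add_true]

theorem embSum_refl_zero {m n : ℕ} (j : Fin m ↪ Fin n) :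
    embSum j (Function.Embedding.refl (Fin 0)) = j := by
  ext i
  exact (embSum_val _ _ i).trans (dif_pos (show (i : ℕ) < m from i.isLt))

/-- The norm of the product sums over permutations of `n + m` letters, regrouped by the positions
`j` of the last `m` letters. The remaining permutations act only on `e n`. -/
theorem spread_starWords_lof {e : ∀ n, C.obj n} (he : C.IsSymmetrizing e) {v : V.carrier}
    (hv : v ∈ V.deg 0) (n m : ℕ) (z : Cell C V 0 m) :
    spread C V 0 0 (n + m) (starWords C V (DirectSum.lof R ℕ (Cell C V 0) n
        (e n ⊗ₜ PiTensorProduct.tprod R fun _ => v)) (DirectSum.lof R ℕ (Cell C V 0) m z)) =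
      spread C V 0 v (n + m) (DirectSum.lof R ℕ (Cell C V 0) m z) := by
  induction z using TensorProduct.induction_on with
  | zero => simp
  | add a b ha hb => simp only [map_add, ha, hb]
  | tmul c t =>
    rw [starWords_lof, starCell_even C V hv, spread_zero_lof_self, spread_lof,
      sum_perm_eq_sum_embedding]
    refine Finset.sum_congr rfl fun j _ => ?_
    rw [← map_sum]
    congr 1
    have hE := (exists_equiv_extending_right rfl j).choose_spec
    set E := (exists_equiv_extending_right rfl j).choose
    have hj : ∀ τ : Equiv.Perm (Fin n), (Fin.natAddEmb n).trans
        ((finSum τ (Equiv.refl (Fin m))).trans E).toEmbedding = j := by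
      intro τ
      refine Function.Embedding.ext fun i => ?_
      refine Eq.trans ?_ (hE i)
      exact congrArg E (finSum_natAdd τ (Equiv.refl (Fin m)) i)
    have hterm : ∀ τ : Equiv.Perm (Fin n),
        act C V 0 ((finSum τ (Equiv.refl (Fin m))).trans E)
          ((C.addInputs n m (e n) * C.addInputsLeft n m c) ⊗ₜ
            TensorPower.mulEquiv ((PiTensorProduct.tprod R fun _ : Fin n => v) ⊗ₜ[R] t)) =
        (C.map E (C.addInputs n m (C.map τ (e n))) * C.ext j c) ⊗ₜ extTensor V.deg v j t := by
      intro τ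
      rw [act_zero_tmul, ← extTensor_natAdd V.deg hv, signedReindex_comp_extTensor V.deg hv, hj,
        map_mul, ← C.ext_natAdd, C.map_ext, hj, C.map_trans, ← C.addInputs_map]
    simp_rw [hterm]
    -- Summing over the orderings of the first `n` letters symmetrizes `e n` to the unit, so the
    -- Hopf product leaves just the extension of `c` along `j`.
    rw [← TensorProduct.sum_tmul, ← Finset.sum_mul, ← map_sum, ← map_sum, (he n).2, C.addInputs_one,
      map_one, one_mul, extCell, embSum_refl_zero, TensorProduct.map_tmul]

/-- Multiplication by the exponential, in terms of the sums over all embeddings. -/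
theorem spread_starWords_expWord {e : ∀ n, C.obj n} (he : C.IsSymmetrizing e) {v : V.carrier}
    (hv : v ∈ V.deg 0) {M K : ℕ} (hM : M < K) (x : Words C V 0) :
    spread C V 0 0 M (starWords C V (expWord C V e v K) x) = spread C V 0 v M x := by
  induction x using words_induction_lof C V with
  | h0 => simp
  | hadd a b ha hb => simp only [map_add, ha, hb]
  | h m z =>
    rw [expWord, map_sum, LinearMap.sum_apply, map_sum]
    have h0 : ∀ n, n + m ≠ M → spread C V 0 0 M (starWords C V (DirectSum.lof R ℕ (Cell C V 0) n
        (e n ⊗ₜ PiTensorProduct.tprod R fun _ => v)) (DirectSum.lof R ℕ (Cell C V 0) m z)) = 0 := by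
      intro n hn
      rw [starWords_lof, spread_zero_lof_of_ne C V 0 hn]
    rcases lt_or_ge M m with h | h
    · rw [spread_lof_of_lt C V 0 v h]
      exact Finset.sum_eq_zero fun n _ => h0 n (by omega)
    -- Exactly one term of the exponential leads from arity `m` to arity `M`, and `M < K` guarantees
    -- that the truncation contains it.
    · obtain ⟨n, rfl⟩ : ∃ n, M = n + m := ⟨M - m, by omega⟩
      rw [Finset.sum_eq_single n (fun n' _ hn' => h0 n' (by omega))
        (fun hn => absurd (Finset.mem_range.mpr (by omega)) hn), spread_starWords_lof C V he hv]

/-- The sum over the symmetric groups, truncated at arity `A`. -/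
def symmetrize (A : ℕ) : Words C V 0 →ₗ[R] Words C V 0 :=
  ∑ a ∈ Finset.range A, spread C V 0 0 a

/-- The action of an averaging family. -/
def averageWords (π : ∀ n, C.obj n →ₗ[R] C.obj n) : Words C V 0 →ₗ[R] Words C V 0 :=
  DirectSum.lmap fun n => TensorProduct.map (π n) LinearMap.id

theorem averageWords_lof (π : ∀ n, C.obj n →ₗ[R] C.obj n) (n : ℕ) (z : Cell C V 0 n) :
    averageWords C V π (DirectSum.lof R ℕ (Cell C V 0) n z) =
      DirectSum.lof R ℕ (Cell C V 0) n (TensorProduct.map (π n) LinearMap.id z) :=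
  DirectSum.lmap_lof _ _ _

theorem averageWords_mem (π : ∀ n, C.obj n →ₗ[R] C.obj n) {N : ℕ} {x : Words C V 0}
    (hx : x ∈ wordFil C V N) : averageWords C V π x ∈ wordFil C V N := by
  suffices h : wordFil C V N ≤ (wordFil C V N).comap (averageWords C V π) from h hx
  refine Submodule.span_le.mpr ?_
  rintro _ ⟨n, c, x, w, hw, hN, rfl⟩
  refine Submodule.subset_span ⟨n, π n c, x, w, hw, hN, ?_⟩
  rw [averageWords_lof]
  rfl

theorem lof_mem_wordFil {K n : ℕ} (h : K ≤ n) (z : Cell C V 0 n) :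
    DirectSum.lof R ℕ (Cell C V 0) n z ∈ wordFil C V K := by
  induction z using TensorProduct.induction_on with
  | zero => simp
  | add a b ha hb => simpa only [map_add] using add_mem ha hb
  | tmul c t =>
    induction t using PiTensorProduct.induction_on with
    | add a b ha hb => simpa only [map_add, TensorProduct.tmul_add] using add_mem ha hb
    | smul_tprod r x =>
      rw [TensorProduct.tmul_smul, map_smul]
      refine Submodule.smul_mem _ _ (Submodule.subset_span ⟨n, c, x, fun _ => 1, fun i => ?_, ?_,
        rfl⟩)
      · rw [V.F_one]
        trivial
      · simpa using h

/-- Expand `c` by the averaging identity. Its term at `σ` is the translate under the inverse of `σ`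
of the term at `σ` of the averaged norm, so the two differ by a coinvariance relation. -/
theorem sub_averageWords_mem {π : ∀ n, C.obj n →ₗ[R] C.obj n} (hπ : C.IsAveraging π) (n : ℕ)
    (z : Cell C V 0 n) :
    DirectSum.lof R ℕ (Cell C V 0) n z - averageWords C V π
      (spread C V 0 0 n (DirectSum.lof R ℕ (Cell C V 0) n z)) ∈ coinvRel C V := by
  induction z using TensorProduct.induction_on with
  | zero => simp
  | add a b ha hb =>
    simp only [map_add]
    rw [add_sub_add_comm]
    exact add_mem ha hb
  | tmul c t =>
    have h1 : c = ∑ σ : Equiv.Perm (Fin n), C.map σ.symm (π n (C.map σ c)) := (hπ n c).symm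
    rw [spread_zero_lof_self, map_sum]
    have h2 : DirectSum.lof R ℕ (Cell C V 0) n (c ⊗ₜ t) =
        ∑ σ : Equiv.Perm (Fin n), DirectSum.lof R ℕ (Cell C V 0) n
          ((C.map σ.symm (π n (C.map σ c)) : C.obj n) ⊗ₜ t) := by
      rw [← map_sum, ← TensorProduct.sum_tmul, ← h1]
    rw [h2, ← Finset.sum_sub_distrib]
    refine Submodule.sum_mem _ fun σ _ => ?_
    refine Submodule.subset_span ⟨n, σ.symm, (π n (C.map σ c)) ⊗ₜ signedReindex V.deg σ t, ?_⟩
    rw [act_zero_tmul, averageWords_lof, act_zero_tmul]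
    congr 3
    have h3 : ∀ u : ⨂[R]^n V.carrier, signedReindex V.deg σ.symm (signedReindex V.deg σ u) = u := by
      intro u
      rw [← extTensor_toEmbedding, ← extTensor_toEmbedding,
        extTensor_toEmbedding V.deg σ.symm, signedReindex_comp_extTensor V.deg (zero_mem _)]
      have h4 : σ.toEmbedding.trans σ.symm.toEmbedding = (Equiv.refl (Fin n)).toEmbedding := by
        ext i
        simp
      rw [h4, extTensor_toEmbedding, signedReindex_refl]
    rw [h3]

/-- Every word is recovered from its symmetrization. -/
theorem sub_symmetrize_mem {π : ∀ n, C.obj n →ₗ[R] C.obj n} (hπ : C.IsAveraging π) (N : ℕ)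
    (x : Words C V 0) :
    x - averageWords C V π (symmetrize C V N x) ∈ fil C V N := by
  induction x using words_induction_lof C V with
  | h0 => simp
  | hadd a b ha hb =>
    simp only [map_add]
    rw [add_sub_add_comm]
    exact add_mem ha hb
  | h m z =>
    rw [symmetrize, LinearMap.sum_apply]
    rcases lt_or_ge m N with h | h
    · rw [Finset.sum_eq_single m
        (fun a _ ha => spread_zero_lof_of_ne C V 0 (Ne.symm ha) z)
        (fun hm => absurd (Finset.mem_range.mpr h) hm)]
      exact Submodule.mem_sup_left (sub_averageWords_mem C V hπ m z)
    -- Since `V = F¹V`, arity at least `N` forces weight at least `N`, so nothing has to be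
    -- recovered here.
    · rw [Finset.sum_eq_zero, map_zero, sub_zero]
      · exact Submodule.mem_sup_right (lof_mem_wordFil C V h z)
      · intro a ha
        exact spread_zero_lof_of_ne C V 0 (by have := Finset.mem_range.mp ha; omega) z

theorem spread_coinvRel (M : ℕ) {x : Words C V 0} (hx : x ∈ coinvRel C V) :
    spread C V 0 0 M x = 0 := by
  suffices h : coinvRel C V ≤ LinearMap.ker (spread C V 0 0 M) from h hx
  refine Submodule.span_le.mpr ?_
  rintro _ ⟨n, σ, z, rfl⟩
  change spread C V 0 0 M _ = 0
  rw [map_sub, spread_act C V (zero_mem _), sub_self]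

/-! ### Coproducts seen through symmetrization. -/

section Coproduct

variable {X Y : Type*} [AddCommMonoid X] [Module R X] [AddCommMonoid Y] [Module R Y]

theorem map_comp_sum_spread {k : ℕ} (f : Fin k → Words C V 0 →ₗ[R] X) (s : Fin k → Finset ℕ)
    (t : ⨂[R]^k (Words C V 0)) :
    PiTensorProduct.map (fun i => f i ∘ₗ ∑ a ∈ s i, spread C V 0 0 a) t =
      ∑ n ∈ Fintype.piFinset s,
        PiTensorProduct.map f (PiTensorProduct.map (fun i => spread C V 0 0 (n i)) t) := by
  have h1 : (fun i => f i ∘ₗ ∑ a ∈ s i, spread C V 0 0 a) =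
      fun i => ∑ a ∈ s i, f i ∘ₗ spread C V 0 0 a := by
    funext i
    ext1
    ext x
    simp
  have h2 := (PiTensorProduct.mapMultilinear R (fun _ : Fin k => Words C V 0)
    (fun _ : Fin k => X)).map_sum_finset (fun i a => f i ∘ₗ spread C V 0 0 a) s
  rw [h1]
  refine (LinearMap.congr_fun h2 t).trans ?_
  rw [LinearMap.sum_apply]
  refine Finset.sum_congr rfl fun n _ => ?_
  rw [← LinearMap.comp_apply (PiTensorProduct.map f), ← PiTensorProduct.map_comp]
  rfl

theorem map_map_comp_sum_spread {k : ℕ} (ψ : C.obj k →ₗ[R] Y) (f : Fin k → Words C V 0 →ₗ[R] X)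
    (s : Fin k → Finset ℕ) (z : C.obj k ⊗[R] (⨂[R]^k (Words C V 0))) :
    TensorProduct.map ψ (PiTensorProduct.map fun i => f i ∘ₗ ∑ a ∈ s i, spread C V 0 0 a) z =
      ∑ n ∈ Fintype.piFinset s,
        TensorProduct.map ψ (PiTensorProduct.map f) (TensorProduct.map LinearMap.id
          (PiTensorProduct.map fun i => spread C V 0 0 (n i)) z) := by
  induction z using TensorProduct.induction_on with
  | zero => simp
  | add a b ha hb => simp only [map_add, ha, hb, Finset.sum_add_distrib]
  | tmul c t =>
    simp only [TensorProduct.map_tmul, map_comp_sum_spread, TensorProduct.tmul_sum,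
      LinearMap.id_apply]

theorem map_map_comp_symmetrize {k : ℕ} (ψ : C.obj k →ₗ[R] Y) (f : Fin k → Words C V 0 →ₗ[R] X)
    (A : ℕ) (z : C.obj k ⊗[R] (⨂[R]^k (Words C V 0))) :
    TensorProduct.map ψ (PiTensorProduct.map fun i => f i ∘ₗ symmetrize C V A) z =
      ∑ n ∈ Fintype.piFinset fun _ : Fin k => Finset.range A,
        TensorProduct.map ψ (PiTensorProduct.map f) (TensorProduct.map LinearMap.id
          (PiTensorProduct.map fun i => spread C V 0 0 (n i)) z) :=
  map_map_comp_sum_spread C V ψ f (fun _ => Finset.range A) z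

/-- Multiplication by the exponential is a morphism of coalgebras, up to symmetrization. -/
theorem map_coproduct_expWord {e : ∀ n, C.obj n} (he : C.IsSymmetrizing e) {v : V.carrier}
    (hv : v ∈ V.deg 0) {k A K : ℕ} (hA : A ≤ K) (hK : k * A < K) (ψ : C.obj k →ₗ[R] Y)
    (f : Fin k → Words C V 0 →ₗ[R] X) (x : Words C V 0) :
    TensorProduct.map ψ (PiTensorProduct.map fun i => f i ∘ₗ symmetrize C V A)
        (coproduct C V k (starWords C V (expWord C V e v K) x)) =
      TensorProduct.map ψ (PiTensorProduct.map fun i => f i ∘ₗ symmetrize C V A ∘ₗ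
        starWords C V (expWord C V e v K)) (coproduct C V k x) := by
  have h1 : ∀ z : C.obj k ⊗[R] (⨂[R]^k (Words C V 0)),
      TensorProduct.map ψ (PiTensorProduct.map fun i => f i ∘ₗ symmetrize C V A ∘ₗ
        starWords C V (expWord C V e v K)) z =
      TensorProduct.map ψ (PiTensorProduct.map fun i => f i ∘ₗ symmetrize C V A)
        (TensorProduct.map LinearMap.id (PiTensorProduct.map fun _ =>
          starWords C V (expWord C V e v K)) z) := by
    intro z
    rw [← LinearMap.comp_apply (TensorProduct.map ψ _), ← TensorProduct.map_comp,
      ← PiTensorProduct.map_comp]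
    rfl
  rw [h1, map_map_comp_symmetrize, map_map_comp_symmetrize]
  refine Finset.sum_congr rfl fun n hn => ?_
  congr 1
  have hn' : ∀ i, n i < A := fun i => Finset.mem_range.mp (Fintype.mem_piFinset.mp hn i)
  obtain ⟨E, hE⟩ := exists_coproduct_spread C V k n
  -- Each of the `k` factors is symmetrized in arity below `A`, so the total arity stays in the
  -- range where the truncated exponential acts correctly.
  have hsum : ∑ i, n i < K := by
    refine lt_of_le_of_lt ?_ hK
    have := Finset.sum_le_card_nsmul Finset.univ n A fun i _ => (hn' i).le
    simpa using this
  -- The formula `E` serves both decorations: with `0` for the product with the exponential, with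
  -- `v` for `x`. Both sides become `E` of `x` spread by `v`.
  have h2 : (fun i => spread C V 0 v (n i)) = fun i => spread C V 0 0 (n i) ∘ₗ
      starWords C V (expWord C V e v K) := by
    funext i
    exact LinearMap.ext fun y =>
      (spread_starWords_expWord C V he hv ((hn' i).trans_le hA) y).symm
  rw [hE 0 (zero_mem _), spread_starWords_expWord C V he hv hsum, ← hE v hv, h2,
    PiTensorProduct.map_comp, ← LinearMap.id_comp (LinearMap.id : C.obj k →ₗ[R] C.obj k),
    TensorProduct.map_comp]
  rfl

theorem map_coproduct_eq_zero {k : ℕ} (n : Fin k → ℕ) {x : Words C V 0}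
    (hx : spread C V 0 0 (∑ i, n i) x = 0) :
    TensorProduct.map LinearMap.id (PiTensorProduct.map fun i => spread C V 0 0 (n i))
      (coproduct C V k x) = 0 := by
  obtain ⟨E, hE⟩ := exists_coproduct_spread C V k n
  rw [hE 0 (zero_mem _), hx, map_zero]

end Coproduct

end ExpWord

/-! ### Congruences of multilinear maps -/

section Congruence

variable {R : Type u} [CommRing R]

theorem multilinear_sub_mem {k : ℕ} {X Y : Type*} [AddCommMonoid X] [Module R X]
    [AddCommGroup Y] [Module R Y] (F : MultilinearMap R (fun _ : Fin k => X) Y)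
    (T : Submodule R Y) {a b s : Fin k → X} (hs : ∀ j, a j = b j + s j)
    (h : ∀ j (x : Fin k → X), x j = s j → F x ∈ T) :
    F a - F b ∈ T := by
  classical
  suffices ht : ∀ t : Finset (Fin k), F (t.piecewise a b) - F b ∈ T by
    simpa using ht Finset.univ
  intro t
  induction t using Finset.induction_on with
  | empty => simp
  | insert j t hj ih =>
    have h2 : Function.update (t.piecewise a b) j (b j) = t.piecewise a b := by
      rw [Function.update_eq_self_iff, Finset.piecewise_eq_of_notMem _ _ _ hj]
    rw [Finset.piecewise_insert, hs, F.map_update_add, h2, add_sub_right_comm]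
    exact add_mem ih (h j _ (Function.update_self ..))

theorem map_sub_map_mem {k : ℕ} {A B M X : Type*} [AddCommMonoid A] [Module R A]
    [AddCommGroup B] [Module R B] [AddCommMonoid M] [Module R M] [AddCommMonoid X] [Module R X]
    (ψ : A →ₗ[R] B) (f g : Fin k → M →ₗ[R] X) (T : Submodule R (B ⊗[R] (⨂[R]^k X)))
    (S : Fin k → X → Prop) (hS : ∀ j m, ∃ s, S j s ∧ f j m = g j m + s)
    (h : ∀ (c : B) (j : Fin k) (x : Fin k → X), S j (x j) → c ⊗ₜ PiTensorProduct.tprod R x ∈ T)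
    (z : A ⊗[R] (⨂[R]^k M)) :
    TensorProduct.map ψ (PiTensorProduct.map f) z -
      TensorProduct.map ψ (PiTensorProduct.map g) z ∈ T := by
  induction z using TensorProduct.induction_on with
  | zero => simp
  | add a b ha hb =>
    rw [map_add, map_add, add_sub_add_comm]
    exact add_mem ha hb
  | tmul c t =>
    induction t using PiTensorProduct.induction_on with
    | add a b ha hb =>
      rw [TensorProduct.tmul_add, map_add, map_add, add_sub_add_comm]
      exact add_mem ha hb
    | smul_tprod r m =>
      rw [TensorProduct.tmul_smul, map_smul, map_smul, ← smul_sub]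
      refine Submodule.smul_mem _ _ ?_
      rw [TensorProduct.map_tmul, TensorProduct.map_tmul, PiTensorProduct.map_tprod,
        PiTensorProduct.map_tprod]
      choose s hs hs' using fun j => hS j (m j)
      exact multilinear_sub_mem ((TensorProduct.mk R B _ (ψ c)).compMultilinearMap
        (PiTensorProduct.tprod R)) T hs' fun j x hx => h (ψ c) j x (hx ▸ hs j)

end Congruence

/-! ### The filtration of the completed cofree coalgebra -/

theorem completionMap₂_eq {R : Type u} [CommRing R] {M : Type v} [AddCommGroup M] [Module R M]
    (G : ℕ → Submodule R M) (f : M →ₗ[R] M →ₗ[R] M)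
    (hl : ∀ N, ∀ x ∈ G N, ∀ y, f x y ∈ G N) (hr : ∀ N x, ∀ y ∈ G N, f x y ∈ G N)
    {x x' : completion G} {N : ℕ} {e e' : M} (h : x.1 N = Submodule.Quotient.mk e)
    (h' : x'.1 N = Submodule.Quotient.mk e') :
    (completionMap₂ G f hl hr x x').1 N = Submodule.Quotient.mk (f e e') := by
  delta completionMap₂
  dsimp only [LinearMap.mk₂_apply]
  rw [h, h']
  rfl

section Filtration

variable {R : Type u} [CommRing R] (C : HopfCooperad.{u, w} R) (V : CompleteGradedModule.{u, v} R)

theorem wordFil_antitone : Antitone (wordFil C V) := by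
  intro m n h
  refine Submodule.span_mono ?_
  rintro _ ⟨l, c, x, w, hw, hN, rfl⟩
  exact ⟨l, c, x, w, hw, h.trans hN, rfl⟩

theorem fil_antitone : Antitone (fil C V) := fun _ _ h =>
  sup_le_sup_left (wordFil_antitone C V h) _

theorem mem_wordFil_zero (x : Words C V 0) : x ∈ wordFil C V 0 := by
  induction x using words_induction_lof C V with
  | h0 => exact zero_mem _
  | hadd a b ha hb => exact add_mem ha hb
  | h n z => exact lof_mem_wordFil C V (Nat.zero_le n) z

/-- The filtration of the completed cofree coalgebra. -/
def cofreeFil (N : ℕ) : Submodule R (Cofree C V) :=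
  LinearMap.ker (LinearMap.proj N ∘ₗ (completion (fil C V)).subtype)

variable {C V}

theorem represents_iff {N : ℕ} {e : Words C V 0} {x : Cofree C V} :
    Represents N e x ↔ x - toCofree C V e ∈ cofreeFil C V N :=
  (sub_eq_zero (a := x.1 N) (b := Submodule.Quotient.mk e)).symm

theorem represents_toCofree (N : ℕ) (e : Words C V 0) : Represents N e (toCofree C V e) := rfl

theorem toCofree_mem {N : ℕ} {e : Words C V 0} :
    toCofree C V e ∈ cofreeFil C V N ↔ e ∈ fil C V N :=
  Submodule.Quotient.mk_eq_zero (fil C V N)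

theorem exists_represents (N : ℕ) (x : Cofree C V) : ∃ e, Represents N e x :=
  (Submodule.Quotient.mk_surjective (fil C V N) (x.1 N)).imp fun _ h => h.symm

theorem Represents.mono {m n : ℕ} (h : m ≤ n) {e : Words C V 0} {x : Cofree C V}
    (hx : Represents n e x) : Represents m e x := by
  obtain ⟨e', h1, h2⟩ := x.2 m n h
  refine h1.symm.trans ((Submodule.Quotient.eq _).mpr (fil_antitone C V h ?_))
  exact (Submodule.Quotient.eq _).mp (h2.trans hx)

theorem Represents.sub_mem {N : ℕ} {e e' : Words C V 0} {x : Cofree C V}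
    (h : Represents N e x) (h' : Represents N e' x) : e - e' ∈ fil C V N :=
  (Submodule.Quotient.eq _).mp (h.symm.trans h')

theorem Represents.congr {N : ℕ} {e e' : Words C V 0} {x : Cofree C V}
    (h : Represents N e x) (h' : e - e' ∈ fil C V N) : Represents N e' x :=
  h.trans ((Submodule.Quotient.eq _).mpr h')

theorem Represents.eq {x y : Cofree C V}
    (h : ∀ N, ∃ e, Represents N e x ∧ Represents N e y) : x = y :=
  Subtype.ext (funext fun N => by
    obtain ⟨e, h1, h2⟩ := h N
    exact h1.trans h2.symm)

theorem Represents.add {N : ℕ} {e e' : Words C V 0} {x x' : Cofree C V}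
    (h : Represents N e x) (h' : Represents N e' x') : Represents N (e + e') (x + x') :=
  congrArg₂ (· + ·) h h'

theorem Represents.smul {N : ℕ} (r : R) {e : Words C V 0} {x : Cofree C V}
    (h : Represents N e x) : Represents N (r • e) (r • x) :=
  congrArg (r • ·) h

theorem represents_star {N : ℕ} {e e' : Words C V 0} {x x' : Cofree C V}
    (h : Represents N e x) (h' : Represents N e' x') :
    Represents N (starWords C V e e') (star C V x x') :=
  completionMap₂_eq _ _ _ _ h h'

theorem mem_cofreeFil_zero (x : Cofree C V) : x ∈ cofreeFil C V 0 := by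
  obtain ⟨e, he⟩ := exists_represents 0 x
  exact he.congr (by
    rw [sub_zero]
    exact Submodule.mem_sup_right (mem_wordFil_zero C V e))

theorem tprod_mem_tensorFil {k N : ℕ} (c : C.obj k) (x : Fin k → Cofree C V) (j : Fin k)
    (hx : x j ∈ cofreeFil C V N) : c ⊗ₜ PiTensorProduct.tprod R x ∈ tensorFil C V k N := by
  classical
  refine Submodule.subset_span ⟨c, x, Pi.single j N, fun i => ?_, by simp, rfl⟩
  rcases eq_or_ne i j with rfl | h
  · rw [Pi.single_eq_same]
    exact hx
  · rw [Pi.single_eq_of_ne h]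
    exact mem_cofreeFil_zero (x i)

/-- Maps from words to the completed cofree coalgebra that preserve the filtrations. -/
def IsFiltered (f : Words C V 0 →ₗ[R] Cofree C V) : Prop :=
  ∀ N, ∀ e ∈ fil C V N, f e ∈ cofreeFil C V N

theorem isFiltered_toCofree : IsFiltered (toCofree C V) := fun _ _ he => toCofree_mem.mpr he

theorem IsFiltered.sub_mem {f : Words C V 0 →ₗ[R] Cofree C V} (hf : IsFiltered f) {N : ℕ}
    {e e' : Words C V 0} (h : e - e' ∈ fil C V N) : f e - f e' ∈ cofreeFil C V N := by
  have h1 := hf N _ h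
  rwa [show f (e - e') = f e - f e' from map_sub f e e'] at h1

theorem map_sub_map_mem_tensorFil {k N : ℕ} {A : Type*} [AddCommMonoid A] [Module R A]
    (ψ : A →ₗ[R] C.obj k) {f g : Fin k → Words C V 0 →ₗ[R] Cofree C V}
    (h : ∀ i e, f i e - g i e ∈ cofreeFil C V N) (z : A ⊗[R] (⨂[R]^k (Words C V 0))) :
    TensorProduct.map ψ (PiTensorProduct.map f) z -
      TensorProduct.map ψ (PiTensorProduct.map g) z ∈ tensorFil C V k N :=
  map_sub_map_mem ψ f g _ (fun _ x => x ∈ cofreeFil C V N)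
    (fun j m => ⟨f j m - g j m, h j m, (add_sub_cancel (g j m) (f j m)).symm⟩)
    (fun c j x hx => tprod_mem_tensorFil c x j hx) z

variable {π : ∀ n, C.obj n →ₗ[R] C.obj n}

/-- The coproduct descends to the completion. For the coinvariance relations every factor is
replaced by its averaged norm; the coproduct with spread factors depends only on the norm of the
word, which vanishes. The weight filtration is handled by `coproduct_mem`. -/
theorem map_coproduct_mem_tensorFil (hπ : C.IsAveraging π) {k N : ℕ} (ψ : C.obj k →ₗ[R] C.obj k)
    {f : Fin k → Words C V 0 →ₗ[R] Cofree C V} (hf : ∀ i, IsFiltered (f i)) {e : Words C V 0}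
    (he : e ∈ fil C V N) :
    TensorProduct.map ψ (PiTensorProduct.map f) (coproduct C V k e) ∈ tensorFil C V k N := by
  obtain ⟨a, ha, b, hb, rfl⟩ := Submodule.mem_sup.mp he
  rw [map_add, map_add]
  refine add_mem ?_ ?_
  · have h1 := map_sub_map_mem_tensorFil (N := N) ψ (f := f)
      (g := fun i => (f i ∘ₗ averageWords C V π) ∘ₗ symmetrize C V N)
      (fun i e => (hf i).sub_mem (sub_symmetrize_mem C V hπ N e)) (coproduct C V k a)
    rw [map_map_comp_symmetrize, Finset.sum_eq_zero, sub_zero] at h1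
    · exact h1
    · intro n _
      rw [map_coproduct_eq_zero C V n (spread_coinvRel C V _ ha), map_zero]
  · have h2 := coproduct_mem C V k N hb
    suffices h : rootFil C V k N ≤ (tensorFil C V k N).comap
        (TensorProduct.map ψ (PiTensorProduct.map f)) from h h2
    refine Submodule.span_le.mpr ?_
    rintro _ ⟨c, x, w, hx, hN, rfl⟩
    refine Submodule.subset_span ⟨ψ c, fun i => f i (x i), w, fun i => ?_, hN, ?_⟩
    · exact hf i _ _ (Submodule.mem_sup_right (hx i))
    · rw [TensorProduct.map_tmul, PiTensorProduct.map_tprod]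

/-- Multiplication by the exponential is a morphism of coalgebras. -/
theorem map_coproduct_expWord_sub_mem (hπ : C.IsAveraging π) {e : ∀ n, C.obj n}
    (he : C.IsSymmetrizing e) {v : V.carrier} (hv : v ∈ V.deg 0) {k N K : ℕ} (hN : N ≤ K)
    (hK : k * N < K) (ψ : C.obj k →ₗ[R] C.obj k)
    {f : Fin k → Words C V 0 →ₗ[R] Cofree C V} (hf : ∀ i, IsFiltered (f i)) (x : Words C V 0) :
    TensorProduct.map ψ (PiTensorProduct.map f)
        (coproduct C V k (starWords C V (expWord C V e v K) x)) -
      TensorProduct.map ψ (PiTensorProduct.map fun i => f i ∘ₗ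
        starWords C V (expWord C V e v K)) (coproduct C V k x) ∈ tensorFil C V k N := by
  have h1 := map_sub_map_mem_tensorFil (N := N) ψ (f := f)
    (g := fun i => (f i ∘ₗ averageWords C V π) ∘ₗ symmetrize C V N)
    (fun i e => (hf i).sub_mem (sub_symmetrize_mem C V hπ N e))
    (coproduct C V k (starWords C V (expWord C V e v K) x))
  have h2 := map_sub_map_mem_tensorFil (N := N) ψ
    (f := fun i => f i ∘ₗ starWords C V (expWord C V e v K))
    (g := fun i => (f i ∘ₗ averageWords C V π) ∘ₗ symmetrize C V N ∘ₗ
      starWords C V (expWord C V e v K))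
    (fun i z => (hf i).sub_mem (sub_symmetrize_mem C V hπ N _)) (coproduct C V k x)
  rw [map_coproduct_expWord C V he hv hN hK] at h1
  simpa using sub_mem h1 h2

end Filtration

/-! ### The coproduct of the unit -/

section UnitWord

variable {R : Type u} [CommRing R] (C : HopfCooperad.{u, w} R) (V : CompleteGradedModule.{u, v} R)

/-- The unit of the Hopf cooperad without decorated inputs. -/
def unitWord (p : ℕ) : Words C V p :=
  DirectSum.lof R ℕ (Cell C V p) 0 ((1 : C.obj (0 + p)) ⊗ₜ PiTensorProduct.tprod R Fin.elim0)

theorem peel_unitWord (p : ℕ) :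
    peel C V p (unitWord C V p) = unitWord C V (p + 1) ⊗ₜ unitWord C V 0 := by
  have h : ∀ (a b : ℕ) (e : Fin 0 ≃ Fin (a + b)), a = 0 → b = 0 →
      TensorProduct.map (DirectSum.lof R ℕ (Cell C V (p + 1)) a)
        (DirectSum.lof R ℕ (Cell C V 0) b)
        (deconcatCell C V p a b (act C V p e
          ((1 : C.obj (0 + p)) ⊗ₜ PiTensorProduct.tprod R Fin.elim0))) =
      unitWord C V (p + 1) ⊗ₜ unitWord C V 0 := by
    rintro a b e rfl rfl
    have he : e = Equiv.refl (Fin 0) := Subsingleton.elim _ _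
    have h1 : (TensorPower.mulEquiv (n := 0) (m := 0)).symm
        (PiTensorProduct.tprod R (Fin.elim0 : Fin 0 → V.carrier)) =
        PiTensorProduct.tprod R Fin.elim0 ⊗ₜ[R] PiTensorProduct.tprod R Fin.elim0 := by
      rw [LinearEquiv.symm_apply_eq, mulEquiv_tprod]
      exact congrArg _ (Subsingleton.elim _ _)
    have h2 : parityPart (C.deg 0) false (1 : C.obj 0) = 1 :=
      parityPart_false_of_mem _ (SetLike.GradedOne.one_mem)
    have h3 : parityPart (C.deg 0) true (1 : C.obj 0) = 0 := by
      have := parityPart_false_add_true (C.deg 0) 1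
      rwa [h2, add_eq_left] at this
    have h4 : act C V p e ((1 : C.obj (0 + p)) ⊗ₜ PiTensorProduct.tprod R Fin.elim0) =
        (1 : C.obj (0 + p)) ⊗ₜ PiTensorProduct.tprod R Fin.elim0 := by
      rw [act, TensorProduct.map_tmul, he, signedReindex_refl, AlgHom.toLinearMap_apply, map_one]
    have h5 : deconcatCell C V p 0 0 ((1 : C.obj (0 + p)) ⊗ₜ PiTensorProduct.tprod R Fin.elim0) =
        ((1 : C.obj (0 + (p + 1))) ⊗ₜ PiTensorProduct.tprod R Fin.elim0) ⊗ₜ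
          ((1 : C.obj 0) ⊗ₜ PiTensorProduct.tprod R Fin.elim0) := by
      rw [deconcatCell, LinearMap.comp_apply, TensorProduct.map_tmul, LinearMap.comp_apply,
        AlgHom.toLinearMap_apply, map_one, C.partialDecomp_one, LinearEquiv.coe_coe, h1,
        distribute, LinearMap.comp_apply, LinearMap.add_apply, TensorProduct.map_tmul,
        TensorProduct.map_tmul, TensorProduct.map_tmul, TensorProduct.map_tmul, h2, h3,
        TensorProduct.tmul_zero, TensorProduct.zero_tmul]
      exact (congrArg _ (add_zero _)).trans rfl
    refine (congrArg (fun y => TensorProduct.map (DirectSum.lof R ℕ (Cell C V (p + 1)) 0)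
        (DirectSum.lof R ℕ (Cell C V 0) 0) (deconcatCell C V p 0 0 y)) h4).trans ?_
    rw [h5]
    rfl
  rw [unitWord, peel_lof]
  exact (Fintype.sum_unique _).trans (h _ _ _ rfl rfl)

/-- The decompositions preserve units, so `𝟙` is grouplike. Multiplication by the exponential then
carries this property to the exponential itself. -/
theorem coproduct_unitWord (k : ℕ) : coproduct C V k (unitWord C V 0) =
    (1 : C.obj k) ⊗ₜ PiTensorProduct.tprod R fun _ => unitWord C V 0 := by
  have h : iterPeel C V k (unitWord C V 0) =
      unitWord C V k ⊗ₜ PiTensorProduct.tprod R fun _ => unitWord C V 0 := by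
    induction k with
    | zero =>
      change unitWord C V 0 ⊗ₜ PiTensorProduct.tprod R Fin.elim0 = _
      rw [Subsingleton.elim (Fin.elim0 : Fin 0 → Words C V 0) fun _ => unitWord C V 0]
    | succ k ih =>
      rw [iterPeel, LinearMap.comp_apply, LinearMap.comp_apply, LinearMap.comp_apply, ih,
        TensorProduct.map_tmul, peel_unitWord, LinearMap.id_apply, LinearEquiv.coe_coe,
        TensorProduct.assoc_tmul, TensorProduct.map_tmul, consTensor_tprod, LinearMap.id_apply]
      congr 2
      funext i
      refine Fin.cases rfl (fun _ => rfl) i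
  have h1 : rootPart C V k (unitWord C V k) = 1 := by
    have h2 := DirectSum.component.lof_self R (ι := ℕ) (M := Cell C V k) 0
      ((1 : C.obj (0 + k)) ⊗ₜ PiTensorProduct.tprod R Fin.elim0)
    have h3 := congrArg (fun z : C.obj (0 + k) ⊗[R] (⨂[R]^0 V.carrier) =>
      C.map ((finCongr (Nat.zero_add k)).trans Fin.revPerm)
        (TensorProduct.rid R (C.obj (0 + k)) (TensorProduct.map LinearMap.id
          (PiTensorProduct.isEmptyEquiv (Fin 0)).toLinearMap z))) h2
    refine Eq.trans h3 ?_
    simp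
  rw [coproduct, LinearMap.comp_apply, h, TensorProduct.map_tmul, h1, LinearMap.id_apply]

end UnitWord

/-! ### The exponential -/

section Exponential

variable {R : Type u} [CommRing R] (C : HopfCooperad.{u, w} R) (V : CompleteGradedModule.{u, v} R)

theorem unitCoeff_spread {v : V.carrier} (hv : v ∈ V.deg 0) (x : Words C V 0) :
    unitCoeff C V (spread C V 0 v 0 x) = unitCoeff C V x := by
  induction x using words_induction_lof C V with
  | h0 => simp
  | hadd a b ha hb => simp only [map_add, ha, hb]
  | h n z =>
    match n with
    | 0 =>
      have h4 : ∀ j : Fin 0 ↪ Fin 0, j = Function.Embedding.refl _ :=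
        fun j => Function.Embedding.ext fun _ => Subsingleton.elim _ _
      rw [spread_lof, Finset.sum_eq_single (Function.Embedding.refl _)
        (fun j _ hj => absurd (h4 j) hj) (fun h => absurd (Finset.mem_univ _) h),
        extCell_refl C V hv]
    | n + 1 =>
      rw [spread_lof_of_lt C V 0 v (by omega), unitCoeff_lof_of_ne C V (by omega), map_zero]

theorem map_spread_zero_eq_zero {m : ℕ} (x : Words C V 0) {X : Type*}
    [AddCommMonoid X] [Module R X] (f : Words C V 0 →ₗ[R] X)
    (hf : ∀ z, f (DirectSum.lof R ℕ (Cell C V 0) m z) = 0) :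
    f (spread C V 0 0 m x) = 0 := by
  induction x using words_induction_lof C V with
  | h0 => simp
  | hadd a b ha hb => simp only [map_add, ha, hb, add_zero]
  | h l z =>
    rw [spread_lof, map_sum]
    exact Finset.sum_eq_zero fun j _ => hf _

/-- `tangent` sees arity one and `unitCoeff` arity zero, where the symmetric groups are trivial.
Truncation at `2` loses nothing. -/
theorem tangent_symmetrize (x : Words C V 0) :
    tangent C V (symmetrize C V 2 x) = tangent C V x := by
  have h0 : tangent C V (spread C V 0 0 0 x) = 0 :=
    map_spread_zero_eq_zero C V x _ (tangent_lof_of_ne C V Nat.zero_ne_one)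
  have h1 := tangent_spread C V (zero_mem (V.deg 0)) x
  rw [smul_zero] at h1
  rw [symmetrize, Finset.sum_range_succ, Finset.sum_range_one, LinearMap.add_apply, map_add, h0, h1]
  simp

theorem unitCoeff_symmetrize (x : Words C V 0) :
    unitCoeff C V (symmetrize C V 2 x) = unitCoeff C V x := by
  have h1 : unitCoeff C V (spread C V 0 0 1 x) = 0 :=
    map_spread_zero_eq_zero C V x _ (unitCoeff_lof_of_ne C V Nat.one_ne_zero)
  rw [symmetrize, Finset.sum_range_succ, Finset.sum_range_one, LinearMap.add_apply, map_add, h1,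
    unitCoeff_spread C V (zero_mem _), add_zero]

variable {e : ∀ n, C.obj n}

theorem tangent_starWords_expWord (he : C.IsSymmetrizing e) {v : V.carrier} (hv : v ∈ V.deg 0)
    {K : ℕ} (hK : 1 < K) (x : Words C V 0) :
    tangent C V (starWords C V (expWord C V e v K) x) = tangent C V x + unitCoeff C V x • v := by
  have h1 := tangent_spread C V (zero_mem (V.deg 0)) (starWords C V (expWord C V e v K) x)
  rw [spread_starWords_expWord C V he hv hK, tangent_spread C V hv, smul_zero] at h1
  rw [h1]
  simp

theorem unitCoeff_starWords_expWord (he : C.IsSymmetrizing e) {v : V.carrier} (hv : v ∈ V.deg 0)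
    {K : ℕ} (hK : 0 < K) (x : Words C V 0) :
    unitCoeff C V (starWords C V (expWord C V e v K) x) = unitCoeff C V x := by
  rw [← unitCoeff_spread C V (zero_mem (V.deg 0)), spread_starWords_expWord C V he hv hK,
    unitCoeff_spread C V hv]

/-- The projection to the cogenerators, twisted by `v`. -/
def shiftedTangent (v : V.carrier) : Words C V 0 →ₗ[R] V.carrier :=
  tangent C V + (unitCoeff C V).smulRight v

theorem shiftedTangent_apply (v : V.carrier) (x : Words C V 0) :
    shiftedTangent C V v x = tangent C V x + unitCoeff C V x • v := rfl

theorem shiftedTangent_zero : shiftedTangent C V 0 = tangent C V := by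
  refine LinearMap.ext fun x => ?_
  rw [shiftedTangent_apply, smul_zero]
  exact add_zero _

theorem shiftedTangent_comp_symmetrize (v : V.carrier) :
    shiftedTangent C V v ∘ₗ symmetrize C V 2 = shiftedTangent C V v :=
  LinearMap.ext fun x => by
    rw [LinearMap.comp_apply, shiftedTangent_apply, tangent_symmetrize, unitCoeff_symmetrize,
      shiftedTangent_apply]

/-- Here the addition law of the exponential arises: on cogenerators, multiplication by the
exponential of `v` adds `v` times the coefficient of `𝟙` and leaves that coefficient alone, so
successive shifts add. -/
theorem shiftedTangent_comp_starWords_expWord (he : C.IsSymmetrizing e) {v : V.carrier}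
    (hv : v ∈ V.deg 0) (w : V.carrier) {K : ℕ} (hK : 1 < K) :
    shiftedTangent C V w ∘ₗ starWords C V (expWord C V e v K) = shiftedTangent C V (v + w) :=
  LinearMap.ext fun x => by
    rw [LinearMap.comp_apply, shiftedTangent_apply, tangent_starWords_expWord C V he hv hK,
      unitCoeff_starWords_expWord C V he hv (by omega), shiftedTangent_apply, smul_add]
    exact add_assoc _ _ _

theorem map_shiftedTangent_coproduct (he : C.IsSymmetrizing e) {v : V.carrier} (hv : v ∈ V.deg 0)
    (w : V.carrier) {k K : ℕ} (hK : 1 < K) (hK' : k * 2 < K) (x : Words C V 0) :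
    TensorProduct.map LinearMap.id (PiTensorProduct.map fun _ => shiftedTangent C V w)
        (coproduct C V k (starWords C V (expWord C V e v K) x)) =
      TensorProduct.map LinearMap.id (PiTensorProduct.map fun _ => shiftedTangent C V (v + w))
        (coproduct C V k x) := by
  -- The maps applied to the factors see only arities `0` and `1`, so the general statement is
  -- needed for `A = 2` only.
  have h := map_coproduct_expWord C V he hv (A := 2) hK hK' (LinearMap.id : C.obj k →ₗ[R] C.obj k)
    (fun _ => shiftedTangent C V w) x
  simp only [← LinearMap.comp_assoc, shiftedTangent_comp_symmetrize,
    shiftedTangent_comp_starWords_expWord C V he hv w hK] at h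
  exact h

/-- Both sides have the same cogenerator parts in all factors of their coproducts, namely those of
`x` shifted by `v + w`, and norms are reassembled from these. -/
theorem spread_starWords_starWords (he : C.IsSymmetrizing e) {v w : V.carrier} (hv : v ∈ V.deg 0)
    (hw : w ∈ V.deg 0) {k K : ℕ} (hK : 1 < K) (hK' : k * 2 < K) (x : Words C V 0) :
    spread C V 0 0 k (starWords C V (expWord C V e v K)
        (starWords C V (expWord C V e w K) x)) =
      spread C V 0 0 k (starWords C V (expWord C V e (v + w) K) x) := by
  obtain ⟨S, -, hS⟩ := exists_reassemble C V k
  rw [← hS, ← hS, ← shiftedTangent_zero, map_shiftedTangent_coproduct C V he hv _ hK hK',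
    map_shiftedTangent_coproduct C V he hw _ hK hK',
    map_shiftedTangent_coproduct C V he (add_mem hv hw) _ hK hK', add_zero, add_zero, add_comm w v]

theorem sub_mem_fil_of_spread {π : ∀ n, C.obj n →ₗ[R] C.obj n} (hπ : C.IsAveraging π) {N : ℕ}
    {x y : Words C V 0} (h : ∀ n < N, spread C V 0 0 n x = spread C V 0 0 n y) :
    x - y ∈ fil C V N := by
  have h1 : symmetrize C V N x = symmetrize C V N y := by
    rw [symmetrize, LinearMap.sum_apply, LinearMap.sum_apply]
    exact Finset.sum_congr rfl fun n hn => h n (Finset.mem_range.mp hn)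
  have h2 := sub_mem (sub_symmetrize_mem C V hπ N x) (sub_symmetrize_mem C V hπ N y)
  rwa [h1, sub_sub_sub_cancel_right] at h2

theorem expWord_sub_mem (e : ∀ n, C.obj n) (v : V.carrier) {N K : ℕ} (h : N ≤ K) :
    expWord C V e v K - expWord C V e v N ∈ wordFil C V N := by
  rw [expWord, expWord, ← Finset.sum_Ico_eq_sub _ h]
  exact Submodule.sum_mem _ fun n hn => lof_mem_wordFil C V (Finset.mem_Ico.mp hn).1 _

/-- The exponential of `v`. -/
def expElement (e : ∀ n, C.obj n) (v : V.carrier) : Cofree C V :=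
  ⟨fun N => Submodule.Quotient.mk (expWord C V e v N), fun _ n h =>
    ⟨expWord C V e v n, (Submodule.Quotient.eq _).mpr
      (Submodule.mem_sup_right (expWord_sub_mem C V e v h)), rfl⟩⟩

theorem represents_expElement (e : ∀ n, C.obj n) (v : V.carrier) {N K : ℕ} (h : N ≤ K) :
    Represents N (expWord C V e v K) (expElement C V e v) :=
  ((Submodule.Quotient.eq _).mpr (Submodule.mem_sup_right (expWord_sub_mem C V e v h))).symm

theorem starWords_expWord_unitWord (e : ∀ n, C.obj n) {v : V.carrier} (hv : v ∈ V.deg 0) (K : ℕ) :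
    starWords C V (expWord C V e v K) (unitWord C V 0) = expWord C V e v K := by
  rw [expWord, map_sum, LinearMap.sum_apply]
  refine Finset.sum_congr rfl fun n _ => ?_
  have h1 : C.addInputsLeft n 0 1 = 1 := by
    rw [HopfCooperad.addInputsLeft, LinearMap.comp_apply, C.addInputs_one,
      AlgHom.toLinearMap_apply, map_one]
  have h2 : TensorPower.mulEquiv ((PiTensorProduct.tprod R fun _ : Fin n => v) ⊗ₜ[R]
      PiTensorProduct.tprod R (Fin.elim0 : Fin 0 → V.carrier)) =
      PiTensorProduct.tprod R fun _ : Fin n => v := by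
    rw [mulEquiv_tprod]
    congr 1
    exact Fin.append_right_nil _ _ rfl
  have h3 : starCell C V n 0 (e n ⊗ₜ PiTensorProduct.tprod R fun _ => v)
      ((1 : C.obj 0) ⊗ₜ PiTensorProduct.tprod R Fin.elim0) =
      (e n : C.obj n) ⊗ₜ PiTensorProduct.tprod R fun _ => v := by
    rw [starCell_even C V hv, h1, mul_one, h2]
    rfl
  rw [unitWord]
  exact (starWords_lof C V n 0 _ _).trans (congrArg _ h3)

theorem star_expElement_unitElement (e : ∀ n, C.obj n) {v : V.carrier} (hv : v ∈ V.deg 0) :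
    star C V (expElement C V e v) (unitElement C V) = expElement C V e v :=
  Represents.eq fun N => ⟨expWord C V e v N, by
    have h := represents_star (represents_expElement C V e v (le_refl N))
      (represents_toCofree N (unitWord C V 0))
    rwa [starWords_expWord_unitWord C V e hv] at h, represents_expElement C V e v le_rfl⟩

variable {π : ∀ n, C.obj n →ₗ[R] C.obj n}

theorem star_expElement_star (hπ : C.IsAveraging π) (he : C.IsSymmetrizing e) {v w : V.carrier}
    (hv : v ∈ V.deg 0) (hw : w ∈ V.deg 0) (x : Cofree C V) :
    star C V (expElement C V e v) (star C V (expElement C V e w) x) =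
      star C V (expElement C V e (v + w)) x := by
  refine Represents.eq fun N => ?_
  obtain ⟨y, hy⟩ := exists_represents N x
  -- The length `2N + 2` exceeds `1` and `2n` for every `n < N`, as the comparison of cogenerator
  -- parts requires.
  have hK : N ≤ N * 2 + 2 := by omega
  refine ⟨_, represents_star (represents_expElement C V e v hK)
    (represents_star (represents_expElement C V e w hK) hy), ?_⟩
  refine (represents_star (represents_expElement C V e (v + w) hK) hy).congr ?_
  exact sub_mem_fil_of_spread C V hπ fun n hn =>
    (spread_starWords_starWords C V he hv hw (by omega) (by omega) y).symm

theorem star_expElement_zero (hπ : C.IsAveraging π) (he : C.IsSymmetrizing e) (x : Cofree C V) :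
    star C V (expElement C V e 0) x = x := by
  refine Represents.eq fun N => ?_
  obtain ⟨y, hy⟩ := exists_represents N x
  refine ⟨_, represents_star (represents_expElement C V e 0 (le_refl N)) hy, hy.congr ?_⟩
  exact sub_mem_fil_of_spread C V hπ fun n hn =>
    (spread_starWords_expWord C V he (zero_mem _) hn y).symm

theorem expElement_zero (hπ : C.IsAveraging π) (he : C.IsSymmetrizing e) :
    expElement C V e 0 = unitElement C V := by
  rw [← star_expElement_unitElement C V e (zero_mem _), star_expElement_zero C V hπ he]

theorem star_expElement_expElement (hπ : C.IsAveraging π) (he : C.IsSymmetrizing e)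
    {v w : V.carrier} (hv : v ∈ V.deg 0) (hw : w ∈ V.deg 0) :
    star C V (expElement C V e v) (expElement C V e w) = expElement C V e (v + w) := by
  rw [← star_expElement_unitElement C V e hw, star_expElement_star C V hπ he hv hw,
    star_expElement_unitElement C V e (add_mem hv hw)]

theorem hasDegree_expElement (he : C.IsSymmetrizing e) {v : V.carrier} (hv : v ∈ V.deg 0) :
    HasDegree 0 (expElement C V e v) := fun N =>
  ⟨expWord C V e v N, Submodule.sum_mem _ fun n _ => Submodule.subset_span
    ⟨n, 0, e n, fun _ => v, fun _ => 0, (he n).1, fun _ => hv, by simp, rfl⟩,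
    represents_expElement C V e v le_rfl⟩

/-- The exponential is grouplike. -/
theorem expElement_grouplike (hπ : C.IsAveraging π) (he : C.IsSymmetrizing e) {v : V.carrier}
    (hv : v ∈ V.deg 0) {k N : ℕ} {y : Words C V 0} (hy : Represents N y (expElement C V e v)) :
    tensorToCofree k (coproduct C V k y) - (1 : C.obj k) ⊗ₜ
      PiTensorProduct.tprod R (fun _ => expElement C V e v) ∈ tensorFil C V k N := by
  -- One truncation long enough both to represent the exponential modulo step `N` and to be
  -- compatible with `δ_k` on factors of arity below `N`.
  have hK : N ≤ k * N + N + 1 := by omega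
  have hE := represents_expElement C V e v hK
  have h1 := map_coproduct_mem_tensorFil hπ (LinearMap.id : C.obj k →ₗ[R] C.obj k)
    (fun _ : Fin k => isFiltered_toCofree) (hy.sub_mem hE)
  -- The grouplike element `𝟙` is transported by multiplication with the exponential.
  have h2 := map_coproduct_expWord_sub_mem hπ he hv hK (k := k) (by omega) LinearMap.id
    (fun _ : Fin k => isFiltered_toCofree) (unitWord C V 0)
  rw [map_sub, map_sub] at h1
  rw [starWords_expWord_unitWord C V e hv, coproduct_unitWord, TensorProduct.map_tmul,
    PiTensorProduct.map_tprod] at h2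
  simp only [LinearMap.comp_apply, starWords_expWord_unitWord C V e hv] at h2
  have h3 := multilinear_sub_mem ((TensorProduct.mk R (C.obj k) _ (1 : C.obj k)).compMultilinearMap
    (PiTensorProduct.tprod R (s := fun _ : Fin k => Cofree C V))) (tensorFil C V k N)
    (a := fun _ => expElement C V e v)
    (b := fun _ => toCofree C V (expWord C V e v (k * N + N + 1)))
    (s := fun _ => expElement C V e v - toCofree C V (expWord C V e v (k * N + N + 1)))
    (fun _ => (add_sub_cancel (toCofree C V (expWord C V e v (k * N + N + 1)))
      (expElement C V e v)).symm)
    (fun j x hx => tprod_mem_tensorFil 1 x j (hx ▸ represents_iff.mp hE))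
  have h4 := sub_mem (add_mem h1 h2) h3
  convert h4 using 1
  simp only [tensorToCofree, LinearMap.compMultilinearMap_apply, TensorProduct.mk_apply,
    LinearMap.id_apply]
  abel

end Exponential

/-! ### Recovering elements of the completion from the cogenerators -/

section Reassemble

variable {R : Type u} [CommRing R] (C : HopfCooperad.{u, w} R) (V : CompleteGradedModule.{u, v} R)

/-- The map sending a tensor of cogenerators to the corresponding word. -/
def reassemble (k : ℕ) : C.obj k ⊗[R] (⨂[R]^k V.carrier) →ₗ[R] Words C V 0 :=
  (exists_reassemble C V k).choose

theorem reassemble_mem {k N : ℕ} (c : C.obj k) {w : Fin k → ℕ} {x : Fin k → V.carrier}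
    (hx : ∀ i, x i ∈ V.F (w i)) (hN : N ≤ ∑ i, w i) :
    reassemble C V k (c ⊗ₜ PiTensorProduct.tprod R x) ∈ wordFil C V N :=
  wordFil_antitone C V hN ((exists_reassemble C V k).choose_spec.1 c w x hx)

theorem reassemble_coproduct (k : ℕ) (x : Words C V 0) :
    reassemble C V k (TensorProduct.map LinearMap.id
      (PiTensorProduct.map fun _ => tangent C V) (coproduct C V k x)) = spread C V 0 0 k x :=
  (exists_reassemble C V k).choose_spec.2 x

/-- On coinvariance relations `tangent` vanishes because it factors through spreading by `0` to
arity one. -/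
theorem tangent_mem {N : ℕ} {e : Words C V 0} (he : e ∈ fil C V N) : tangent C V e ∈ V.F N := by
  obtain ⟨a, ha, b, hb, rfl⟩ := Submodule.mem_sup.mp he
  rw [map_add]
  refine add_mem ?_ ?_
  · have h := tangent_spread C V (zero_mem (V.deg 0)) a
    rw [spread_coinvRel C V 1 ha, map_zero, smul_zero] at h
    have h' : tangent C V a = 0 := by simpa using h.symm
    rw [h']
    exact zero_mem _
  · suffices h : wordFil C V N ≤ (V.F N).comap (tangent C V) from h hb
    refine Submodule.span_le.mpr ?_
    rintro _ ⟨n, c, x, w, hw, hN, rfl⟩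
    rcases eq_or_ne n 1 with rfl | hn
    · have h1 := tangent_lof_one C V c x
      refine (congrArg (· ∈ V.F N) h1).mpr (Submodule.smul_mem _ _ (V.F_antitone ?_ (hw 0)))
      simpa using hN
    · refine (congrArg (· ∈ V.F N) (tangent_lof_of_ne C V hn _)).mpr (zero_mem _)

/-- Factors are exchanged one at a time: the changed factor contributes weight `N`, the others
weight zero. Hence reassembly makes sense on cogenerator parts known only modulo step `N`. -/
theorem reassemble_sub_mem {k N : ℕ} (c : C.obj k) {x y : Fin k → V.carrier}
    (h : ∀ i, x i - y i ∈ V.F N) :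
    reassemble C V k (c ⊗ₜ PiTensorProduct.tprod R x) -
      reassemble C V k (c ⊗ₜ PiTensorProduct.tprod R y) ∈ wordFil C V N := by
  classical
  refine multilinear_sub_mem ((reassemble C V k ∘ₗ TensorProduct.mk R (C.obj k) _
    c).compMultilinearMap (PiTensorProduct.tprod R)) (wordFil C V N)
    (s := fun i => x i - y i) (fun i => (add_sub_cancel (y i) (x i)).symm) fun j z hz => ?_
  refine reassemble_mem C V (w := Pi.single j N) c (fun i => ?_) (by simp)
  rcases eq_or_ne i j with rfl | hi
  · rw [Pi.single_eq_same, hz]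
    exact h i
  · rw [Pi.single_eq_of_ne hi]
    exact F_zero V _

/-- The cogenerator part of a representative modulo the `N`-th step of the filtration. -/
def tangentRep (N : ℕ) (x : Cofree C V) : V.carrier :=
  tangent C V (exists_represents N x).choose

variable {C V} in
theorem tangent_sub_tangentRep_mem {N : ℕ} {e : Words C V 0} {x : Cofree C V}
    (he : Represents N e x) : tangent C V e - tangentRep C V N x ∈ V.F N := by
  rw [tangentRep, ← map_sub]
  exact tangent_mem C V (he.sub_mem (exists_represents N x).choose_spec)

/-- `reassemble` on tensors of elements of the completed cofree coalgebra, with values modulo the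
`N`-th step of the filtration. -/
def reassembleMultilinear (k N : ℕ) (c : C.obj k) :
    MultilinearMap R (fun _ : Fin k => Cofree C V) (Words C V 0 ⧸ wordFil C V N) where
  toFun x := Submodule.Quotient.mk (reassemble C V k
    (c ⊗ₜ PiTensorProduct.tprod R fun i => tangentRep C V N (x i)))
  map_update_add' := by
    intro _ x i a b
    have h1 : ∀ z, (fun j => tangentRep C V N (Function.update x i z j)) =
        Function.update (fun j => tangentRep C V N (x j)) i (tangentRep C V N z) := fun z => by
      funext j
      exact Function.apply_update (fun _ => tangentRep C V N) x i z j
    rw [h1, h1, h1, ← Submodule.Quotient.mk_add, ← map_add, ← TensorProduct.tmul_add,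
      ← MultilinearMap.map_update_add, Submodule.Quotient.eq]
    refine reassemble_sub_mem C V c fun j => ?_
    rcases eq_or_ne j i with rfl | hj
    · rw [Function.update_self, Function.update_self, ← neg_mem_iff, neg_sub]
      have h := tangent_sub_tangentRep_mem
        ((exists_represents N a).choose_spec.add (exists_represents N b).choose_spec)
      rwa [map_add] at h
    · rw [Function.update_of_ne hj, Function.update_of_ne hj, sub_self]
      exact zero_mem _
  map_update_smul' := by
    intro _ x i r a
    have h1 : ∀ z, (fun j => tangentRep C V N (Function.update x i z j)) =
        Function.update (fun j => tangentRep C V N (x j)) i (tangentRep C V N z) := fun z => by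
      funext j
      exact Function.apply_update (fun _ => tangentRep C V N) x i z j
    rw [h1, h1, ← Submodule.Quotient.mk_smul, ← map_smul, ← TensorProduct.tmul_smul,
      ← MultilinearMap.map_update_smul, Submodule.Quotient.eq]
    refine reassemble_sub_mem C V c fun j => ?_
    rcases eq_or_ne j i with rfl | hj
    · rw [Function.update_self, Function.update_self, ← neg_mem_iff, neg_sub]
      have h := tangent_sub_tangentRep_mem ((exists_represents N a).choose_spec.smul r)
      rwa [map_smul] at h
    · rw [Function.update_of_ne hj, Function.update_of_ne hj, sub_self]
      exact zero_mem _

/-- `reassembleMultilinear` as a map on the tensor product. -/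
def reassembleCofree (k N : ℕ) :
    C.obj k ⊗[R] (⨂[R]^k (Cofree C V)) →ₗ[R] Words C V 0 ⧸ wordFil C V N :=
  TensorProduct.lift (PiTensorProduct.lift.toLinearMap ∘ₗ
    { toFun := reassembleMultilinear C V k N
      map_add' := fun c c' => MultilinearMap.ext fun x => by
        simp [reassembleMultilinear, TensorProduct.add_tmul]
      map_smul' := fun r c => MultilinearMap.ext fun x => by
        simp only [reassembleMultilinear, MultilinearMap.coe_mk, smul_apply,
          ← TensorProduct.smul_tmul', map_smul, Submodule.Quotient.mk_smul, RingHom.id_apply] })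

variable {C V}

theorem reassembleCofree_tprod (k N : ℕ) (c : C.obj k) (x : Fin k → Cofree C V) :
    reassembleCofree C V k N (c ⊗ₜ PiTensorProduct.tprod R x) =
      Submodule.Quotient.mk (reassemble C V k
        (c ⊗ₜ PiTensorProduct.tprod R fun i => tangentRep C V N (x i))) := by
  rw [reassembleCofree, TensorProduct.lift.tmul]
  exact PiTensorProduct.lift.tprod _

theorem reassembleCofree_eq {k N : ℕ} (c : C.obj k) {x : Fin k → Cofree C V}
    {y : Fin k → V.carrier}
    (h : ∀ i, ∃ e, Represents N e (x i) ∧ tangent C V e - y i ∈ V.F N) :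
    reassembleCofree C V k N (c ⊗ₜ PiTensorProduct.tprod R x) =
      Submodule.Quotient.mk (reassemble C V k (c ⊗ₜ PiTensorProduct.tprod R y)) := by
  rw [reassembleCofree_tprod, Submodule.Quotient.eq]
  refine reassemble_sub_mem C V c fun i => ?_
  obtain ⟨e, he, he'⟩ := h i
  have := sub_mem he' (tangent_sub_tangentRep_mem he)
  rwa [sub_sub_sub_cancel_left] at this

theorem reassembleCofree_eq_zero {k N : ℕ} {z : C.obj k ⊗[R] (⨂[R]^k (Cofree C V))}
    (hz : z ∈ tensorFil C V k N) : reassembleCofree C V k N z = 0 := by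
  suffices h : tensorFil C V k N ≤ LinearMap.ker (reassembleCofree C V k N) from h hz
  refine Submodule.span_le.mpr ?_
  rintro _ ⟨c, x, w, hx, hN, rfl⟩
  change reassembleCofree C V k N _ = 0
  rw [reassembleCofree_tprod, Submodule.Quotient.mk_eq_zero]
  -- The weights are capped at `N` because the chosen representatives are controlled only modulo
  -- step `N`. If some weight reaches `N`, its capped value alone suffices.
  refine reassemble_mem C V (w := fun i => min (w i) N) c (fun i => ?_) ?_
  · refine tangent_mem C V ?_
    have h1 := (exists_represents N (x i)).choose_spec.mono (min_le_right (w i) N)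
    have h2 : Represents (min (w i) N) 0 (x i) := Represents.mono (min_le_left _ _) (hx i)
    simpa using h1.sub_mem h2
  · by_cases h : ∃ i, N ≤ w i
    · obtain ⟨i, hi⟩ := h
      have := Finset.single_le_sum (f := fun i => min (w i) N) (fun _ _ => Nat.zero_le _)
        (Finset.mem_univ i)
      rwa [min_eq_right hi] at this
    · push Not at h
      simpa only [min_eq_left (h _).le] using hN

theorem reassembleCofree_tensorToCofree (k N : ℕ) (z : C.obj k ⊗[R] (⨂[R]^k (Words C V 0))) :
    reassembleCofree C V k N (tensorToCofree k z) =
      Submodule.Quotient.mk (reassemble C V k (TensorProduct.map LinearMap.id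
        (PiTensorProduct.map fun _ => tangent C V) z)) := by
  induction z using TensorProduct.induction_on with
  | zero => simp
  | add a b ha hb => simp only [map_add, ha, hb, Submodule.Quotient.mk_add]
  | tmul c t =>
    induction t using PiTensorProduct.induction_on with
    | add a b ha hb =>
      simp only [TensorProduct.tmul_add, map_add, ha, hb, Submodule.Quotient.mk_add]
    | smul_tprod r x =>
      rw [TensorProduct.tmul_smul, map_smul, map_smul, map_smul, map_smul,
        Submodule.Quotient.mk_smul]
      congr 1
      rw [tensorToCofree, TensorProduct.map_tmul, TensorProduct.map_tmul,
        PiTensorProduct.map_tprod, PiTensorProduct.map_tprod, LinearMap.id_apply]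
      refine reassembleCofree_eq c fun i => ⟨x i, represents_toCofree N (x i), ?_⟩
      rw [sub_self]
      exact zero_mem _

/-- Grouplike elements are determined by their cogenerator parts. -/
theorem eq_of_grouplike {π : ∀ n, C.obj n →ₗ[R] C.obj n} (hπ : C.IsAveraging π) {v : V.carrier}
    {g g' : Cofree C V}
    (h : ∀ k N e, Represents N e g → tensorToCofree k (coproduct C V k e) - (1 : C.obj k) ⊗ₜ
      PiTensorProduct.tprod R (fun _ => g) ∈ tensorFil C V k N)
    (ht : ∀ N e, Represents N e g → tangent C V e - v ∈ V.F N)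
    (h' : ∀ k N e, Represents N e g' → tensorToCofree k (coproduct C V k e) - (1 : C.obj k) ⊗ₜ
      PiTensorProduct.tprod R (fun _ => g') ∈ tensorFil C V k N)
    (ht' : ∀ N e, Represents N e g' → tangent C V e - v ∈ V.F N) : g = g' := by
  have key : ∀ (x : Cofree C V),
      (∀ k N e, Represents N e x → tensorToCofree k (coproduct C V k e) - (1 : C.obj k) ⊗ₜ
        PiTensorProduct.tprod R (fun _ => x) ∈ tensorFil C V k N) →
      (∀ N e, Represents N e x → tangent C V e - v ∈ V.F N) →
      ∀ k N e, Represents N e x → spread C V 0 0 k e - reassemble C V k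
        ((1 : C.obj k) ⊗ₜ PiTensorProduct.tprod R fun _ => v) ∈ wordFil C V N := by
    intro x hx hxt k N e he
    -- Reassembling the grouplike identity expresses the norm of `e` in arity `k`, modulo step `N`,
    -- through `v` alone.
    have h1 := reassembleCofree_eq_zero (hx k N e he)
    rwa [map_sub, reassembleCofree_tensorToCofree, reassemble_coproduct, sub_eq_zero,
      reassembleCofree_eq (y := fun _ => v) 1 fun _ => ⟨e, he, hxt N e he⟩,
      Submodule.Quotient.eq] at h1
  refine Represents.eq fun N => ?_
  obtain ⟨e, he⟩ := exists_represents N g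
  obtain ⟨e', he'⟩ := exists_represents N g'
  refine ⟨e, he, he'.congr ?_⟩
  have h1 : symmetrize C V N e' - symmetrize C V N e ∈ wordFil C V N := by
    rw [symmetrize, LinearMap.sum_apply, LinearMap.sum_apply, ← Finset.sum_sub_distrib]
    refine Submodule.sum_mem _ fun k _ => ?_
    have := sub_mem (key g' h' ht' k N e' he') (key g h ht k N e he)
    rwa [sub_sub_sub_cancel_right] at this
  have h2 := sub_mem (sub_symmetrize_mem C V hπ N e') (sub_symmetrize_mem C V hπ N e)
  have h3 : averageWords C V π (symmetrize C V N e') -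
      averageWords C V π (symmetrize C V N e) ∈ fil C V N := by
    rw [← map_sub]
    exact Submodule.mem_sup_right (averageWords_mem C V π h1)
  have h4 := add_mem h2 h3
  rwa [sub_sub_sub_comm, sub_add_cancel] at h4

end Reassemble

/-! ### The one-parameter subgroup -/

section OneParameterSubgroup

variable {R : Type u} [CommRing R] {C : HopfCooperad.{u, w} R} {V : CompleteGradedModule.{u, v} R}
  {π : ∀ n, C.obj n →ₗ[R] C.obj n} {e : ∀ n, C.obj n}

variable (C V) in
/-- The linear extension of `g_r ↦ exp (r v)`. -/
def expSubgroup (e : ∀ n, C.obj n) (v : V.carrier) : AddMonoidAlgebra R R →ₗ[R] Cofree C V :=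
  Finsupp.linearCombination R (fun r : R => expElement C V e (r • v)) ∘ₗ
    (AddMonoidAlgebra.coeffLinearEquiv R).toLinearMap

theorem expSubgroup_single (e : ∀ n, C.obj n) (v : V.carrier) (r a : R) :
    expSubgroup C V e v (AddMonoidAlgebra.single r a) = a • expElement C V e (r • v) :=
  Finsupp.linearCombination_single R a r

theorem counit_symmetrizing (he : C.IsSymmetrizing e) : e 1 = 1 := by
  have h := (he 1).2
  rw [Fintype.sum_unique] at h
  rw [← h, Subsingleton.elim (default : Equiv.Perm (Fin 1)) (Equiv.refl _), C.map_refl]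

theorem tangent_expWord (he : C.IsSymmetrizing e) (v : V.carrier) {K : ℕ} (hK : 1 < K) :
    tangent C V (expWord C V e v K) = v := by
  rw [expWord, map_sum, Finset.sum_eq_single 1]
  · refine (tangent_lof_one C V (e 1) _).trans ?_
    rw [counit_symmetrizing he, map_one, one_smul]
  · exact fun n _ hn => tangent_lof_of_ne C V hn _
  · exact fun h => absurd (Finset.mem_range.mpr hK) h

theorem hasDegree_add {k : ℤ} {x y : Cofree C V} (hx : HasDegree k x) (hy : HasDegree k y) :
    HasDegree k (x + y) := fun N => by
  obtain ⟨a, ha, ha'⟩ := hx N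
  obtain ⟨b, hb, hb'⟩ := hy N
  exact ⟨a + b, add_mem ha hb, ha'.add hb'⟩

theorem hasDegree_smul {k : ℤ} (r : R) {x : Cofree C V} (hx : HasDegree k x) :
    HasDegree k (r • x) := fun N => by
  obtain ⟨a, ha, ha'⟩ := hx N
  exact ⟨r • a, Submodule.smul_mem _ r ha, ha'.smul r⟩

/-- Linearity reduces degree and multiplicativity to basis elements, where all axioms are properties
of the exponentials of `r v`. Multiplicativity is the addition law for `r v + s v`. -/
theorem isOneParameterSubgroup_expSubgroup (hπ : C.IsAveraging π) (he : C.IsSymmetrizing e)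
    {v : V.carrier} (hv : v ∈ V.deg 0) :
    IsOneParameterSubgroup v (expSubgroup C V e v) := by
  have hr : ∀ r : R, r • v ∈ V.deg 0 := fun r => Submodule.smul_mem _ r hv
  have h1 : ∀ r : R, expSubgroup C V e v (AddMonoidAlgebra.single r 1) =
      expElement C V e (r • v) := fun r => by rw [expSubgroup_single, one_smul]
  refine ⟨fun a => ?_, fun k N r y hy => ?_, ?_, fun a b => ?_, fun N r y hy => ?_⟩
  · induction a using AddMonoidAlgebra.induction_linear with
    | zero =>
      rw [map_zero]
      exact fun N => ⟨0, zero_mem _, rfl⟩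
    | add a b ha hb =>
      rw [map_add]
      exact hasDegree_add ha hb
    | single r a =>
      rw [expSubgroup_single]
      exact hasDegree_smul a (hasDegree_expElement C V he (hr r))
  · rw [h1] at hy ⊢
    exact expElement_grouplike C V hπ he (hr r) hy
  · rw [AddMonoidAlgebra.one_def, h1, zero_smul, expElement_zero C V hπ he]
  · induction a using AddMonoidAlgebra.induction_linear with
    | zero => simp
    | add a a' ha ha' => rw [add_mul, map_add, ha, ha', map_add, map_add, LinearMap.add_apply]
    | single r a =>
      induction b using AddMonoidAlgebra.induction_linear with
      | zero => simp
      | add b b' hb hb' => rw [mul_add, map_add, hb, hb', map_add, map_add]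
      | single s b =>
        rw [AddMonoidAlgebra.single_mul_single, expSubgroup_single, expSubgroup_single,
          expSubgroup_single, map_smul, map_smul, LinearMap.smul_apply,
          star_expElement_expElement C V hπ he (hr r) (hr s), add_smul, smul_smul, mul_comm]
  · rw [h1] at hy
    -- The truncation at `N + 2` contains the arity one term even for small `N`.
    have h2 := tangent_mem C V (hy.sub_mem
      (represents_expElement C V e (r • v) (Nat.le_add_right N 2)))
    rwa [map_sub, tangent_expWord he (r • v) (by omega)] at h2

/-- Each basis element is sent to a grouplike element with prescribed tangent vector, and these are
unique. -/
theorem IsOneParameterSubgroup.unique (hπ : C.IsAveraging π) {v : V.carrier}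
    {γ γ' : AddMonoidAlgebra R R →ₗ[R] Cofree C V} (h : IsOneParameterSubgroup v γ)
    (h' : IsOneParameterSubgroup v γ') : γ = γ' := by
  have h1 : ∀ r : R, γ (AddMonoidAlgebra.single r 1) = γ' (AddMonoidAlgebra.single r 1) :=
    fun r => eq_of_grouplike hπ (fun k N => h.coalgebra k N r) (fun N => h.tangent N r)
      (fun k N => h'.coalgebra k N r) (fun N => h'.tangent N r)
  refine LinearMap.ext fun a => ?_
  induction a using AddMonoidAlgebra.induction_linear with
  | zero => simp
  | add a b ha hb => rw [map_add, map_add, ha, hb]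
  | single r a =>
    have h2 : (AddMonoidAlgebra.single r a : AddMonoidAlgebra R R) =
        a • AddMonoidAlgebra.single r 1 := by
      rw [AddMonoidAlgebra.smul_single, smul_eq_mul, mul_one]
    rw [h2, map_smul, map_smul, h1]

theorem exp_eq (hπ : C.IsAveraging π) (he : C.IsSymmetrizing e) {v : V.carrier}
    (hv : v ∈ V.deg 0) : exp C v = expElement C V e v := by
  have h := isOneParameterSubgroup_expSubgroup hπ he hv
  have h1 : Classical.epsilon (IsOneParameterSubgroup (C := C) v) = expSubgroup C V e v :=
    (Classical.epsilon_spec ⟨_, h⟩ : IsOneParameterSubgroup v _).unique hπ h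
  rw [exp, h1, expSubgroup_single, one_smul, one_smul]

end OneParameterSubgroup

/-! ### Degrees and signs -/

theorem map_signInv {R : Type u} [CommRing R] {M : Type v} [AddCommGroup M] [Module R M]
    (𝒜 : ℤ → Submodule R M) [DirectSum.Decomposition 𝒜] {N : Type w} [AddCommGroup N] [Module R N]
    (ℬ : ℤ → Submodule R N) [DirectSum.Decomposition ℬ] (f : M →ₗ[R] N)
    (hf : ∀ i, ∀ x ∈ 𝒜 i, f x ∈ ℬ i) (x : M) : f (signInv 𝒜 x) = signInv ℬ (f x) := by
  rw [signInv, signInv, LinearMap.sub_apply, LinearMap.sub_apply, map_sub, parityPart, parityPart,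
    map_scaleByDegree 𝒜 ℬ _ f hf, map_scaleByDegree 𝒜 ℬ _ f hf]
  rfl

section Signs

variable {R : Type u} [CommRing R] (C : HopfCooperad.{u, w} R) (V : CompleteGradedModule.{u, v} R)

theorem signInv_obj_one (c : C.obj 1) : signInv (C.deg 1) c = c := by
  simpa using signInv_of_pure (C.deg 1) (parityPart_false_of_mem _ (C.mem_deg_one_zero c))

theorem wordSign_lof (n : ℕ) (c : C.obj n) (t : ⨂[R]^n V.carrier) :
    wordSign C V (DirectSum.lof R ℕ (Cell C V 0) n (c ⊗ₜ t)) =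
      DirectSum.lof R ℕ (Cell C V 0) n
        (signInv (C.deg n) c ⊗ₜ PiTensorProduct.map (fun _ => signInv V.deg) t) :=
  DirectSum.lmap_lof _ _ _

theorem mul_addInputs_deg {n m : ℕ} {c : C.obj n} (hc : c ∈ C.deg n 0) {i : ℤ} {c' : C.obj m}
    (hc' : c' ∈ C.deg m i) : C.addInputs n m c * C.addInputsLeft n m c' ∈ C.deg (n + m) i := by
  have h := SetLike.GradedMul.mul_mem (C.addInputs_deg n 0 hc m) (C.addInputsLeft_deg n m i hc')
  rwa [zero_add] at h

variable {e : ∀ n, C.obj n}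

/-- The exponential is even: `e n` has degree zero and `v` is even. This is used for the factors to
the left of `Q` in the coderivation operator, which carry Koszul signs. -/
theorem wordSign_starWords_expWord (he : C.IsSymmetrizing e) {v : V.carrier} (hv : v ∈ V.deg 0)
    (K : ℕ) (x : Words C V 0) :
    wordSign C V (starWords C V (expWord C V e v K) x) =
      starWords C V (expWord C V e v K) (wordSign C V x) := by
  have hv' : signInv V.deg v = v := by
    simpa using signInv_of_pure V.deg (parityPart_false_of_mem V.deg hv)
  induction x using words_induction C V with
  | h0 => simp
  | hadd a b ha hb => simp only [map_add, ha, hb]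
  | hsmul r a ha => simp only [map_smul, ha]
  | h m c x =>
    rw [expWord, map_sum, LinearMap.sum_apply, LinearMap.sum_apply, map_sum]
    refine Finset.sum_congr rfl fun n _ => ?_
    have h1 : PiTensorProduct.map (fun _ => signInv V.deg) (TensorPower.mulEquiv
        ((PiTensorProduct.tprod R fun _ : Fin n => v) ⊗ₜ[R] PiTensorProduct.tprod R x)) =
        TensorPower.mulEquiv ((PiTensorProduct.tprod R fun _ : Fin n => v) ⊗ₜ[R]
          PiTensorProduct.tprod R fun i => signInv V.deg (x i)) := by
      rw [mulEquiv_tprod, mulEquiv_tprod, PiTensorProduct.map_tprod]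
      congr 1
      funext i
      refine Fin.addCases (fun i => ?_) (fun i => ?_) i <;> simp [hv']
    have h2 := map_signInv (C.deg m) (C.deg (n + m))
      (LinearMap.mulLeft R (C.addInputs n m (e n)) ∘ₗ C.addInputsLeft n m)
      (fun i c hc => mul_addInputs_deg C (he n).1 hc) c
    simp only [LinearMap.comp_apply, LinearMap.mulLeft_apply] at h2
    rw [starWords_lof, starCell_even C V hv, wordSign_lof, wordSign_lof, starWords_lof,
      PiTensorProduct.map_tprod, starCell_even C V hv, h2, ← h1]

theorem starWords_expWord_mem_wordDeg (he : C.IsSymmetrizing e) {v : V.carrier}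
    (hv : v ∈ V.deg 0) (K : ℕ) {k : ℤ} {x : Words C V 0} (hx : x ∈ wordDeg C V k) :
    starWords C V (expWord C V e v K) x ∈ wordDeg C V k := by
  suffices h : wordDeg C V k ≤ (wordDeg C V k).comap (starWords C V (expWord C V e v K)) from h hx
  refine Submodule.span_le.mpr ?_
  rintro _ ⟨m, i, c, x, f, hc, hx, hk, rfl⟩
  rw [SetLike.mem_coe, Submodule.mem_comap, expWord, map_sum, LinearMap.sum_apply]
  refine Submodule.sum_mem _ fun n _ => ?_
  rw [starWords_lof, starCell_even C V hv, mulEquiv_tprod]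
  refine Submodule.subset_span ⟨n + m, i, _, _, Fin.append (fun _ => 0) f,
    mul_addInputs_deg C (he n).1 hc, fun j => ?_, ?_, rfl⟩
  · refine Fin.addCases (fun j => ?_) (fun j => ?_) j <;> simp [hv, hx]
  · simpa [Fin.sum_univ_add] using hk

theorem wordSign_mem {N : ℕ} {x : Words C V 0} (hx : x ∈ fil C V N) :
    wordSign C V x ∈ fil C V N := by
  obtain ⟨a, ha, b, hb, rfl⟩ := Submodule.mem_sup.mp hx
  rw [map_add]
  refine add_mem (Submodule.mem_sup_left ?_) (Submodule.mem_sup_right ?_)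
  · suffices h : coinvRel C V ≤ (coinvRel C V).comap (wordSign C V) from h ha
    refine Submodule.span_le.mpr ?_
    rintro _ ⟨n, σ, z, rfl⟩
    rw [SetLike.mem_coe, Submodule.mem_comap, map_sub]
    induction z using TensorProduct.induction_on with
    | zero => simp
    | add a b ha hb =>
      simp only [map_add]
      rw [add_sub_add_comm]
      exact add_mem ha hb
    | tmul c t =>
      refine Submodule.subset_span ⟨n, σ,
        signInv (C.deg n) c ⊗ₜ PiTensorProduct.map (fun _ => signInv V.deg) t, ?_⟩
      rw [act_zero_tmul, wordSign_lof, wordSign_lof, act_zero_tmul, map_signInv_signedReindex]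
      have h := map_signInv (C.deg n) (C.deg n) (C.map σ).toLinearMap (C.map_deg σ) c
      rw [AlgHom.toLinearMap_apply, AlgHom.toLinearMap_apply] at h
      rw [h]
  · suffices h : wordFil C V N ≤ (wordFil C V N).comap (wordSign C V) from h hb
    refine Submodule.span_le.mpr ?_
    rintro _ ⟨n, c, x, w, hw, hN, rfl⟩
    rw [SetLike.mem_coe, Submodule.mem_comap, wordSign_lof, PiTensorProduct.map_tprod]
    exact Submodule.subset_span ⟨n, _, _, w, fun i => signInv_mem_F V (hw i), hN, rfl⟩

theorem tangent_wordSign (x : Words C V 0) :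
    tangent C V (wordSign C V x) = signInv V.deg (tangent C V x) := by
  induction x using words_induction C V with
  | h0 => simp
  | hadd a b ha hb => simp only [map_add, ha, hb]
  | hsmul r a ha => simp only [map_smul, ha]
  | h n c x =>
    rcases eq_or_ne n 1 with rfl | hn
    · have h1 : wordSign C V (DirectSum.lof R ℕ (Cell C V 0) 1
          (c ⊗ₜ PiTensorProduct.tprod R x)) = DirectSum.lof R ℕ (Cell C V 0) 1
          (c ⊗ₜ PiTensorProduct.tprod R fun i => signInv V.deg (x i)) := by
        refine (wordSign_lof C V 1 c _).trans ?_
        rw [PiTensorProduct.map_tprod, signInv_obj_one]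
      rw [h1]
      refine (tangent_lof_one C V c _).trans ?_
      rw [← map_smul]
      exact congrArg _ (tangent_lof_one C V c x).symm
    · rw [wordSign_lof]
      refine (tangent_lof_of_ne C V hn _).trans ?_
      have h1 := tangent_lof_of_ne C V hn ((c : C.obj n) ⊗ₜ PiTensorProduct.tprod R x)
      exact (congrArg _ h1).trans (map_zero _) |>.symm

end Signs

/-! ### Coderivations -/

section Coderivation

variable {R : Type u} [CommRing R] {C : HopfCooperad.{u, w} R} {V : CompleteGradedModule.{u, v} R}

theorem IsFiltered.comp {f : Words C V 0 →ₗ[R] Cofree C V} (hf : IsFiltered f)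
    {L : Cofree C V →ₗ[R] Cofree C V} (hL : ∀ N x, InFil N x → InFil N (L x)) :
    IsFiltered (L ∘ₗ f) := fun N e he => hL N _ (hf N e he)

theorem isFiltered_toCofree_wordSign : IsFiltered (toCofree C V ∘ₗ wordSign C V) :=
  fun _ _ he => toCofree_mem.mpr (wordSign_mem C V he)

theorem inFil_star {N : ℕ} (y : Cofree C V) {x : Cofree C V} (hx : InFil N x) :
    InFil N (star C V y x) := by
  obtain ⟨a, ha⟩ := exists_represents N y
  have h := represents_star ha hx
  rwa [map_zero] at h

theorem map_sub_mem_cofreeFil {L : Cofree C V →ₗ[R] Cofree C V}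
    (hL : ∀ N x, InFil N x → InFil N (L x)) {N : ℕ} {x y : Cofree C V}
    (h : x - y ∈ cofreeFil C V N) : L x - L y ∈ cofreeFil C V N := by
  have h1 : x = y + (x - y) := (add_sub_cancel y x).symm
  have h2 : L x - L y = L (x - y) := by
    conv_lhs => rw [h1, map_add]
    exact add_sub_cancel_left (L y) (L (x - y))
  rw [h2]
  exact hL N _ h

/-- The `j`-th family of maps in `coderivationOp`. -/
def coderivationMap (Q : Cofree C V →ₗ[R] Cofree C V) {k : ℕ} (j i : Fin k) :
    Words C V 0 →ₗ[R] Cofree C V :=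
  if i < j then toCofree C V ∘ₗ wordSign C V else if i = j then Q ∘ₗ toCofree C V else toCofree C V

theorem coderivationOp_apply (Q : Cofree C V →ₗ[R] Cofree C V) (k : ℕ)
    (z : C.obj k ⊗[R] (⨂[R]^k (Words C V 0))) :
    coderivationOp Q k z =
      TensorProduct.map (C.d k) (PiTensorProduct.map fun _ => toCofree C V) z +
      ∑ j : Fin k, TensorProduct.map (signInv (C.deg k))
        (PiTensorProduct.map (coderivationMap Q j)) z := by
  rw [coderivationOp, LinearMap.add_apply, LinearMap.sum_apply]
  rfl

theorem isFiltered_coderivationMap {Q : Cofree C V →ₗ[R] Cofree C V}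
    (hQ : ∀ N x, InFil N x → InFil N (Q x)) {k : ℕ} (j i : Fin k) :
    IsFiltered (coderivationMap Q j i) := by
  rw [coderivationMap]
  split_ifs
  · exact isFiltered_toCofree_wordSign
  · exact isFiltered_toCofree.comp hQ
  · exact isFiltered_toCofree

theorem map_mem_tensorFil {L : Cofree C V →ₗ[R] Cofree C V}
    (hL : ∀ N x, InFil N x → InFil N (L x)) {k N : ℕ} {z : C.obj k ⊗[R] (⨂[R]^k (Cofree C V))}
    (hz : z ∈ tensorFil C V k N) :
    TensorProduct.map LinearMap.id (PiTensorProduct.map fun _ => L) z ∈ tensorFil C V k N := by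
  suffices h : tensorFil C V k N ≤ (tensorFil C V k N).comap
      (TensorProduct.map LinearMap.id (PiTensorProduct.map fun _ => L)) from h hz
  refine Submodule.span_le.mpr ?_
  rintro _ ⟨c, x, w, hx, hN, rfl⟩
  refine Submodule.subset_span ⟨c, fun i => L (x i), w, fun i => hL _ _ (hx i), hN, ?_⟩
  rw [TensorProduct.map_tmul, PiTensorProduct.map_tprod, LinearMap.id_apply]

theorem map_id_map_map {k : ℕ} {X Y Z : Type*} [AddCommMonoid X] [Module R X] [AddCommMonoid Y]
    [Module R Y] [AddCommMonoid Z] [Module R Z] (ψ : C.obj k →ₗ[R] C.obj k)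
    (f : Fin k → X →ₗ[R] Y) (L : Y →ₗ[R] Z) (z : C.obj k ⊗[R] (⨂[R]^k X)) :
    TensorProduct.map LinearMap.id (PiTensorProduct.map fun _ => L)
      (TensorProduct.map ψ (PiTensorProduct.map f) z) =
    TensorProduct.map ψ (PiTensorProduct.map fun i => L ∘ₗ f i) z := by
  rw [PiTensorProduct.map_comp, ← LinearMap.id_comp ψ, TensorProduct.map_comp]
  rfl

variable {π : ∀ n, C.obj n →ₗ[R] C.obj n} {e : ∀ n, C.obj n}

/-- The multiplication by `exp (-v)` of a family of filtered maps, evaluated on a coproduct, in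
terms of the conjugated family. -/
theorem map_star_expElement_sub_mem (hπ : C.IsAveraging π) (he : C.IsSymmetrizing e)
    {v : V.carrier} (hv : v ∈ V.deg 0) {k N K : ℕ} (hN : N ≤ K) (hK : k * N < K)
    (ψ : C.obj k →ₗ[R] C.obj k) {f g : Fin k → Words C V 0 →ₗ[R] Cofree C V}
    (hf : ∀ i, IsFiltered (f i)) {L : Cofree C V →ₗ[R] Cofree C V}
    (hL : ∀ N x, InFil N x → InFil N (L x))
    (hg : ∀ i x, L (f i (starWords C V (expWord C V e v K) x)) - g i x ∈ cofreeFil C V N)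
    (x : Words C V 0) :
    TensorProduct.map LinearMap.id (PiTensorProduct.map fun _ => L)
        (TensorProduct.map ψ (PiTensorProduct.map f)
          (coproduct C V k (starWords C V (expWord C V e v K) x))) -
      TensorProduct.map ψ (PiTensorProduct.map g) (coproduct C V k x) ∈ tensorFil C V k N := by
  rw [map_id_map_map]
  have h1 := map_coproduct_expWord_sub_mem hπ he hv hN hK ψ
    (f := fun i => L ∘ₗ f i) (fun i => (hf i).comp hL) x
  have h2 := map_sub_map_mem_tensorFil (N := N) ψ
    (f := fun i => (L ∘ₗ f i) ∘ₗ starWords C V (expWord C V e v K)) (g := g)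
    (fun i y => hg i y) (coproduct C V k x)
  have h3 := add_mem h1 h2
  rwa [sub_add_sub_cancel] at h3

theorem toCofree_starWords_sub_mem {v : V.carrier} {N K : ℕ} (hN : N ≤ K) (x : Words C V 0) :
    toCofree C V (starWords C V (expWord C V e v K) x) -
      star C V (expElement C V e v) (toCofree C V x) ∈ cofreeFil C V N := by
  have h := represents_star (represents_expElement C V e v hN) (represents_toCofree N x)
  exact sub_eq_zero.mpr h.symm

/-- Conjugation by the exponential, for the exponential as an explicit element. -/
def conjugate (e : ∀ n, C.obj n) (v : V.carrier) (Q : Cofree C V →ₗ[R] Cofree C V) :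
    Cofree C V →ₗ[R] Cofree C V :=
  star C V (expElement C V e (-v)) ∘ₗ Q ∘ₗ star C V (expElement C V e v)

theorem star_expElement_neg_star (hπ : C.IsAveraging π) (he : C.IsSymmetrizing e)
    {v : V.carrier} (hv : v ∈ V.deg 0) (x : Cofree C V) :
    star C V (expElement C V e (-v)) (star C V (expElement C V e v) x) = x := by
  rw [star_expElement_star C V hπ he (neg_mem hv) hv, neg_add_cancel,
    star_expElement_zero C V hπ he]

theorem star_expElement_star_neg (hπ : C.IsAveraging π) (he : C.IsSymmetrizing e)
    {v : V.carrier} (hv : v ∈ V.deg 0) (x : Cofree C V) :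
    star C V (expElement C V e v) (star C V (expElement C V e (-v)) x) = x := by
  rw [star_expElement_star C V hπ he hv (neg_mem hv), add_neg_cancel,
    star_expElement_zero C V hπ he]

/-- Conjugation acts factor by factor. On factors without `Q` the two exponentials cancel, also
across the sign involution since they are even; the factor with `Q` becomes the conjugate of `Q`. -/
theorem conjugate_coderivationMap (hπ : C.IsAveraging π) (he : C.IsSymmetrizing e)
    {v : V.carrier} (hv : v ∈ V.deg 0) {Q : Cofree C V →ₗ[R] Cofree C V}
    (hQ : ∀ N x, InFil N x → InFil N (Q x)) {N K : ℕ} (hN : N ≤ K) {k : ℕ} (j i : Fin k)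
    (x : Words C V 0) :
    star C V (expElement C V e (-v)) (coderivationMap Q j i
      (starWords C V (expWord C V e v K) x)) -
        coderivationMap (conjugate e v Q) j i x ∈ cofreeFil C V N := by
  have hsub : ∀ L : Cofree C V →ₗ[R] Cofree C V, (∀ N x, InFil N x → InFil N (L x)) →
      ∀ y, L (toCofree C V (starWords C V (expWord C V e v K) y)) -
        L (star C V (expElement C V e v) (toCofree C V y)) ∈ cofreeFil C V N :=
    fun L hL y => map_sub_mem_cofreeFil hL (toCofree_starWords_sub_mem hN y)
  have hL : ∀ N x, InFil N x → InFil N (star C V (expElement C V e (-v)) x) :=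
    fun N x hx => inFil_star _ hx
  rw [coderivationMap, coderivationMap]
  split_ifs
  · have h := hsub _ hL (wordSign C V x)
    rw [star_expElement_neg_star hπ he hv] at h
    rw [LinearMap.comp_apply, LinearMap.comp_apply, wordSign_starWords_expWord C V he hv]
    exact h
  · exact hsub (star C V (expElement C V e (-v)) ∘ₗ Q) (fun N x hx => hL N _ (hQ N x hx)) x
  · have h := hsub _ hL x
    rwa [star_expElement_neg_star hπ he hv] at h

/-- The conjugate of a coderivation is a coderivation. -/
theorem conjugate_coderivation (hπ : C.IsAveraging π) (he : C.IsSymmetrizing e)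
    {v : V.carrier} (hv : v ∈ V.deg 0) {Q : Cofree C V →ₗ[R] Cofree C V}
    (hQ : ∀ N x, InFil N x → InFil N (Q x))
    (hQ' : ∀ k N (x : Cofree C V) (y y' : Words C V 0), Represents N y x →
      Represents N y' (Q x) → tensorToCofree k (coproduct C V k y') -
        coderivationOp Q k (coproduct C V k y) ∈ tensorFil C V k N)
    {k N : ℕ} {x : Cofree C V} {y y' : Words C V 0} (hy : Represents N y x)
    (hy' : Represents N y' (conjugate e v Q x)) :
    tensorToCofree k (coproduct C V k y') -
      coderivationOp (conjugate e v Q) k (coproduct C V k y) ∈ tensorFil C V k N := by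
  have hN : N ≤ k * N + N + 1 := by omega
  have hK : k * N < k * N + N + 1 := by omega
  generalize k * N + N + 1 = K at hN hK
  set L := star C V (expElement C V e (-v)) with hLdef
  have hL : ∀ N x, InFil N x → InFil N (L x) := fun N x hx => inFil_star _ hx
  obtain ⟨b, hb⟩ := exists_represents N (Q (star C V (expElement C V e v) x))
  have ha := represents_star (represents_expElement C V e v hN) hy
  have hb' := represents_star (represents_expElement C V e (-v) hN) hb
  -- The difference telescopes. `h1` replaces `y'` by an explicit representative, `h2` moves `exp
  -- (-v)` through the coproduct, `h3` replaces its truncation by `L`, and `h4` is the coderivation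
  -- identity for `Q` at `exp v ⋆ x`, transported by `L` on every factor. Finally `h5` and `h6` move
  -- `exp v` into the factors, for the differential term and for the terms with `Q`.
  have h1 := map_coproduct_mem_tensorFil hπ (LinearMap.id : C.obj k →ₗ[R] C.obj k)
    (fun _ : Fin k => isFiltered_toCofree) (hy'.sub_mem hb')
  rw [map_sub, map_sub] at h1
  have h2 := map_coproduct_expWord_sub_mem hπ he (neg_mem hv) hN hK LinearMap.id
    (fun _ : Fin k => isFiltered_toCofree) b
  have h3 := map_sub_map_mem_tensorFil (N := N) (LinearMap.id : C.obj k →ₗ[R] C.obj k)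
    (f := fun _ => toCofree C V ∘ₗ starWords C V (expWord C V e (-v) K))
    (g := fun _ => L ∘ₗ toCofree C V)
    (fun _ m => toCofree_starWords_sub_mem hN m) (coproduct C V k b)
  have h4 := map_mem_tensorFil hL (hQ' k N _ _ _ ha hb)
  rw [map_sub, coderivationOp_apply, map_add, map_sum, tensorToCofree, map_id_map_map] at h4
  have h5 := map_star_expElement_sub_mem hπ he hv hN hK (C.d k)
    (fun _ : Fin k => isFiltered_toCofree) (g := fun _ => toCofree C V) hL (fun _ m => by
      have h := map_sub_mem_cofreeFil hL (toCofree_starWords_sub_mem (e := e) (v := v) hN m)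
      rwa [hLdef, star_expElement_neg_star hπ he hv] at h) y
  have h6 := Submodule.sum_mem (tensorFil C V k N) fun (j : Fin k) (_ : j ∈ Finset.univ) =>
    map_star_expElement_sub_mem hπ he hv hN hK (signInv (C.deg k))
      (isFiltered_coderivationMap hQ j) hL
      (conjugate_coderivationMap hπ he hv hQ hN j) y
  rw [Finset.sum_sub_distrib] at h6
  rw [coderivationOp_apply]
  have h7 := add_mem (add_mem (add_mem (add_mem (add_mem h1 h2) h3) h4) h5) h6
  convert h7 using 1
  simp only [tensorToCofree]
  abel

end Coderivation

/-! ### Coderivations raise the arity by at most one -/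

section Arity

variable {R : Type u} [CommRing R] {C : HopfCooperad.{u, w} R} {V : CompleteGradedModule.{u, v} R}

/-- Reassembly sees each factor only through its cogenerator part modulo step `N`. Thus the factors
without `Q` may be projected to arity one. -/
theorem reassembleCofree_congr {A : Type*} [AddCommMonoid A] [Module R A] {k N : ℕ}
    (ψ : A →ₗ[R] C.obj k) {f g : Fin k → Words C V 0 →ₗ[R] Cofree C V}
    (h : ∀ i m, ∃ y, Represents N y (f i m - g i m) ∧ tangent C V y ∈ V.F N)
    (z : A ⊗[R] (⨂[R]^k (Words C V 0))) :
    reassembleCofree C V k N (TensorProduct.map ψ (PiTensorProduct.map f) z) =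
      reassembleCofree C V k N (TensorProduct.map ψ (PiTensorProduct.map g) z) := by
  have h1 := map_sub_map_mem ψ f g (LinearMap.ker (reassembleCofree C V k N))
    (fun _ x => ∃ y, Represents N y x ∧ tangent C V y ∈ V.F N)
    (fun j m => ⟨f j m - g j m, h j m, (add_sub_cancel (g j m) (f j m)).symm⟩)
    (fun c j x ⟨y, hy, hy'⟩ => by
      have h2 : ∀ i, ∃ y, Represents N y (x i) ∧
          tangent C V y - Function.update (fun i => tangentRep C V N (x i)) j 0 i ∈ V.F N := by
        intro i
        rcases eq_or_ne i j with rfl | hi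
        · exact ⟨y, hy, by simpa using hy'⟩
        · obtain ⟨y', hy'⟩ := exists_represents N (x i)
          refine ⟨y', hy', ?_⟩
          rw [Function.update_of_ne hi]
          exact tangent_sub_tangentRep_mem hy'
      rw [LinearMap.mem_ker, reassembleCofree_eq c h2, MultilinearMap.map_update_zero,
        TensorProduct.tmul_zero, map_zero, Submodule.Quotient.mk_zero]) z
  rwa [LinearMap.mem_ker, map_sub, sub_eq_zero] at h1

theorem tangent_spread_one (x : Words C V 0) :
    tangent C V (spread C V 0 0 1 x) = tangent C V x := by
  have h := tangent_spread C V (zero_mem (V.deg 0)) x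
  rw [smul_zero] at h
  rw [h]
  simp

variable {π : ∀ n, C.obj n →ₗ[R] C.obj n}

/-- In each term at least `k - 1` factors matter only in arity one, and the factor with `Q` has some
arity `≥ 0`. The total arity is at least `k - 1 > n`, where the norms of `y` vanish, and with them
the symmetrized coproduct. -/
theorem reassembleCofree_coderivationOp (hπ : C.IsAveraging π) {Q : Cofree C V →ₗ[R] Cofree C V}
    (hQ : ∀ N x, InFil N x → InFil N (Q x)) {n k : ℕ} (hk : n + 1 < k) (N : ℕ)
    {y : Words C V 0} (hy : ∀ m, n < m → spread C V 0 0 m y = 0) :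
    reassembleCofree C V k N (coderivationOp Q k (coproduct C V k y)) = 0 := by
  have hone : ∀ (f : Words C V 0 →ₗ[R] Words C V 0), (∀ z, tangent C V (f z) =
      tangent C V (f (spread C V 0 0 1 z))) → ∀ z, ∃ y, Represents N y
        ((toCofree C V ∘ₗ f) z - ((toCofree C V ∘ₗ f) ∘ₗ ∑ a ∈ {1}, spread C V 0 0 a) z) ∧
          tangent C V y ∈ V.F N := by
    intro f hf z
    refine ⟨f z - f (spread C V 0 0 1 z), ?_, ?_⟩
    · rw [Finset.sum_singleton]
      rfl
    · rw [map_sub, hf z, sub_self]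
      exact zero_mem _
  have hid : ∀ z, tangent C V ((LinearMap.id : Words C V 0 →ₗ[R] Words C V 0) z) =
      tangent C V ((LinearMap.id : Words C V 0 →ₗ[R] Words C V 0) (spread C V 0 0 1 z)) :=
    fun z => (tangent_spread_one z).symm
  have hsign : ∀ z, tangent C V (wordSign C V z) =
      tangent C V (wordSign C V (spread C V 0 0 1 z)) := fun z => by
    rw [tangent_wordSign, tangent_wordSign, tangent_spread_one]
  rw [coderivationOp_apply, map_add, map_sum]
  have h1 : reassembleCofree C V k N (TensorProduct.map (C.d k)
      (PiTensorProduct.map fun _ => toCofree C V) (coproduct C V k y)) = 0 := by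
    rw [reassembleCofree_congr (f := fun _ => toCofree C V)
        (g := fun _ => (toCofree C V ∘ₗ LinearMap.id) ∘ₗ ∑ a ∈ {1}, spread C V 0 0 a) (C.d k) (fun _ => hone _ hid),
      map_map_comp_sum_spread C V _ _ fun _ => {1}, Finset.sum_eq_zero, map_zero]
    intro a ha
    have ha' : ∀ i, a i = 1 := fun i => Finset.mem_singleton.mp (Fintype.mem_piFinset.mp ha i)
    rw [map_coproduct_eq_zero C V, map_zero]
    refine hy _ ?_
    simp only [ha', Finset.sum_const, Finset.card_univ, Fintype.card_fin, smul_eq_mul, mul_one]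
    omega
  rw [h1, zero_add]
  refine Finset.sum_eq_zero fun j _ => ?_
  let g : Fin k → Words C V 0 →ₗ[R] Cofree C V := fun i =>
    if i < j then toCofree C V ∘ₗ wordSign C V else if i = j then
      (Q ∘ₗ toCofree C V) ∘ₗ averageWords C V π else toCofree C V ∘ₗ LinearMap.id
  -- Arities that can contribute: any below `N` in the factor fed into `Q`, which is recovered from
  -- its norms by averaging, and exactly one in every other factor.
  let s : Fin k → Finset ℕ := fun i => if i = j then Finset.range N else {1}
  have h2 : ∀ i z, ∃ y, Represents N y
      (coderivationMap Q j i z - (g i ∘ₗ ∑ a ∈ s i, spread C V 0 0 a) z) ∧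
        tangent C V y ∈ V.F N := by
    intro i z
    rcases lt_trichotomy i j with hi | rfl | hi
    · simp only [coderivationMap, g, s, if_pos hi, if_neg hi.ne]
      exact hone _ hsign z
    · simp only [coderivationMap, g, s, if_neg (lt_irrefl i), if_true]
      refine ⟨0, ?_, by rw [map_zero]; exact zero_mem _⟩
      exact (isFiltered_toCofree.comp hQ).sub_mem (sub_symmetrize_mem C V hπ N z)
    · simp only [coderivationMap, g, s, if_neg hi.not_gt, if_neg hi.ne']
      exact hone _ hid z
  rw [reassembleCofree_congr (g := fun i => g i ∘ₗ ∑ a ∈ s i, spread C V 0 0 a) _ h2,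
    map_map_comp_sum_spread, Finset.sum_eq_zero, map_zero]
  intro a ha
  rw [map_coproduct_eq_zero C V, map_zero]
  refine hy _ ?_
  have h3 : ∑ i ∈ Finset.univ.erase j, a i = k - 1 := by
    rw [Finset.sum_congr rfl (g := fun _ => 1), Finset.sum_const,
      Finset.card_erase_of_mem (Finset.mem_univ j), Finset.card_univ, Fintype.card_fin,
      smul_eq_mul, mul_one]
    intro i hi
    have := Fintype.mem_piFinset.mp ha i
    simp only [s, if_neg (Finset.ne_of_mem_erase hi)] at this
    exact Finset.mem_singleton.mp this
  have h4 := Finset.sum_le_sum_of_subset (f := a) (Finset.erase_subset j Finset.univ)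
  omega

theorem spread_eq_lof (n : ℕ) (x : Words C V 0) :
    ∃ z, spread C V 0 0 n x = DirectSum.lof R ℕ (Cell C V 0) n z := by
  induction x using words_induction_lof C V with
  | h0 => exact ⟨0, by simp⟩
  | hadd a b ha hb =>
    obtain ⟨y, hy⟩ := ha
    obtain ⟨z, hz⟩ := hb
    exact ⟨y + z, by rw [map_add, hy, hz, map_add]⟩
  | h m z => exact ⟨_, (spread_lof C V 0 0 m n z).trans (map_sum _ _ _).symm⟩

theorem spread_mem_wordFil {N n : ℕ} (h : N ≤ n) (x : Words C V 0) :
    spread C V 0 0 n x ∈ wordFil C V N := by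
  obtain ⟨z, hz⟩ := spread_eq_lof n x
  rw [hz]
  exact lof_mem_wordFil C V h z

theorem spread_eq_zero_of_arity {n : ℕ} {x : Words C V 0} (hx : ∀ m, n < m → x m = 0) {m : ℕ}
    (hm : n < m) : spread C V 0 0 m x = 0 := by
  classical
  rw [← DirectSum.sum_support_of x, map_sum]
  refine Finset.sum_eq_zero fun l hl => ?_
  have hl' : l ≤ n := by
    by_contra h
    exact (DFinsupp.mem_support_iff.mp hl) (hx l (by omega))
  exact spread_zero_lof_of_ne C V 0 (by omega) (x l)

/-- Filtered coderivations raise the arity by at most one. -/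
theorem arityLE_of_coderivation (hπ : C.IsAveraging π) {Q : Cofree C V →ₗ[R] Cofree C V}
    (hQ : ∀ N x, InFil N x → InFil N (Q x))
    (hQ' : ∀ k N (x : Cofree C V) (y y' : Words C V 0), Represents N y x →
      Represents N y' (Q x) → tensorToCofree k (coproduct C V k y') -
        coderivationOp Q k (coproduct C V k y) ∈ tensorFil C V k N)
    {n : ℕ} {x : Cofree C V} (hx : ArityLE n x) : ArityLE (n + 1) (Q x) := by
  intro N
  obtain ⟨y, hy, hyx⟩ := hx N
  obtain ⟨y', hy'⟩ := exists_represents N (Q x)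
  have h1 : ∀ k, n + 1 < k → spread C V 0 0 k y' ∈ wordFil C V N := by
    intro k hk
    have h := reassembleCofree_eq_zero (hQ' k N x y y' hyx hy')
    rwa [map_sub, reassembleCofree_coderivationOp hπ hQ hk N
      (fun m hm => spread_eq_zero_of_arity hy hm), sub_zero, reassembleCofree_tensorToCofree,
      reassemble_coproduct, Submodule.Quotient.mk_eq_zero] at h
  -- The norms of `y'` in arities above `n + 1` lie in step `N`, so discarding them before averaging
  -- leaves a representative of bounded arity.
  refine ⟨averageWords C V π (symmetrize C V (n + 2) y'), fun m hm => ?_, hy'.congr ?_⟩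
  · have h2 : symmetrize C V (n + 2) y' m = 0 := by
      rw [symmetrize, LinearMap.sum_apply, DirectSum.sum_apply]
      refine Finset.sum_eq_zero fun a ha => ?_
      obtain ⟨z, hz⟩ := spread_eq_lof a y'
      rw [hz]
      exact DirectSum.of_eq_of_ne _ _ _ (by have := Finset.mem_range.mp ha; omega)
    rw [averageWords, DirectSum.lmap_apply, h2, map_zero]
  · have h2 : symmetrize C V N y' - symmetrize C V (n + 2) y' ∈ wordFil C V N := by
      rw [symmetrize, symmetrize, LinearMap.sum_apply, LinearMap.sum_apply]
      rcases le_total (n + 2) N with h | h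
      · rw [← Finset.sum_Ico_eq_sub _ h]
        exact Submodule.sum_mem _ fun k hk => h1 k (by have := Finset.mem_Ico.mp hk; omega)
      · rw [← neg_mem_iff, neg_sub, ← Finset.sum_Ico_eq_sub _ h]
        exact Submodule.sum_mem _ fun k hk => spread_mem_wordFil (Finset.mem_Ico.mp hk).1 y'
    have h3 := add_mem (sub_symmetrize_mem C V hπ N y')
      (Submodule.mem_sup_right (averageWords_mem C V π h2) : _ ∈ fil C V N)
    rwa [map_sub, sub_add_sub_cancel] at h3

end Arity

/-! ### The twist -/

section Twist

variable {R : Type u} [CommRing R] {C : HopfCooperad.{u, w} R} {V : CompleteGradedModule.{u, v} R}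
  {π : ∀ n, C.obj n →ₗ[R] C.obj n} {e : ∀ n, C.obj n}

theorem hasDegree_star_expElement (he : C.IsSymmetrizing e) {v : V.carrier} (hv : v ∈ V.deg 0)
    {k : ℤ} {x : Cofree C V} (hx : HasDegree k x) :
    HasDegree k (star C V (expElement C V e v) x) := fun N => by
  obtain ⟨y, hy, hy'⟩ := hx N
  exact ⟨_, starWords_expWord_mem_wordDeg C V he hv N hy,
    represents_star (represents_expElement C V e v le_rfl) hy'⟩

/-- The square is conjugate to the square of `Q`, as the inner exponentials cancel. The arity bound
is obtained from the coderivation property of the conjugate. -/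
theorem isCurvedAlgebra_conjugate (hπ : C.IsAveraging π) (he : C.IsSymmetrizing e)
    {v : V.carrier} (hv : v ∈ V.deg 0) {Q : Cofree C V →ₗ[R] Cofree C V}
    (hQ : IsCurvedAlgebra Q) : IsCurvedAlgebra (conjugate e v Q) := by
  have hfil : ∀ N x, InFil N x → InFil N (conjugate e v Q x) := fun N x hx =>
    inFil_star _ (hQ.filtered N _ (inFil_star _ hx))
  have hcod : ∀ k N (x : Cofree C V) (y y' : Words C V 0), Represents N y x →
      Represents N y' (conjugate e v Q x) → tensorToCofree k (coproduct C V k y') -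
        coderivationOp (conjugate e v Q) k (coproduct C V k y) ∈ tensorFil C V k N :=
    fun k N x y y' hy hy' => conjugate_coderivation hπ he hv hQ.filtered hQ.coderivation hy hy'
  refine ⟨hfil, fun k x hx => ?_, fun n x hx => ⟨n + 1, arityLE_of_coderivation hπ hfil hcod hx⟩,
    hcod, fun x => ?_⟩
  · exact hasDegree_star_expElement he (neg_mem hv)
      (hQ.degree k _ (hasDegree_star_expElement he hv hx))
  · simp only [conjugate, LinearMap.comp_apply]
    rw [star_expElement_star_neg hπ he hv, hQ.square_zero, map_zero]

end Twist

end CurvedTwist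

end

theorem mainTheorem2 {R : Type u} [CommRing R] (C : CurvedTwist.HopfCooperad.{u, w} R)
    (hC : C.IsSymmetricFree ∨ Nonempty (Algebra ℚ R))
    (V : CurvedTwist.CompleteGradedModule.{u, v} R)
    (Q : CurvedTwist.Cofree C V →ₗ[R] CurvedTwist.Cofree C V)
    (hQ : CurvedTwist.IsCurvedAlgebra Q) (v : V.carrier) (hv : v ∈ V.deg 0) :
    (∃! γ : AddMonoidAlgebra R R →ₗ[R] CurvedTwist.Cofree C V,
      CurvedTwist.IsOneParameterSubgroup v γ) ∧
    CurvedTwist.IsCurvedAlgebra (CurvedTwist.twist Q v) := by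
  obtain ⟨π, hπ⟩ := C.exists_averaging hC
  obtain ⟨e, he⟩ := C.exists_symmetrizing hπ
  refine ⟨⟨CurvedTwist.expSubgroup C V e v,
    CurvedTwist.isOneParameterSubgroup_expSubgroup hπ he hv, fun γ hγ =>
      hγ.unique hπ (CurvedTwist.isOneParameterSubgroup_expSubgroup hπ he hv)⟩, ?_⟩
  -- By uniqueness of the one-parameter subgroup, the exponential obtained by choice is the explicit
  -- one, for `v` and for `-v`.
  rw [CurvedTwist.twist, CurvedTwist.exp_eq hπ he hv, CurvedTwist.exp_eq hπ he (neg_mem hv)]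
  exact CurvedTwist.isCurvedAlgebra_conjugate hπ he hv hQ
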